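/- **Setting.** Let $E$ be a real $d\times d$ matrix, $d\ge 1$, all of whose (complex) eigenvalues have positive real part; let $0<a_1<\dots<a_p$ be the distinct real parts of its eigenvalues and $q=\operatorname{trace}(E)$. For $c>0$ put $c^E=\exp(E\log c)$. Let $V_i\subset\mathbb R^d$ be the spectral subspace belonging to $a_i$, i.e. the real vectors in the sum of the complex generalized eigenspaces of $E$ for the eigenvalues with real part $a_i$; let $W_i=V_1\oplus\dots\oplus V_i$ and $W_0=\{0\}$. Let $\|x\|_0=\int_0^1\|t^Ex\|\,\frac{dt}{t}$; every $x\ne 0$ is uniquely $x=\tau(x)^E\theta$ with $\tau(x)>0$ and $\|\theta\|_0=1$; put $\tau(0)=0$. A function $\varphi:\mathbb R^d\to[0,\infty)$ is $E$-homogeneous if $\varphi(c^Ex)=c\,\varphi(x)$ for all $c>0$ and $x\neq0$. For $\beta>0$ it is $(\beta,E)$-admissible if it is continuous, $\varphi(x)>0$ for $x\ne 0$, and for all $0<A<B$ there is $C>0$ such that $|\varphi(x+y)-\varphi(y)|\le C\,\tau(x)^\beta$ whenever $A\le\|y\|\le B$ and $\tau(x)\le 1$. Let $Z$ be a real and $W$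 a complex isotropic independently scattered, $\sigma$-additive Gaussian random measure on $\mathbb R^d$ with control measure a positive multiple $\kappa\,dx$ of Lebesgue measure: for Borel sets $A$ with $|A|<\infty$, $Z(A)\sim N(0,\kappa|A|)$, and the real and imaginary parts of $W(A)$ are independent with law $N(0,\kappa|A|)$ (the constant $\kappa>0$ is an arbitrary normalization). Stochastic integrals are the $L^2$-limits of the integrals of simple functions. A random field $X=\{X(x)\}_{x\in\mathbb R^m}$ has *Hölder critical exponent* $\gamma\in(0,1)$ if (a) for every $s\in(0,\gamma)$ and every compact $K\subset\mathbb R^m$ there is a positive random variable $A$ such that almost surely $|X(x)-X(y)|\le A\|x-y\|^s$ for all $x,y\in K$; and (b) for every $s\in(\gamma,1)$, almost surely, for every compact set $K$ with non-empty interior, the path does not satisfy $|X(x)-X(y)|\le A\|x-y\|^s$ for all $x,y\in K$ with any finite constant $A$. A field $X$ on $\mathbb R^d$ admits *directional regularity* $\gamma$ in the direction of the unit vector $u$ if the process $\{X(tu)\}_{t\in\mathbb R}$ has Hölder critical exponent $\gamma$. A *continuous version* of a field $X$ is a field $Y$ with $Y(x)=X(x)$ almost surely for every $x$ and with almost surely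 continuous sample paths. **Theorem 5.1.** (i) Let $\varphi:\mathbb R^d\to[0,\infty)$ be $E$-homogeneous and $(\beta,E)$-admissible, let $0<H<\beta$ with $H\neq q/2$, and let $$X_\varphi(x)=\int_{\mathbb R^d}\bigl(\varphi(x-y)^{H-q/2}-\varphi(-y)^{H-q/2}\bigr)\,Z(dy),\qquad x\in\mathbb R^d .$$ Then any continuous version of $X_\varphi$ has Hölder critical exponent $H/a_p$, and for every $i=1,\dots,p$ and every unit vector $u\in W_i\setminus W_{i-1}$ it admits directional regularity $H/a_i$ in direction $u$. (ii) Let $\psi:\mathbb R^d\to[0,\infty)$ be continuous and $E^t$-homogeneous with $\psi(x)>0$ for all $x\ne 0$, let $0<H<a_1$, and let $$X_\psi(x)=\operatorname{Re}\int_{\mathbb R^d}\bigl(e^{i\langle x,\xi\rangle}-1\bigr)\psi(\xi)^{-H-q/2}\,W(d\xi),\qquad x\in\mathbb R^d .$$ Then any continuous version of $X_\psi$ has Hölder critical exponent $H/a_p$, and for every $i=1,\dots,p$ and every unit vector $u\in W_i\setminus W_{i-1}$ it admits directional regularity $H/a_i$ in direction $u$. -/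

import Mathlib

open MeasureTheory ProbabilityTheory Filter Topology
open scoped NNReal ENNReal

noncomputable section

namespace OSSRF

/-! ### Operator scaling: matrix powers, real spectrum, spectral subspaces -/

/-- `c ^ E x`, where `c ^ E = exp (log c • E)` (used for `c > 0`). -/
def opPow {d : ℕ} (E : Matrix (Fin d) (Fin d) ℝ) (c : ℝ) (x : EuclideanSpace ℝ (Fin d)) :
    EuclideanSpace ℝ (Fin d) :=
  Matrix.toEuclideanLin (NormedSpace.exp (Real.log c • E)) x

/-- The set of real parts of the complex eigenvalues of the real matrix `E`. -/
def realSpectrum {d : ℕ} (E : Matrix (Fin d) (Fin d) ℝ) : Set ℝ :=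
  Complex.re '' spectrum ℂ (E.map (algebraMap ℝ ℂ))

/-- The inclusion `ℝ^d → ℂ^d`, as a real-linear map. -/
def complexify (d : ℕ) : EuclideanSpace ℝ (Fin d) →ₗ[ℝ] (Fin d → ℂ) where
  toFun x := fun i => (x i : ℂ)
  map_add' x y := by ext i; simp
  map_smul' r x := by ext i; simp

/-- The spectral subspace `V` of `ℝ^d` belonging to the real part `b`: the real vectors in the sum
of the complex generalized eigenspaces of `E` over all eigenvalues with real part `b`. -/
def spectralSubspace {d : ℕ} (E : Matrix (Fin d) (Fin d) ℝ) (b : ℝ) :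
    Submodule ℝ (EuclideanSpace ℝ (Fin d)) :=
  Submodule.comap (complexify d)
    (Submodule.restrictScalars ℝ
      (⨆ z ∈ {z : ℂ | z.re = b},
        Module.End.maxGenEigenspace (Matrix.toLin' (E.map (algebraMap ℝ ℂ))) z))

/-! ### The radial part, homogeneous and admissible functions -/

/-- The norm `‖x‖₀ = ∫_0^1 ‖t ^ E x‖ dt / t` adapted to `E`. For a matrix `E` whose eigenvalues have
positive real parts, `t ↦ ‖t ^ E x‖₀` increases strictly from `0` to `∞` for every `x ≠ 0`. -/
def adaptedNorm {d : ℕ} (E : Matrix (Fin d) (Fin d) ℝ) (x : EuclideanSpace ℝ (Fin d)) : ℝ :=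
  ∫ t in (0 : ℝ)..1, ‖opPow E t x‖ / t

/-- The radial part `τ(x)`: for `x ≠ 0` the unique `r > 0` with `‖r ^ (-E) x‖₀ = 1`, that is
`x = r ^ E θ` with `‖θ‖₀ = 1`; and `τ(0) = 0`. -/
def radial {d : ℕ} (E : Matrix (Fin d) (Fin d) ℝ) (x : EuclideanSpace ℝ (Fin d)) : ℝ :=
  sInf {r : ℝ | 0 < r ∧ adaptedNorm E (opPow E r⁻¹ x) ≤ 1}

/-- `φ (c ^ E x) = c φ(x)` for all `c > 0` and `x ≠ 0`. -/
def IsHomogeneous {d : ℕ} (E : Matrix (Fin d) (Fin d) ℝ) (φ : EuclideanSpace ℝ (Fin d) → ℝ) :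
    Prop :=
  ∀ c : ℝ, 0 < c → ∀ x : EuclideanSpace ℝ (Fin d), x ≠ 0 → φ (opPow E c x) = c * φ x

/-- `(β, E)`-admissible functions `ℝ^d → [0, ∞)`. -/
structure IsAdmissible {d : ℕ} (β : ℝ) (E : Matrix (Fin d) (Fin d) ℝ)
    (φ : EuclideanSpace ℝ (Fin d) → ℝ) : Prop where
  continuous : Continuous φ
  nonneg : ∀ x, 0 ≤ φ x
  pos : ∀ x, x ≠ 0 → 0 < φ x
  bound : ∀ A B : ℝ, 0 < A → A < B → ∃ C : ℝ, 0 < C ∧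
    ∀ x y : EuclideanSpace ℝ (Fin d), A ≤ ‖y‖ → ‖y‖ ≤ B → radial E x ≤ 1 →
      |φ (x + y) - φ y| ≤ C * radial E x ^ β

/-! ### Gaussian random measures and their integrals -/

variable {S Ω : Type*} [MeasurableSpace S] [MeasurableSpace Ω]

/-- `M` is an independently scattered, σ-additive random set function, defined on the
measurable sets of finite `μ`-measure (its values on other sets are irrelevant). The series in
`sigma_additive` converges almost surely, but in general not absolutely. -/
structure IsIndependentlyScattered {𝕜 : Type*} [RCLike 𝕜] [MeasurableSpace 𝕜]
    (M : Set S → Ω → 𝕜) (μ : Measure S) (P : Measure Ω) : Prop where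
  aemeasurable : ∀ A : Set S, MeasurableSet A → μ A ≠ ∞ → AEMeasurable (M A) P
  indep : ∀ (n : ℕ) (A : Fin n → Set S), (∀ i, MeasurableSet (A i)) → (∀ i, μ (A i) ≠ ∞) →
    Pairwise (fun i j => Disjoint (A i) (A j)) → iIndepFun (fun i => M (A i)) P
  sigma_additive : ∀ A : ℕ → Set S, (∀ i, MeasurableSet (A i)) → μ (⋃ i, A i) ≠ ∞ →
    Pairwise (fun i j => Disjoint (A i) (A j)) →
    ∀ᵐ ω ∂P, Tendsto (fun N : ℕ => ∑ i ∈ Finset.range N, M (A i) ω) atTop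
      (𝓝 (M (⋃ i, A i) ω))

/-- A real Gaussian random measure with control measure `μ`: `Z(A) ~ N(0, μ(A))`. -/
structure IsGaussianRandomMeasure (Z : Set S → Ω → ℝ) (μ : Measure S) (P : Measure Ω) : Prop
    extends IsIndependentlyScattered Z μ P where
  law : ∀ A : Set S, MeasurableSet A → μ A ≠ ∞ → P.map (Z A) = gaussianReal 0 (μ A).toNNReal

/-- A complex isotropic Gaussian random measure with control measure `μ`: the real and imaginary
parts of `W(A)` are independent with law `N(0, μ(A))`. -/
structure IsIsotropicGaussianRandomMeasure (W : Set S → Ω → ℂ) (μ : Measure S) (P : Measure Ω) :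
    Prop extends IsIndependentlyScattered W μ P where
  law : ∀ A : Set S, MeasurableSet A → μ A ≠ ∞ →
    P.map (W A) = ((gaussianReal 0 (μ A).toNNReal).prod (gaussianReal 0 (μ A).toNNReal)).map
      (fun z : ℝ × ℝ => (⟨z.1, z.2⟩ : ℂ))

/-- The integral `∑ c M(s = c)` of a simple function `s`. -/
def simpleIntegral {𝕜 : Type*} [RCLike 𝕜] (M : Set S → Ω → 𝕜) (s : SimpleFunc S 𝕜) (ω : Ω) : 𝕜 :=
  ∑ c ∈ s.range, c * M (s ⁻¹' {c}) ω

/-- `I` is (a version of) the stochastic integral `∫ f dM`: it is the `L²(P)`-limit of the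
integrals of simple functions with support of finite measure that converge to `f` in `L²(μ)`. -/
def IsStochIntegral {𝕜 : Type*} [RCLike 𝕜] (M : Set S → Ω → 𝕜) (μ : Measure S) (P : Measure Ω)
    (f : S → 𝕜) (I : Ω → 𝕜) : Prop :=
  MemLp f 2 μ ∧ MemLp I 2 P ∧ ∃ s : ℕ → SimpleFunc S 𝕜,
    (∀ n, (s n).FinMeasSupp μ) ∧
    Tendsto (fun n => eLpNorm (fun y => s n y - f y) 2 μ) atTop (𝓝 0) ∧
    Tendsto (fun n => eLpNorm (fun ω => simpleIntegral M (s n) ω - I ω) 2 P) atTop (𝓝 0)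

open Classical in
/-- A version of the stochastic integral `∫ f dM` (and `0` if the integral does not exist). -/
def stochIntegral {𝕜 : Type*} [RCLike 𝕜] (M : Set S → Ω → 𝕜) (μ : Measure S) (P : Measure Ω)
    (f : S → 𝕜) : Ω → 𝕜 :=
  if h : ∃ I : Ω → 𝕜, IsStochIntegral M μ P f I then h.choose else 0

/-! ### The moving-average and the harmonizable Gaussian fields -/

/-- `X_φ(x) = ∫ (φ(x - y) ^ (H - q/2) - φ(-y) ^ (H - q/2)) Z(dy)` with `q = trace E`. -/
def movingAverageField {d : ℕ} (E : Matrix (Fin d) (Fin d) ℝ) (H : ℝ)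
    (φ : EuclideanSpace ℝ (Fin d) → ℝ) (Z : Set (EuclideanSpace ℝ (Fin d)) → Ω → ℝ)
    (μ : Measure (EuclideanSpace ℝ (Fin d))) (P : Measure Ω) :
    EuclideanSpace ℝ (Fin d) → Ω → ℝ :=
  fun x => stochIntegral Z μ P
    (fun y => φ (x - y) ^ (H - E.trace / 2) - φ (-y) ^ (H - E.trace / 2))

/-- `X_ψ(x) = Re ∫ (exp(i⟨x, ξ⟩) - 1) ψ(ξ) ^ (-H - q/2) W(dξ)` with `q = trace E`. -/
def harmonizableField {d : ℕ} (E : Matrix (Fin d) (Fin d) ℝ) (H : ℝ)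
    (ψ : EuclideanSpace ℝ (Fin d) → ℝ) (W : Set (EuclideanSpace ℝ (Fin d)) → Ω → ℂ)
    (μ : Measure (EuclideanSpace ℝ (Fin d))) (P : Measure Ω) :
    EuclideanSpace ℝ (Fin d) → Ω → ℝ :=
  fun x ω => (stochIntegral W μ P
    (fun ξ => (Complex.exp (Complex.I * (inner ℝ x ξ : ℝ)) - 1) *
      ((ψ ξ ^ (-H - E.trace / 2) : ℝ) : ℂ)) ω).re

/-! ### Sample path regularity -/

/-- `Y` is a continuous version of `X`: `Y x = X x` almost surely for every `x`, and almost all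
sample paths of `Y` are continuous. -/
def IsContinuousVersion {T : Type*} [TopologicalSpace T] (Y X : T → Ω → ℝ) (P : Measure Ω) :
    Prop :=
  (∀ x, Y x =ᵐ[P] X x) ∧ ∀ᵐ ω ∂P, Continuous fun x => Y x ω

/-- `X` has Hölder critical exponent `γ ∈ (0, 1)`: for `s < γ` the paths are almost surely
uniformly `s`-Hölder on every compact set (with a random variable as constant), and for
`γ < s < 1` almost surely they are uniformly `s`-Hölder on no compact set with non-empty
interior. -/
structure HasHolderCriticalExponent {T : Type*} [NormedAddCommGroup T] (X : T → Ω → ℝ)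
    (P : Measure Ω) (γ : ℝ) : Prop where
  pos : 0 < γ
  lt_one : γ < 1
  holder : ∀ s : ℝ, 0 < s → s < γ → ∀ K : Set T, IsCompact K →
    ∃ A : Ω → ℝ, Measurable A ∧ (∀ ω, 0 < A ω) ∧
      ∀ᵐ ω ∂P, ∀ x ∈ K, ∀ y ∈ K, |X x ω - X y ω| ≤ A ω * ‖x - y‖ ^ s
  not_holder : ∀ s : ℝ, γ < s → s < 1 →
    ∀ᵐ ω ∂P, ∀ K : Set T, IsCompact K → (interior K).Nonempty →
      ¬ ∃ A : ℝ, ∀ x ∈ K, ∀ y ∈ K, |X x ω - X y ω| ≤ A * ‖x - y‖ ^ s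

/-- `X` admits `γ` as directional regularity in the direction `u`: the process `t ↦ X(t u)` has
Hölder critical exponent `γ`. -/
def HasDirectionalRegularity {T : Type*} [NormedAddCommGroup T] [NormedSpace ℝ T]
    (X : T → Ω → ℝ) (P : Measure Ω) (u : T) (γ : ℝ) : Prop :=
  HasHolderCriticalExponent (fun t : ℝ => X (t • u)) P γ

end OSSRF

end

/-! Both fields have centered Gaussian increments whose variance at `x`, `y` is `V (x - y)`, where
`V x` is the squared `L²` norm of the kernel at `x`. The whole argument uses only three properties
of `V`, collected in `IsScalingVariance`: `V (c^E x) = c^(2H) V x`, boundedness on the unit ball,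
and a positive lower bound on the unit sphere. `IsScalingVariance.regularity` deduces all the
exponents from them.

The scaling relation converts growth of orbits into power laws for `V`. If `‖exp(tE) x‖` grows at
rate at most `α`, running the flow until `x` has norm of order one gives `V x ≲ ‖x‖^(2H/α)`; a
growth rate at least `α` along `u` gives `V (h u) ≳ h^(2H/α)`. The rates come from the generalized
eigenspaces of the complexified matrix: vectors of `W_i` grow no faster than `a_i + ε`, vectors
outside `W_{i-1}` at least as fast as `a_i - ε`, and the whole flow at most as fast as `a_p + ε`.

A variance bound from above gives Hölder paths by a Garsia-Rodemich-Rumsey argument applied to high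
Gaussian moments (`exists_holder_of_variance_le`). A variance bound from below excludes larger
exponents, because a Gaussian of large variance is rarely small (`ae_not_holder_of_le_variance`);
only laws of single increments enter, never joint laws.

For the two concrete kernels, homogeneity of `V` is a linear change of variables with determinant
`exp(t trace E)`, boundedness is integration of powers of a homogeneous function over shells, and
the lower bound is Fatou's lemma on the sphere together with nondegeneracy of the kernel. In the
moving-average case, admissibility forces `β ≤ a_1` (`IsAdmissible.le_of_growth`), so that `H < β`
makes every `H / a_i` less than one. -/

noncomputable section

namespace OSSRF

/-! ### One-parameter groups of operators -/

section ExpFlow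

variable {V : Type*} [NormedAddCommGroup V] [NormedSpace ℝ V]

/-- The one-parameter group `t ↦ exp (t A)`. -/
def expFlow (A : V →L[ℝ] V) (t : ℝ) : V →L[ℝ] V := NormedSpace.exp (t • A)

@[simp] lemma expFlow_zero (A : V →L[ℝ] V) : expFlow A 0 = 1 := by
  simp [expFlow]

variable [CompleteSpace V]

lemma expFlow_add (A : V →L[ℝ] V) (s t : ℝ) : expFlow A (s + t) = expFlow A s * expFlow A t := by
  let _ : NormedAlgebra ℚ (V →L[ℝ] V) := NormedAlgebra.restrictScalars ℚ ℝ _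
  rw [expFlow, add_smul, NormedSpace.exp_add_of_commute]
  · rfl
  · exact ((Commute.refl A).smul_left s).smul_right t

lemma expFlow_add_apply (A : V →L[ℝ] V) (s t : ℝ) (x : V) :
    expFlow A (s + t) x = expFlow A s (expFlow A t x) := by
  rw [expFlow_add]; rfl

@[simp] lemma expFlow_neg_apply_expFlow (A : V →L[ℝ] V) (t : ℝ) (x : V) :
    expFlow A (-t) (expFlow A t x) = x := by
  rw [← expFlow_add_apply]; simp

@[simp] lemma expFlow_apply_expFlow_neg (A : V →L[ℝ] V) (t : ℝ) (x : V) :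
    expFlow A t (expFlow A (-t) x) = x := by
  rw [← expFlow_add_apply]; simp

lemma hasDerivAt_expFlow (A : V →L[ℝ] V) (t : ℝ) :
    HasDerivAt (expFlow A) (expFlow A t * A) t :=
  hasDerivAt_exp_smul_const A t

lemma continuous_expFlow (A : V →L[ℝ] V) : Continuous (expFlow A) :=
  continuous_iff_continuousAt.2 fun t => (hasDerivAt_expFlow A t).continuousAt

lemma continuous_expFlow_apply (A : V →L[ℝ] V) (x : V) : Continuous fun t => expFlow A t x :=
  (continuous_expFlow A).clm_apply continuous_const

lemma hasSum_expFlow_apply (A : V →L[ℝ] V) (t : ℝ) (x : V) :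
    HasSum (fun n : ℕ => ((n.factorial : ℝ)⁻¹ * t ^ n) • (A ^ n) x) (expFlow A t x) := by
  have h := (NormedSpace.exp_series_hasSum_exp' (𝕂 := ℝ) (t • A)).mapL
    (ContinuousLinearMap.apply ℝ V x)
  convert! h using 1
  ext n
  simp [smul_pow, smul_smul]

end ExpFlow

lemma hasSum_exp_smul_apply {F : Type*} [NormedAddCommGroup F] [NormedSpace ℂ F]
    [CompleteSpace F] (M : F →L[ℂ] F) (t : ℂ) (x : F) :
    HasSum (fun n : ℕ => ((n.factorial : ℂ)⁻¹ * t ^ n) • (M ^ n) x)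
      (NormedSpace.exp (t • M) x) := by
  have h := (NormedSpace.exp_series_hasSum_exp' (𝕂 := ℂ) (t • M)).mapL
    (ContinuousLinearMap.apply ℂ F x)
  convert! h using 1
  ext1 n
  rw [mul_smul, smul_pow]
  rfl

/-- Growth of `exp (t M) x` for a generalized eigenvector `x`. -/
lemma exists_norm_exp_smul_apply_le {F : Type*} [NormedAddCommGroup F] [NormedSpace ℂ F]
    [CompleteSpace F] (M : F →L[ℂ] F) (z : ℂ) (x : F) (N : ℕ) (h : ((M - z • 1) ^ N) x = 0)
    {ε : ℝ} (hε : 0 < ε) :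
    ∃ C : ℝ, ∀ t : ℝ, ‖NormedSpace.exp ((t : ℂ) • M) x‖ ≤ C * Real.exp (t * z.re + ε * |t|) := by
  let _ : NormedAlgebra ℚ (F →L[ℂ] F) := NormedAlgebra.restrictScalars ℚ ℂ _
  set D := M - z • (1 : F →L[ℂ] F) with hD
  -- Since `D` commutes with scalars and `D ^ N x = 0`, `exp(tM) x = e^{tz} ∑_{n<N} t^n/n! D^n x`;
  -- the constant comes from `|t|^n/n! ≤ ε^{-n} e^{ε|t|}`.
  refine ⟨∑ n ∈ Finset.range N, (ε⁻¹) ^ n * ‖(D ^ n) x‖, fun t => ?_⟩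
  have hsplit : (t : ℂ) • M = algebraMap ℂ (F →L[ℂ] F) (t * z) + (t : ℂ) • D := by
    rw [hD, smul_sub, smul_smul, Algebra.algebraMap_eq_smul_one]; abel
  have hcomm : Commute (algebraMap ℂ (F →L[ℂ] F) (t * z)) ((t : ℂ) • D) :=
    Algebra.commutes _ _
  have hsum : NormedSpace.exp ((t : ℂ) • D) x
      = ∑ n ∈ Finset.range N, ((n.factorial : ℂ)⁻¹ * (t : ℂ) ^ n) • (D ^ n) x := by
    refine (hasSum_exp_smul_apply D t x).unique (hasSum_sum_of_ne_finset_zero fun n hn => ?_)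
    obtain ⟨k, rfl⟩ := Nat.exists_eq_add_of_le (show N ≤ n by simpa using hn)
    rw [add_comm, pow_add D, mul_apply_eq_comp, h, map_zero, smul_zero]
  rw [hsplit, NormedSpace.exp_add_of_commute hcomm, ← NormedSpace.algebraMap_exp_comm,
    Algebra.algebraMap_eq_smul_one, mul_apply_eq_comp, smul_apply,
    one_apply_eq_self, norm_smul, ← Complex.exp_eq_exp_ℂ, Complex.norm_exp, hsum,
    Real.exp_add, mul_comm _ (Real.exp _ * _), mul_assoc]
  have hre : ((t : ℂ) * z).re = t * z.re := by simp
  rw [hre]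
  gcongr
  rw [Finset.mul_sum]
  refine (norm_sum_le _ _).trans (Finset.sum_le_sum fun n _ => ?_)
  rw [norm_smul]
  have h3 := Real.pow_div_factorial_le_exp (ε * |t|) (by positivity) n
  have h4 : ‖(n.factorial : ℂ)⁻¹ * (t : ℂ) ^ n‖ = ε⁻¹ ^ n * ((ε * |t|) ^ n / n.factorial) := by
    rw [norm_mul, norm_inv, norm_pow, Complex.norm_natCast, Complex.norm_real, Real.norm_eq_abs,
      mul_pow, inv_pow]
    field_simp
  rw [h4]
  calc ε⁻¹ ^ n * ((ε * |t|) ^ n / n.factorial) * ‖(D ^ n) x‖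
      ≤ ε⁻¹ ^ n * Real.exp (ε * |t|) * ‖(D ^ n) x‖ := by gcongr
    _ = _ := by ring

/-! ### Growth of the flow on spectral subspaces -/

/-- A pointwise exponential bound for a family of operators is uniform. -/
lemma exists_uniform_exp_bound {𝕜 V W : Type*} [RCLike 𝕜] [NormedAddCommGroup V] [NormedSpace 𝕜 V]
    [CompleteSpace V] [NormedAddCommGroup W] [NormedSpace 𝕜 W] (T : ℝ → V →L[𝕜] W) (b : ℝ)
    (h : ∀ x, ∃ C : ℝ, ∀ t : ℝ, 0 ≤ t → ‖T t x‖ ≤ C * Real.exp (b * t)) :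
    ∃ C : ℝ, 0 < C ∧ ∀ t : ℝ, 0 ≤ t → ∀ x, ‖T t x‖ ≤ C * Real.exp (b * t) * ‖x‖ := by
  obtain ⟨C, hC⟩ := banach_steinhaus
    (g := fun t : {t : ℝ // 0 ≤ t} => ((Real.exp (-(b * t)) : ℝ) : 𝕜) • T t) (fun x => by
      obtain ⟨C, hC⟩ := h x
      refine ⟨C, fun t => ?_⟩
      have := hC t t.2
      rw [smul_apply, norm_smul, RCLike.norm_ofReal, abs_of_pos (Real.exp_pos _), Real.exp_neg]
      rw [inv_mul_le_iff₀ (Real.exp_pos _)]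
      linarith)
  refine ⟨max C 1, by positivity, fun t ht x => ?_⟩
  have h1 := hC ⟨t, ht⟩
  have h2 := ((((Real.exp (-(b * t)) : ℝ) : 𝕜) • T t).le_opNorm x).trans
    (mul_le_mul_of_nonneg_right (h1.trans (le_max_left C 1)) (norm_nonneg x))
  rw [smul_apply, norm_smul, RCLike.norm_ofReal, abs_of_pos (Real.exp_pos _),
    Real.exp_neg, inv_mul_le_iff₀ (Real.exp_pos _)] at h2
  linarith

section Complex

variable {F : Type*} [NormedAddCommGroup F] [NormedSpace ℂ F]

/-- The vectors satisfying such a bound, with a constant depending on the vector, form a subspace,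
so it is enough to treat one generalized eigenspace. The sign `κ` covers both directions of time. -/
lemma exists_norm_exp_smul_apply_le_of_mem_iSup [CompleteSpace F] (M : F →L[ℂ] F) (κ : ℝ)
    (hκ : |κ| = 1) (s : Set ℂ) (b : ℝ) (hs : ∀ z ∈ s, κ * z.re ≤ b) {ε : ℝ} (hε : 0 < ε) {x : F}
    (hx : x ∈ ⨆ z ∈ s, Module.End.maxGenEigenspace (M : F →ₗ[ℂ] F) z) :
    ∃ C : ℝ, ∀ t : ℝ, 0 ≤ t →
      ‖NormedSpace.exp (((κ * t : ℝ) : ℂ) • M) x‖ ≤ C * Real.exp ((b + ε) * t) := by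
  let G : Submodule ℂ F :=
    { carrier := {x | ∃ C : ℝ, ∀ t : ℝ, 0 ≤ t →
        ‖NormedSpace.exp (((κ * t : ℝ) : ℂ) • M) x‖ ≤ C * Real.exp ((b + ε) * t)}
      add_mem' := by
        rintro x y ⟨C, hC⟩ ⟨D, hD⟩
        refine ⟨C + D, fun t ht => ?_⟩
        rw [map_add, add_mul]
        exact (norm_add_le _ _).trans (add_le_add (hC t ht) (hD t ht))
      zero_mem' := ⟨0, fun t ht => by simp⟩
      smul_mem' := by
        rintro c x ⟨C, hC⟩
        refine ⟨‖c‖ * C, fun t ht => ?_⟩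
        rw [map_smul, norm_smul, mul_assoc]
        exact mul_le_mul_of_nonneg_left (hC t ht) (norm_nonneg _) }
  have hG : ⨆ z ∈ s, Module.End.maxGenEigenspace (M : F →ₗ[ℂ] F) z ≤ G := by
    refine iSup₂_le fun z hz y hy => ?_
    obtain ⟨N, hN⟩ := (Module.End.mem_maxGenEigenspace _ _ _).1 hy
    have hN' : ((M - z • 1) ^ N) y = 0 := by
      have : ((M - z • (1 : F →L[ℂ] F) : F →L[ℂ] F) : F →ₗ[ℂ] F) = (M : F →ₗ[ℂ] F) - z • 1 := by
        ext; simp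
      rw [← this] at hN
      rw [← hN, ← ContinuousLinearMap.toLinearMap_pow]
      rfl
    obtain ⟨C, hC⟩ := exists_norm_exp_smul_apply_le M z y N hN' hε
    refine ⟨|C|, fun t ht => (hC (κ * t)).trans ?_⟩
    have h1 : κ * t * z.re + ε * |κ * t| ≤ (b + ε) * t := by
      rw [abs_mul, hκ, one_mul, abs_of_nonneg ht]
      nlinarith [hs z hz]
    gcongr
    exact le_abs_self C
  exact hG hx

/-- Let `Q` project onto the generalized eigenspaces with real part at least `b`, along the others.
It commutes with the flow and `Q x ≠ 0`, so `Q x = exp(-tM) Q (exp(tM) x)`. The operators `exp(-tM)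
Q` grow at rate at most `-b + ε`, uniformly by Banach-Steinhaus, which forces `exp(tM) x` to be
large. -/
lemma exists_le_norm_exp_smul_apply [FiniteDimensional ℂ F] (M : F →L[ℂ] F) (b : ℝ) {ε : ℝ}
    (hε : 0 < ε) {x : F}
    (hx : x ∉ ⨆ z ∈ {z : ℂ | z.re < b}, Module.End.maxGenEigenspace (M : F →ₗ[ℂ] F) z) :
    ∃ c : ℝ, 0 < c ∧ ∀ t : ℝ, 0 ≤ t →
      c * Real.exp ((b - ε) * t) ≤ ‖NormedSpace.exp ((t : ℂ) • M) x‖ := by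
  have : CompleteSpace F := FiniteDimensional.complete ℂ F
  let _ : NormedAlgebra ℚ (F →L[ℂ] F) := NormedAlgebra.restrictScalars ℚ ℂ _
  set f : Module.End ℂ F := (M : F →ₗ[ℂ] F) with hf
  set W₁ := ⨆ z ∈ {z : ℂ | z.re < b}, f.maxGenEigenspace z with hW₁
  set W₂ := ⨆ z ∈ {z : ℂ | b ≤ z.re}, f.maxGenEigenspace z with hW₂
  have hdisj : Disjoint W₂ W₁ := by
    refine (Module.End.independent_maxGenEigenspace f).disjoint_biSup_biSup ?_
    rw [Set.disjoint_left]
    intro z hz hz'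
    exact absurd (show z.re < b from hz') (not_lt.2 hz)
  have htop : W₂ ⊔ W₁ = ⊤ := by
    rw [eq_top_iff, ← Module.End.iSup_maxGenEigenspace_eq_top f]
    refine iSup_le fun z => ?_
    rcases le_or_gt b z.re with h | h
    · exact (le_iSup₂ (f := fun z (_ : z ∈ {z : ℂ | b ≤ z.re}) => f.maxGenEigenspace z) z h).trans
        le_sup_left
    · exact (le_iSup₂ (f := fun z (_ : z ∈ {z : ℂ | z.re < b}) => f.maxGenEigenspace z) z h).trans
        le_sup_right
  have hcompl : IsCompl W₂ W₁ := ⟨hdisj, codisjoint_iff.2 htop⟩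
  have hinv : ∀ s : Set ℂ, (⨆ z ∈ s, f.maxGenEigenspace z) ∈ Module.End.invtSubmodule f := by
    intro s
    rw [Module.End.mem_invtSubmodule]
    refine iSup₂_le fun z hz y hy => ?_
    exact Submodule.mem_iSup_of_mem z (Submodule.mem_iSup_of_mem hz
      (Module.End.mapsTo_maxGenEigenspace_of_comm (Commute.refl f) z hy))
  let q : F →ₗ[ℂ] F := W₂.projection W₁ hcompl
  have hq : IsIdempotentElem q := Submodule.isIdempotentElem_projection hcompl
  have hqf : Commute q f := by
    rw [LinearMap.IsIdempotentElem.commute_iff hq]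
    rw [Submodule.range_projection, Submodule.ker_projection]
    exact ⟨hinv _, hinv _⟩
  let Q : F →L[ℂ] F := LinearMap.toContinuousLinearMap q
  have hQM : Commute Q M := by
    ext y
    exact LinearMap.congr_fun hqf y
  have hQx : Q x ≠ 0 := by
    intro h
    apply hx
    have : x ∈ q.ker := h
    rwa [Submodule.ker_projection] at this
  obtain ⟨C, hC0, hC⟩ := exists_uniform_exp_bound
    (fun t : ℝ => NormedSpace.exp (((-1 * t : ℝ) : ℂ) • M) * Q) (-b + ε) (fun y =>
      exists_norm_exp_smul_apply_le_of_mem_iSup M (-1) (by simp) {z : ℂ | b ≤ z.re} (-b)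
        (fun z hz => by simpa using hz) hε (x := Q y) (by
          have : q y ∈ q.range := ⟨y, rfl⟩
          rwa [Submodule.range_projection] at this))
  refine ⟨‖Q x‖ / C, by positivity, fun t ht => ?_⟩
  have h1 := hC t ht (NormedSpace.exp ((t : ℂ) • M) x)
  have h2 : (NormedSpace.exp (((-1 * t : ℝ) : ℂ) • M) * Q) (NormedSpace.exp ((t : ℂ) • M) x)
      = Q x := by
    have h3 : Commute Q (NormedSpace.exp ((t : ℂ) • M)) := (hQM.smul_right _).exp_right
    have h4 : NormedSpace.exp (((-1 * t : ℝ) : ℂ) • M) * NormedSpace.exp ((t : ℂ) • M) = 1 := by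
      rw [← NormedSpace.exp_add_of_commute, ← add_smul]
      · simp
      · exact ((Commute.refl M).smul_left _).smul_right _
    calc _ = (NormedSpace.exp (((-1 * t : ℝ) : ℂ) • M) * (Q * NormedSpace.exp ((t : ℂ) • M))) x :=
          rfl
      _ = ((NormedSpace.exp (((-1 * t : ℝ) : ℂ) • M) * NormedSpace.exp ((t : ℂ) • M)) * Q) x := by
          rw [h3.eq, mul_assoc]
      _ = Q x := by rw [h4, one_mul]
  rw [h2] at h1
  rw [div_mul_eq_mul_div, div_le_iff₀ hC0]
  have h5 : Real.exp ((b - ε) * t) * Real.exp ((-b + ε) * t) = 1 := by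
    rw [← Real.exp_add]; ring_nf; simp
  calc ‖Q x‖ * Real.exp ((b - ε) * t)
      ≤ C * Real.exp ((-b + ε) * t) * ‖NormedSpace.exp ((t : ℂ) • M) x‖
        * Real.exp ((b - ε) * t) := by gcongr
    _ = ‖NormedSpace.exp ((t : ℂ) • M) x‖ * C
        * (Real.exp ((b - ε) * t) * Real.exp ((-b + ε) * t)) := by ring
    _ = _ := by rw [h5, mul_one]

end Complex

/-! ### The flow of a real matrix -/

section MatrixFlow

variable {d : ℕ}

/-- The flow `t ↦ exp (t E)` on `ℝ^d`. -/
abbrev flow (E : Matrix (Fin d) (Fin d) ℝ) (t : ℝ) :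
    EuclideanSpace ℝ (Fin d) →L[ℝ] EuclideanSpace ℝ (Fin d) :=
  expFlow (Matrix.toEuclideanCLM (𝕜 := ℝ) E) t

/-- The operator of `E` on `ℂ^d`. -/
def complexOp (E : Matrix (Fin d) (Fin d) ℝ) : (Fin d → ℂ) →L[ℂ] (Fin d → ℂ) :=
  LinearMap.toContinuousLinearMap (Matrix.toLin' (E.map (algebraMap ℝ ℂ)))

lemma toEuclideanCLM_exp (B : Matrix (Fin d) (Fin d) ℝ) :
    Matrix.toEuclideanCLM (𝕜 := ℝ) (NormedSpace.exp B)
      = NormedSpace.exp (Matrix.toEuclideanCLM (𝕜 := ℝ) B) := by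
  -- The exponential depends only on the topology, so any submultiplicative matrix norm inducing it
  -- may be installed here.
  let _ : NormedRing (Matrix (Fin d) (Fin d) ℝ) := Matrix.linftyOpNormedRing
  let _ : NormedAlgebra ℝ (Matrix (Fin d) (Fin d) ℝ) := Matrix.linftyOpNormedAlgebra
  let _ : NormedAlgebra ℚ (Matrix (Fin d) (Fin d) ℝ) := NormedAlgebra.restrictScalars ℚ ℝ _
  let _ : NormedAlgebra ℚ (EuclideanSpace ℝ (Fin d) →L[ℝ] EuclideanSpace ℝ (Fin d)) :=
    NormedAlgebra.restrictScalars ℚ ℝ _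
  exact NormedSpace.map_exp (Matrix.toEuclideanCLM (𝕜 := ℝ) (n := Fin d))
    (LinearMap.continuous_of_finiteDimensional
      (Matrix.toEuclideanCLM (𝕜 := ℝ) (n := Fin d)).toAlgEquiv.toLinearMap) B

lemma opPow_eq (E : Matrix (Fin d) (Fin d) ℝ) (c : ℝ) (x : EuclideanSpace ℝ (Fin d)) :
    opPow E c x = flow E (Real.log c) x := by
  rw [opPow, flow, expFlow, ← map_smul, ← toEuclideanCLM_exp,
    ← Matrix.coe_toEuclideanCLM_eq_toEuclideanLin]
  rfl

lemma opPow_exp (E : Matrix (Fin d) (Fin d) ℝ) (t : ℝ) (x : EuclideanSpace ℝ (Fin d)) :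
    opPow E (Real.exp t) x = flow E t x := by
  rw [opPow_eq, Real.log_exp]

lemma inner_flow (E : Matrix (Fin d) (Fin d) ℝ) (t : ℝ) (x y : EuclideanSpace ℝ (Fin d)) :
    inner ℝ (flow E t x) y = inner ℝ x (flow E.transpose t y) := by
  have h : flow E.transpose t = ContinuousLinearMap.adjoint (flow E t) := by
    rw [flow, flow, expFlow, expFlow, ← ContinuousLinearMap.star_eq_adjoint,
      NormedSpace.star_exp, star_smul, ← map_star, Matrix.star_eq_conjTranspose,
      Matrix.conjTranspose_eq_transpose_of_trivial]
    simp
  rw [h, ContinuousLinearMap.adjoint_inner_right]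

lemma norm_flow_transpose (E : Matrix (Fin d) (Fin d) ℝ) (t : ℝ) :
    ‖flow E.transpose t‖ = ‖flow E t‖ := by
  have h : flow E.transpose t = ContinuousLinearMap.adjoint (flow E t) := by
    refine (ContinuousLinearMap.eq_adjoint_iff _ _).2 fun x y => ?_
    rw [real_inner_comm, ← inner_flow, real_inner_comm]
  rw [h, LinearIsometryEquiv.norm_map]

lemma complexify_flow (E : Matrix (Fin d) (Fin d) ℝ) (t : ℝ) (x : EuclideanSpace ℝ (Fin d)) :
    complexify d (flow E t x) = NormedSpace.exp ((t : ℂ) • complexOp E) (complexify d x) := by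
  have h1 := (hasSum_expFlow_apply (Matrix.toEuclideanCLM (𝕜 := ℝ) E) t x).mapL
    (LinearMap.toContinuousLinearMap (complexify d))
  refine h1.unique ?_
  convert! hasSum_exp_smul_apply (complexOp E) t (complexify d x) using 1
  ext1 n
  have h2 : ∀ y, complexify d (Matrix.toEuclideanCLM (𝕜 := ℝ) E y)
      = complexOp E (complexify d y) := by
    intro y
    ext i
    simp [complexify, complexOp, Matrix.mulVec, dotProduct, Matrix.ofLp_toEuclideanCLM]
  have h3 : ∀ n : ℕ, complexify d ((Matrix.toEuclideanCLM (𝕜 := ℝ) E ^ n) x)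
      = (complexOp E ^ n) (complexify d x) := by
    intro n
    induction n with
    | zero => simp
    | succ n ih => rw [pow_succ', pow_succ', mul_apply_eq_comp, mul_apply_eq_comp, ← ih, h2]
  change complexify d (_ • _) = _
  rw [map_smul, h3 n, ← Complex.coe_smul]
  push_cast
  rfl

lemma exists_norm_complexify_bounds (d : ℕ) : ∃ K : ℝ, 0 < K ∧
    ∀ x : EuclideanSpace ℝ (Fin d), ‖complexify d x‖ ≤ K * ‖x‖ ∧ ‖x‖ ≤ K * ‖complexify d x‖ := by
  have hinj : LinearMap.ker (complexify d) = ⊥ := by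
    rw [LinearMap.ker_eq_bot']
    intro x hx
    ext i
    have := congrFun hx i
    simpa [complexify] using this
  obtain ⟨K, hK, hK'⟩ := LinearMap.exists_antilipschitzWith (complexify d) hinj
  set J := LinearMap.toContinuousLinearMap (complexify d)
  refine ⟨max K ‖J‖, lt_max_of_lt_left hK, fun x => ⟨?_, ?_⟩⟩
  · exact (J.le_opNorm x).trans (by gcongr; exact le_max_right _ _)
  · have := hK'.le_mul_dist x 0
    rw [dist_zero_right, map_zero, dist_zero_right] at this
    exact this.trans (by gcongr; exact le_max_left _ _)

/-- The real part of a complex vector. -/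
def reVec (d : ℕ) : (Fin d → ℂ) →ₗ[ℝ] EuclideanSpace ℝ (Fin d) where
  toFun w := WithLp.toLp 2 fun i => (w i).re
  map_add' x y := by ext i; simp
  map_smul' r x := by ext i; simp

lemma reVec_complexify (x : EuclideanSpace ℝ (Fin d)) : reVec d (complexify d x) = x := by
  ext i; simp [reVec, complexify]

lemma complexify_reVec (w : Fin d → ℂ) :
    complexify d (reVec d w) = (1 / 2 : ℂ) • (w + star w) := by
  ext i
  simp [reVec, complexify, Complex.re_eq_add_conj]
  ring

lemma star_mem_maxGenEigenspace (E : Matrix (Fin d) (Fin d) ℝ) (z : ℂ) {w : Fin d → ℂ}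
    (hw : w ∈ Module.End.maxGenEigenspace (Matrix.toLin' (E.map (algebraMap ℝ ℂ))) z) :
    star w ∈ Module.End.maxGenEigenspace (Matrix.toLin' (E.map (algebraMap ℝ ℂ))) (star z) := by
  rw [Module.End.mem_maxGenEigenspace] at hw ⊢
  obtain ⟨k, hk⟩ := hw
  refine ⟨k, ?_⟩
  have h : ∀ (k : ℕ) (w : Fin d → ℂ),
      ((Matrix.toLin' (E.map (algebraMap ℝ ℂ)) - star z • (1 : Module.End ℂ (Fin d → ℂ))) ^ k)
        (star w) =
      star (((Matrix.toLin' (E.map (algebraMap ℝ ℂ)) - z • (1 : Module.End ℂ (Fin d → ℂ))) ^ k)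
        w) := by
    intro k
    induction k with
    | zero => intro w; simp
    | succ k ih =>
      intro w
      rw [pow_succ, pow_succ, Module.End.mul_apply, Module.End.mul_apply, ← ih]
      congr 1
      ext i
      simp [Matrix.mulVec, dotProduct]
  rw [h, hk, star_zero]

/-- The real part is `(w + star w) / 2`, and since `E` is real, `star w` is a generalized
eigenvector for the conjugate eigenvalue, which has the same real part. -/
lemma reVec_mem_spectralSubspace (E : Matrix (Fin d) (Fin d) ℝ) (z : ℂ) {w : Fin d → ℂ}
    (hw : w ∈ Module.End.maxGenEigenspace (Matrix.toLin' (E.map (algebraMap ℝ ℂ))) z) :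
    reVec d w ∈ spectralSubspace E z.re := by
  rw [spectralSubspace, Submodule.mem_comap, Submodule.restrictScalars_mem, complexify_reVec]
  refine Submodule.smul_mem _ _ (Submodule.add_mem _ ?_ ?_)
  · exact Submodule.mem_iSup_of_mem z (Submodule.mem_iSup_of_mem rfl hw)
  · refine Submodule.mem_iSup_of_mem (star z) (Submodule.mem_iSup_of_mem ?_
      (star_mem_maxGenEigenspace E z hw))
    simp

lemma re_mem_realSpectrum (E : Matrix (Fin d) (Fin d) ℝ) (z : ℂ) {w : Fin d → ℂ} (hw0 : w ≠ 0)
    (hw : w ∈ Module.End.maxGenEigenspace (Matrix.toLin' (E.map (algebraMap ℝ ℂ))) z) :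
    z.re ∈ realSpectrum E := by
  refine ⟨z, ?_, rfl⟩
  rw [← Matrix.spectrum_toLin', ← Module.End.hasEigenvalue_iff_mem_spectrum]
  have h : Module.End.HasUnifEigenvalue (Matrix.toLin' (E.map (algebraMap ℝ ℂ))) z ⊤ := by
    intro h
    have : w ∈ (⊥ : Submodule ℂ (Fin d → ℂ)) := h ▸ hw
    exact hw0 (by simpa using this)
  exact h.lt one_pos

variable {p : ℕ} {E : Matrix (Fin d) (Fin d) ℝ} {a : Fin (p + 1) → ℝ}

/-- Taking real parts is only real-linear, whereas the supremum is one of complex subspaces. The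
condition is therefore strengthened to cover both `w` and `I • w`, which cuts out a complex
subspace. -/
lemma reVec_mem_of_mem_iSup_lt (ha_mono : StrictMono a) (ha_range : Set.range a = realSpectrum E)
    (i : Fin (p + 1)) {w : Fin d → ℂ}
    (hw : w ∈ ⨆ z ∈ {z : ℂ | z.re < a i},
      Module.End.maxGenEigenspace (Matrix.toLin' (E.map (algebraMap ℝ ℂ))) z) :
    reVec d w ∈ ⨆ j < i, spectralSubspace E (a j) := by
  set R := ⨆ j < i, spectralSubspace E (a j) with hR
  let G : Submodule ℂ (Fin d → ℂ) :=
    { carrier := {w | reVec d w ∈ R ∧ reVec d (Complex.I • w) ∈ R}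
      add_mem' := by
        rintro x y ⟨hx, hx'⟩ ⟨hy, hy'⟩
        refine ⟨?_, ?_⟩
        · rw [map_add]; exact R.add_mem hx hy
        · rw [smul_add, map_add]; exact R.add_mem hx' hy'
      zero_mem' := by simp
      smul_mem' := by
        rintro c x ⟨hx, hx'⟩
        have h1 : c • x = c.re • x + c.im • (Complex.I • x) := by
          conv_lhs => rw [← Complex.re_add_im c]
          rw [add_smul, mul_smul, Complex.coe_smul, Complex.coe_smul]
        have h2 : Complex.I • c • x = c.re • (Complex.I • x) - c.im • x := by
          rw [h1, smul_add, smul_comm Complex.I c.re, smul_comm Complex.I c.im, smul_smul,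
            Complex.I_mul_I, neg_smul, one_smul, smul_neg, ← sub_eq_add_neg]
        refine ⟨?_, ?_⟩
        · rw [h1, map_add, map_smul, map_smul]
          exact R.add_mem (R.smul_mem _ hx) (R.smul_mem _ hx')
        · rw [h2, map_sub, LinearMap.map_smul, LinearMap.map_smul]
          exact R.sub_mem (R.smul_mem c.re hx') (R.smul_mem c.im hx) }
  suffices h : ⨆ z ∈ {z : ℂ | z.re < a i},
      Module.End.maxGenEigenspace (Matrix.toLin' (E.map (algebraMap ℝ ℂ))) z ≤ G from (h hw).1
  refine iSup₂_le fun z hz y hy => ?_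
  have key : ∀ y ∈ Module.End.maxGenEigenspace (Matrix.toLin' (E.map (algebraMap ℝ ℂ))) z,
      reVec d y ∈ R := by
    intro y hy
    by_cases hy0 : y = 0
    · simp [hy0]
    have h1 := re_mem_realSpectrum E z hy0 hy
    rw [← ha_range] at h1
    obtain ⟨j, hj⟩ := h1
    have h2 := reVec_mem_spectralSubspace E z hy
    rw [← hj] at h2
    have hji : j < i := by
      rw [← ha_mono.lt_iff_lt, hj]; exact hz
    exact Submodule.mem_iSup_of_mem j (Submodule.mem_iSup_of_mem hji h2)
  exact ⟨key y hy, key _ (Submodule.smul_mem _ _ hy)⟩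

lemma exists_eigenvector (ha_range : Set.range a = realSpectrum E) (i : Fin (p + 1)) :
    ∃ z : ℂ, z.re = a i ∧ ∃ w : Fin d → ℂ, w ≠ 0 ∧
      w ∈ Module.End.maxGenEigenspace (Matrix.toLin' (E.map (algebraMap ℝ ℂ))) z := by
  have h : a i ∈ realSpectrum E := ha_range ▸ ⟨i, rfl⟩
  obtain ⟨z, hz, hzi⟩ := h
  refine ⟨z, hzi, ?_⟩
  rw [← Matrix.spectrum_toLin', ← Module.End.hasEigenvalue_iff_mem_spectrum] at hz
  obtain ⟨w, hw⟩ := hz.exists_hasEigenvector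
  exact ⟨w, hw.2, (Module.End.genEigenspace _ z).monotone le_top hw.1⟩

lemma eq_zero_of_reVec_eq_zero {w : Fin d → ℂ} (h1 : reVec d w = 0)
    (h2 : reVec d (Complex.I • w) = 0) : w = 0 := by
  ext i
  have h3 := congrArg (fun v : EuclideanSpace ℝ (Fin d) => v i) h1
  have h4 := congrArg (fun v : EuclideanSpace ℝ (Fin d) => v i) h2
  simp [reVec] at h3 h4
  exact Complex.ext h3 h4

lemma exists_mem_spectralSubspace (ha_range : Set.range a = realSpectrum E) (i : Fin (p + 1)) :
    ∃ x ∈ spectralSubspace E (a i), x ≠ 0 := by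
  obtain ⟨z, hz, w, hw0, hw⟩ := exists_eigenvector ha_range i
  rw [← hz]
  by_contra! h
  exact hw0 (eq_zero_of_reVec_eq_zero (h _ (reVec_mem_spectralSubspace E z hw))
    (h _ (reVec_mem_spectralSubspace E z (Submodule.smul_mem _ Complex.I hw))))

lemma complexify_mem_iSup_le (ha_mono : StrictMono a) (i : Fin (p + 1))
    {u : EuclideanSpace ℝ (Fin d)} (hu : u ∈ ⨆ j ≤ i, spectralSubspace E (a j)) :
    complexify d u ∈ ⨆ z ∈ {z : ℂ | z.re ≤ a i},
      Module.End.maxGenEigenspace (Matrix.toLin' (E.map (algebraMap ℝ ℂ))) z := by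
  suffices h : ⨆ j ≤ i, spectralSubspace E (a j) ≤ Submodule.comap (complexify d)
      (Submodule.restrictScalars ℝ (⨆ z ∈ {z : ℂ | z.re ≤ a i},
        Module.End.maxGenEigenspace (Matrix.toLin' (E.map (algebraMap ℝ ℂ))) z)) from h hu
  refine iSup₂_le fun j hj => Submodule.comap_mono ?_
  intro w hw
  refine (iSup₂_le fun z hz => ?_ : (⨆ z ∈ {z : ℂ | z.re = a j},
    Module.End.maxGenEigenspace (Matrix.toLin' (E.map (algebraMap ℝ ℂ))) z) ≤ _) hw
  have hz' : z ∈ {z : ℂ | z.re ≤ a i} := by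
    have h1 : z.re = a j := hz
    have h2 := ha_mono.monotone hj
    exact h1.le.trans h2
  exact le_iSup₂ (f := fun z (_ : z ∈ {z : ℂ | z.re ≤ a i}) =>
    Module.End.maxGenEigenspace (Matrix.toLin' (E.map (algebraMap ℝ ℂ))) z) z hz'

/-- Otherwise every real vector, hence every complex one, would lie in the sum of the generalized
eigenspaces with real part below `a i`. An eigenvector with real part exactly `a i` contradicts
their independence. -/
lemma exists_not_mem_iSup_lt (ha_mono : StrictMono a) (ha_range : Set.range a = realSpectrum E)
    (i : Fin (p + 1)) : ∃ u, u ∉ ⨆ j < i, spectralSubspace E (a j) := by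
  obtain ⟨z, hz, w, hw0, hw⟩ := exists_eigenvector ha_range i
  by_contra! h
  set T := ⨆ z ∈ {z : ℂ | z.re < a i},
    Module.End.maxGenEigenspace (Matrix.toLin' (E.map (algebraMap ℝ ℂ))) z with hT
  have hle : ⨆ j < i, spectralSubspace E (a j) ≤
      Submodule.comap (complexify d) (Submodule.restrictScalars ℝ T) := by
    refine iSup₂_le fun j hj => Submodule.comap_mono ?_
    intro w hw
    refine (iSup₂_le fun z hz => ?_ : (⨆ z ∈ {z : ℂ | z.re = a j},
      Module.End.maxGenEigenspace (Matrix.toLin' (E.map (algebraMap ℝ ℂ))) z) ≤ _) hw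
    have hz' : z ∈ {z : ℂ | z.re < a i} := by
      have h1 : z.re = a j := hz
      have h2 := ha_mono hj
      exact h1.le.trans_lt h2
    exact le_iSup₂ (f := fun z (_ : z ∈ {z : ℂ | z.re < a i}) =>
      Module.End.maxGenEigenspace (Matrix.toLin' (E.map (algebraMap ℝ ℂ))) z) z hz'
  have h1 : ∀ x : EuclideanSpace ℝ (Fin d), complexify d x ∈ T := fun x => hle (h x)
  have h2 : w ∈ T := by
    have h3 : w = complexify d (reVec d w) +
        Complex.I • complexify d (reVec d (-Complex.I • w)) := by
      ext i
      simp [reVec, complexify, mul_comm Complex.I]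
    rw [h3]
    exact T.add_mem (h1 _) (T.smul_mem _ (h1 _))
  have hdisj := (Module.End.independent_maxGenEigenspace
    (Matrix.toLin' (E.map (algebraMap ℝ ℂ)))).disjoint_biSup_biSup
    (s := {z : ℂ | z.re < a i}) (t := {z : ℂ | z.re = a i}) (by
      rw [Set.disjoint_left]
      intro z hz hz'
      exact absurd (show z.re < a i from hz) (not_lt.2 (le_of_eq hz'.symm)))
  exact hw0 (Submodule.disjoint_def.1 hdisj w h2
    (Submodule.mem_iSup_of_mem z (Submodule.mem_iSup_of_mem hz hw)))

lemma exists_norm_flow_le_of_mem (ha_mono : StrictMono a) (i : Fin (p + 1))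
    {u : EuclideanSpace ℝ (Fin d)} (hu : u ∈ ⨆ j ≤ i, spectralSubspace E (a j)) {ε : ℝ}
    (hε : 0 < ε) : ∃ C : ℝ, ∀ t : ℝ, 0 ≤ t → ‖flow E t u‖ ≤ C * Real.exp ((a i + ε) * t) := by
  obtain ⟨C, hC⟩ := exists_norm_exp_smul_apply_le_of_mem_iSup (complexOp E) 1 (by simp)
    {z : ℂ | z.re ≤ a i} (a i) (fun z hz => by simpa using hz) hε
    (complexify_mem_iSup_le ha_mono i hu)
  obtain ⟨K, hK0, hK⟩ := exists_norm_complexify_bounds d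
  refine ⟨K * C, fun t ht => ?_⟩
  refine (hK _).2.trans ?_
  rw [complexify_flow, mul_assoc]
  have := hC t ht
  rw [one_mul] at this
  gcongr

lemma iSup_maxGenEigenspace_eq_top_of_forall (ha_range : Set.range a = realSpectrum E) (s : Set ℂ)
    (hs : ∀ z : ℂ, (∃ i, a i = z.re) → z ∈ s) :
    ⨆ z ∈ s, Module.End.maxGenEigenspace (Matrix.toLin' (E.map (algebraMap ℝ ℂ))) z = ⊤ := by
  rw [eq_top_iff, ← Module.End.iSup_maxGenEigenspace_eq_top]
  refine iSup_le fun z y hy => ?_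
  by_cases hy0 : y = 0
  · rw [hy0]; exact Submodule.zero_mem _
  have h1 := re_mem_realSpectrum E z hy0 hy
  rw [← ha_range] at h1
  exact Submodule.mem_iSup_of_mem z (Submodule.mem_iSup_of_mem (hs z h1) hy)

lemma exists_norm_flow_le (ha_mono : StrictMono a) (ha_range : Set.range a = realSpectrum E)
    {ε : ℝ} (hε : 0 < ε) : ∃ C : ℝ, 0 < C ∧ ∀ t : ℝ, 0 ≤ t → ∀ x,
      ‖flow E t x‖ ≤ C * Real.exp ((a (Fin.last p) + ε) * t) * ‖x‖ := by
  obtain ⟨K, hK0, hK⟩ := exists_norm_complexify_bounds d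
  refine exists_uniform_exp_bound (fun t => flow E t) _ fun x => ?_
  have hx : complexify d x ∈ ⨆ z ∈ {z : ℂ | z.re ≤ a (Fin.last p)},
      Module.End.maxGenEigenspace (Matrix.toLin' (E.map (algebraMap ℝ ℂ))) z := by
    rw [iSup_maxGenEigenspace_eq_top_of_forall ha_range]
    · trivial
    · rintro z ⟨i, hi⟩
      have : a i ≤ a (Fin.last p) := ha_mono.monotone (Fin.le_last i)
      exact (hi ▸ this : z.re ≤ a (Fin.last p))
  obtain ⟨C, hC⟩ := exists_norm_exp_smul_apply_le_of_mem_iSup (complexOp E) 1 (by simp)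
    {z : ℂ | z.re ≤ a (Fin.last p)} (a (Fin.last p)) (fun z hz => by simpa using hz) hε hx
  refine ⟨K * C, fun t ht => ?_⟩
  refine (hK _).2.trans ?_
  rw [complexify_flow, mul_assoc]
  have := hC t ht
  rw [one_mul] at this
  gcongr

lemma exists_norm_flow_neg_le (ha_mono : StrictMono a) (ha_range : Set.range a = realSpectrum E)
    {ε : ℝ} (hε : 0 < ε) : ∃ C : ℝ, 0 < C ∧ ∀ t : ℝ, 0 ≤ t → ∀ x,
      ‖flow E (-t) x‖ ≤ C * Real.exp ((-a 0 + ε) * t) * ‖x‖ := by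
  obtain ⟨K, hK0, hK⟩ := exists_norm_complexify_bounds d
  refine exists_uniform_exp_bound (fun t => flow E (-t)) _ fun x => ?_
  have hx : complexify d x ∈ ⨆ z ∈ {z : ℂ | a 0 ≤ z.re},
      Module.End.maxGenEigenspace (Matrix.toLin' (E.map (algebraMap ℝ ℂ))) z := by
    rw [iSup_maxGenEigenspace_eq_top_of_forall ha_range]
    · trivial
    · rintro z ⟨i, hi⟩
      have : a 0 ≤ a i := ha_mono.monotone (Fin.zero_le i)
      exact (hi ▸ this : a 0 ≤ z.re)
  obtain ⟨C, hC⟩ := exists_norm_exp_smul_apply_le_of_mem_iSup (complexOp E) (-1) (by simp)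
    {z : ℂ | a 0 ≤ z.re} (-a 0) (fun z hz => by simpa using hz) hε hx
  refine ⟨K * C, fun t ht => ?_⟩
  refine (hK _).2.trans ?_
  rw [complexify_flow, mul_assoc]
  have := hC t ht
  rw [neg_one_mul] at this
  gcongr

lemma exists_le_norm_flow (ha_mono : StrictMono a) (ha_range : Set.range a = realSpectrum E)
    (i : Fin (p + 1)) {u : EuclideanSpace ℝ (Fin d)}
    (hu : u ∉ ⨆ j < i, spectralSubspace E (a j)) {ε : ℝ} (hε : 0 < ε) :
    ∃ c : ℝ, 0 < c ∧ ∀ t : ℝ, 0 ≤ t → c * Real.exp ((a i - ε) * t) ≤ ‖flow E t u‖ := by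
  have hu' : complexify d u ∉ ⨆ z ∈ {z : ℂ | z.re < a i},
      Module.End.maxGenEigenspace (Matrix.toLin' (E.map (algebraMap ℝ ℂ))) z := by
    intro h
    apply hu
    rw [← reVec_complexify u]
    exact reVec_mem_of_mem_iSup_lt ha_mono ha_range i h
  obtain ⟨c, hc, h⟩ := exists_le_norm_exp_smul_apply (complexOp E) (a i) hε hu'
  obtain ⟨K, hK0, hK⟩ := exists_norm_complexify_bounds d
  refine ⟨c / K, by positivity, fun t ht => ?_⟩
  have h1 := h t ht
  rw [← complexify_flow] at h1
  have h2 := h1.trans (hK _).1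
  rw [div_mul_eq_mul_div, div_le_iff₀ hK0]
  linarith

end MatrixFlow

/-! ### The determinant of the flow and the change of variables -/

section Determinant

variable {d : ℕ}

/-- The determinant is multiplicative along the flow and has derivative `trace E` at time zero, so
it solves `y' = (trace E) y`. -/
lemma det_flow (E : Matrix (Fin d) (Fin d) ℝ) (t : ℝ) :
    (flow E t : EuclideanSpace ℝ (Fin d) →L[ℝ] EuclideanSpace ℝ (Fin d)).det
      = Real.exp (t * E.trace) := by
  let Φ := (Matrix.toEuclideanCLM (𝕜 := ℝ) (n := Fin d)).symm
  have hdet : ∀ L : EuclideanSpace ℝ (Fin d) →L[ℝ] EuclideanSpace ℝ (Fin d),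
      L.det = (Φ L).det := by
    intro L
    have h1 : (L : EuclideanSpace ℝ (Fin d) →ₗ[ℝ] EuclideanSpace ℝ (Fin d))
        = Matrix.toEuclideanLin (Φ L) := by
      rw [← Matrix.coe_toEuclideanCLM_eq_toEuclideanLin]
      simp [Φ]
    rw [ContinuousLinearMap.det, h1, Matrix.toEuclideanLin_eq_toLin_orthonormal,
      LinearMap.det_toLin]
  have hdiff : Differentiable ℝ fun L : EuclideanSpace ℝ (Fin d) →L[ℝ] EuclideanSpace ℝ (Fin d) =>
      L.det := by
    simp_rw [hdet, Matrix.det_apply]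
    have h1 : ∀ i j, Differentiable ℝ
        fun L : EuclideanSpace ℝ (Fin d) →L[ℝ] EuclideanSpace ℝ (Fin d) => Φ L i j := by
      intro i j
      let ℓ : (EuclideanSpace ℝ (Fin d) →L[ℝ] EuclideanSpace ℝ (Fin d)) →ₗ[ℝ] ℝ :=
        { toFun := fun L => Φ L i j
          map_add' := fun L L' => by simp
          map_smul' := fun r L => by simp }
      exact (LinearMap.toContinuousLinearMap ℓ).differentiable
    fun_prop
  -- The curves `1 + h E` and `exp(h E)` have the same tangent at zero, so the derivative can be
  -- read off the polynomial `det (1 + h E)`.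
  have hderiv0 : HasDerivAt (fun t => (flow E t).det) E.trace 0 := by
    have h1 : HasDerivAt (fun h : ℝ => (1 : EuclideanSpace ℝ (Fin d) →L[ℝ] EuclideanSpace ℝ (Fin d))
        + h • Matrix.toEuclideanCLM (𝕜 := ℝ) E) (Matrix.toEuclideanCLM (𝕜 := ℝ) E) 0 := by
      simpa using ((hasDerivAt_id (0 : ℝ)).smul_const
        (Matrix.toEuclideanCLM (𝕜 := ℝ) E)).const_add 1
    have h2 : HasDerivAt (flow E) (Matrix.toEuclideanCLM (𝕜 := ℝ) E) 0 := by
      simpa using hasDerivAt_expFlow (Matrix.toEuclideanCLM (𝕜 := ℝ) E) 0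
    have hD := (hdiff 1).hasFDerivAt
    have h3 := HasFDerivAt.comp_hasDerivAt_of_eq (0 : ℝ) hD h1 (by
      ext1 x
      change x = x + (0 : ℝ) • _
      rw [zero_smul, add_zero])
    have h4 := HasFDerivAt.comp_hasDerivAt_of_eq (0 : ℝ) hD h2 (by simp)
    obtain ⟨Q, hQ⟩ : ∃ Q : Polynomial ℝ, ∀ h : ℝ,
        (1 + h • E).det = 1 + E.trace * h + Q.eval h * h ^ 2 :=
      ⟨_, fun h => Matrix.det_one_add_smul h E⟩
    have h5 : HasDerivAt (fun h : ℝ => 1 + E.trace * h + Q.eval h * h ^ 2) E.trace 0 := by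
      have h6 := ((hasDerivAt_id (0 : ℝ)).const_mul E.trace).const_add 1
      have h7 := (Q.hasDerivAt (0 : ℝ)).mul (hasDerivAt_pow 2 (0 : ℝ))
      convert! h6.add h7 using 1
      simp
    have h8 : ((fun L : EuclideanSpace ℝ (Fin d) →L[ℝ] EuclideanSpace ℝ (Fin d) => L.det) ∘
        fun h : ℝ => 1 + h • Matrix.toEuclideanCLM (𝕜 := ℝ) E) =
          fun h : ℝ => 1 + E.trace * h + Q.eval h * h ^ 2 := by
      ext h
      rw [Function.comp_apply, hdet, ← hQ]
      congr 1
      simp [Φ]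
    rw [h8] at h3
    rw [h5.unique h3]
    exact h4
  have hmul : ∀ s t, (flow E (s + t)).det = (flow E s).det * (flow E t).det := by
    intro s t
    rw [flow, expFlow_add]
    exact LinearMap.det_comp _ _
  have hderiv : ∀ t, HasDerivAt (fun t => (flow E t).det) ((flow E t).det * E.trace) t := by
    intro t
    have h1 : HasDerivAt (fun s => s - t) 1 t := (hasDerivAt_id t).sub_const t
    have h2 := HasDerivAt.comp_of_eq t hderiv0 h1 (by simp)
    have h3 := h2.const_mul (flow E t).det
    convert! h3 using 1
    · ext s
      rw [Function.comp_apply, ← hmul]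
      simp
    · simp
  have hconst : ∀ t, HasDerivAt (fun t => (flow E t).det * Real.exp (-(t * E.trace))) 0 t := by
    intro t
    have h1 : HasDerivAt (fun t => Real.exp (-(t * E.trace)))
        (Real.exp (-(t * E.trace)) * (-(1 * E.trace))) t :=
      (((hasDerivAt_id t).mul_const E.trace).neg).exp
    convert! (hderiv t).mul h1 using 1
    ring
  have h := is_const_of_deriv_eq_zero (fun t => (hconst t).differentiableAt)
    (fun t => (hconst t).deriv) t 0
  simp only [flow, expFlow_zero, zero_mul, neg_zero, Real.exp_zero, mul_one] at h
  rw [Real.exp_neg, mul_inv_eq_iff_eq_mul₀ (Real.exp_ne_zero _)] at h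
  rw [h]
  have : (1 : EuclideanSpace ℝ (Fin d) →L[ℝ] EuclideanSpace ℝ (Fin d)).det = 1 :=
    LinearMap.det_id
  rw [this, one_mul]

variable (μ : Measure (EuclideanSpace ℝ (Fin d))) [μ.IsAddHaarMeasure]

lemma map_flow_measure (E : Matrix (Fin d) (Fin d) ℝ) (t : ℝ) :
    μ.map (flow E t) = ENNReal.ofReal (Real.exp (-(t * E.trace))) • μ := by
  have h : LinearMap.det (flow E t : EuclideanSpace ℝ (Fin d) →ₗ[ℝ] EuclideanSpace ℝ (Fin d))
      = Real.exp (t * E.trace) := det_flow E t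
  have h1 := Measure.map_linearMap_addHaar_eq_smul_addHaar μ
    (f := (flow E t : EuclideanSpace ℝ (Fin d) →ₗ[ℝ] EuclideanSpace ℝ (Fin d)))
    (by rw [h]; exact Real.exp_ne_zero _)
  rw [h, ← Real.exp_neg, abs_of_pos (Real.exp_pos _)] at h1
  exact h1

lemma lintegral_comp_flow (E : Matrix (Fin d) (Fin d) ℝ) (t : ℝ)
    {g : EuclideanSpace ℝ (Fin d) → ℝ≥0∞} (hg : Measurable g) :
    ∫⁻ y, g (flow E t y) ∂μ = ENNReal.ofReal (Real.exp (-(t * E.trace))) * ∫⁻ y, g y ∂μ := by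
  rw [← lintegral_map hg (flow E t).measurable, map_flow_measure, lintegral_smul_measure,
    smul_eq_mul]

end Determinant

/-! ### Homogeneous gauges -/

section Gauge

variable {d : ℕ}

/-- The flow of `E` contracts at rate `b` in negative time. -/
def IsContracting (E : Matrix (Fin d) (Fin d) ℝ) (b : ℝ) : Prop :=
  ∃ C : ℝ, 0 < C ∧ ∀ t : ℝ, 0 ≤ t → ∀ x, ‖flow E (-t) x‖ ≤ C * Real.exp (-(b * t)) * ‖x‖

/-- A continuous function that is positive off the origin and homogeneous for the flow of `E`. -/
structure IsGauge (E : Matrix (Fin d) (Fin d) ℝ) (φ : EuclideanSpace ℝ (Fin d) → ℝ) : Prop where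
  continuous : Continuous φ
  pos : ∀ x, x ≠ 0 → 0 < φ x
  hom : ∀ t x, φ (flow E t x) = Real.exp t * φ x

variable {E : Matrix (Fin d) (Fin d) ℝ} {b : ℝ} {φ : EuclideanSpace ℝ (Fin d) → ℝ}

lemma IsContracting.tendsto (hE : IsContracting E b) (hb : 0 < b) (x : EuclideanSpace ℝ (Fin d)) :
    Tendsto (fun t => flow E (-t) x) atTop (𝓝 0) := by
  obtain ⟨C, hC, h⟩ := hE
  have h1 : Tendsto (fun t : ℝ => C * Real.exp (-(b * t)) * ‖x‖) atTop (𝓝 0) := by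
    have h2 : Tendsto (fun t : ℝ => Real.exp (-(b * t))) atTop (𝓝 0) :=
      Real.tendsto_exp_neg_atTop_nhds_zero.comp (tendsto_id.const_mul_atTop hb)
    simpa using (h2.const_mul C).mul_const ‖x‖
  refine squeeze_zero_norm' ?_ h1
  filter_upwards [eventually_ge_atTop 0] with t ht using h t ht x

lemma IsContracting.exists_norm_eq (hE : IsContracting E b) (hb : 0 < b)
    {x : EuclideanSpace ℝ (Fin d)} {ρ : ℝ} (hρ : 0 < ρ) (hx : ρ ≤ ‖x‖) :
    ∃ t : ℝ, 0 ≤ t ∧ ‖flow E (-t) x‖ = ρ := by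
  have h1 : Tendsto (fun t => ‖flow E (-t) x‖) atTop (𝓝 0) := by
    simpa using (hE.tendsto hb x).norm
  obtain ⟨T, hT0, hT⟩ := ((eventually_ge_atTop (0 : ℝ)).and (h1.eventually_lt_const hρ)).exists
  have hcont : Continuous fun t => ‖flow E (-t) x‖ :=
    ((continuous_expFlow_apply _ x).comp continuous_neg).norm
  obtain ⟨t, ht, hte⟩ := intermediate_value_Icc' hT0 hcont.continuousOn
    (show ρ ∈ Set.Icc ‖flow E (-T) x‖ ‖flow E (-0) x‖ from ⟨hT.le, by simpa using hx⟩)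
  exact ⟨t, ht.1, hte⟩

namespace IsGauge

lemma zero (hφ : IsGauge E φ) : φ 0 = 0 := by
  have h := hφ.hom 1 0
  rw [map_zero] at h
  have h1 : (1 : ℝ) < Real.exp 1 := by simp
  nlinarith

lemma nonneg (hφ : IsGauge E φ) (x : EuclideanSpace ℝ (Fin d)) : 0 ≤ φ x := by
  by_cases hx : x = 0
  · rw [hx, hφ.zero]
  · exact (hφ.pos x hx).le

/-- A point of norm above one is `exp(tE) θ` with `‖θ‖ = 1` and `t ≥ 0`. There `φ` equals `e^t φ θ ≥
e^t m`, which bounds `t` by `log (r/m)` and confines the point to a compact piece of the flow. -/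
lemma exists_norm_le (hφ : IsGauge E φ) (hE : IsContracting E b) (hb : 0 < b) (r : ℝ) :
    ∃ R : ℝ, 0 < R ∧ ∀ x, φ x ≤ r → ‖x‖ ≤ R := by
  obtain ⟨m, hm0, hm⟩ : ∃ m : ℝ, 0 < m ∧ ∀ θ : EuclideanSpace ℝ (Fin d), ‖θ‖ = 1 → m ≤ φ θ := by
    -- The sphere is empty when `d = 0`.
    rcases (Metric.sphere (0 : EuclideanSpace ℝ (Fin d)) 1).eq_empty_or_nonempty with h | h
    · refine ⟨1, one_pos, fun θ hθ => ?_⟩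
      have : θ ∈ Metric.sphere (0 : EuclideanSpace ℝ (Fin d)) 1 := by simpa using hθ
      rw [h] at this
      exact this.elim
    · obtain ⟨θ₀, hθ₀, hmin⟩ := (isCompact_sphere (0 : EuclideanSpace ℝ (Fin d)) 1).exists_isMinOn h
        hφ.continuous.continuousOn
      refine ⟨φ θ₀, hφ.pos _ (by rintro rfl; simp at hθ₀), fun θ hθ => ?_⟩
      exact hmin (by simpa using hθ)
  obtain ⟨B, hB⟩ := (isCompact_Icc (a := (0 : ℝ)) (b :=
    Real.log (r / m))).exists_bound_of_continuousOn (f := fun t => flow E t)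
    (continuous_expFlow _).continuousOn
  refine ⟨max 1 B, by positivity, fun x hx => ?_⟩
  rcases le_or_gt ‖x‖ 1 with h1 | h1
  · exact h1.trans (le_max_left _ _)
  obtain ⟨t, ht0, ht⟩ := hE.exists_norm_eq hb one_pos h1.le
  have h2 := hφ.hom t (flow E (-t) x)
  rw [expFlow_apply_expFlow_neg] at h2
  have h3 := hm _ ht
  have h4 : Real.exp t ≤ r / m := by
    rw [le_div_iff₀ hm0]
    exact (mul_le_mul_of_nonneg_left h3 (Real.exp_pos t).le).trans (h2 ▸ hx)
  have h5 : t ≤ Real.log (r / m) := by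
    rw [← Real.log_exp t]
    exact Real.log_le_log (Real.exp_pos _) h4
  have h6 := hB t ⟨ht0, h5⟩
  have h7 := (flow E t).le_opNorm (flow E (-t) x)
  rw [expFlow_apply_expFlow_neg, ht, mul_one] at h7
  exact h7.trans (h6.trans (le_max_right _ _))

lemma exists_le_norm (hφ : IsGauge E φ) {r : ℝ} (hr : 0 < r) :
    ∃ δ : ℝ, 0 < δ ∧ ∀ x, r ≤ φ x → δ ≤ ‖x‖ := by
  have h : ∀ᶠ x in 𝓝 (0 : EuclideanSpace ℝ (Fin d)), φ x < r :=
    hφ.continuous.continuousAt.eventually_lt_const (by rw [hφ.zero]; exact hr)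
  obtain ⟨δ, hδ, h'⟩ := Metric.eventually_nhds_iff.1 h
  refine ⟨δ, hδ, fun x hx => ?_⟩
  by_contra! hlt
  exact absurd (h' (by simpa using hlt)) (not_lt.2 hx)

lemma exists_le_of_norm_le (hφ : IsGauge E φ) (R : ℝ) :
    ∃ M : ℝ, 0 < M ∧ ∀ x, ‖x‖ ≤ R → φ x < M := by
  obtain ⟨B, hB⟩ :=
    (isCompact_closedBall (0 : EuclideanSpace ℝ (Fin d)) R).exists_bound_of_continuousOn
      hφ.continuous.continuousOn
  refine ⟨max B 0 + 1, by positivity, fun x hx => ?_⟩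
  have h1 := hB x (by simpa using hx)
  have h2 := le_abs_self (φ x)
  rw [Real.norm_eq_abs] at h1
  have := le_max_left B 0
  linarith

variable (μ : Measure (EuclideanSpace ℝ (Fin d))) [μ.IsAddHaarMeasure]

lemma measurableSet_shell (hφ : IsGauge E φ) (k : ℝ) :
    MeasurableSet {y | Real.exp k ≤ φ y ∧ φ y < Real.exp (k + 1)} :=
  (measurableSet_le measurable_const hφ.continuous.measurable).inter
    (measurableSet_lt hφ.continuous.measurable measurable_const)

lemma measure_shell (hφ : IsGauge E φ) (k : ℝ) :
    μ {y | Real.exp k ≤ φ y ∧ φ y < Real.exp (k + 1)}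
      = ENNReal.ofReal (Real.exp (k * E.trace)) *
        μ {y | Real.exp 0 ≤ φ y ∧ φ y < Real.exp (0 + 1)} := by
  have h1 : {y | Real.exp k ≤ φ y ∧ φ y < Real.exp (k + 1)}
      = flow E (-k) ⁻¹' {y | Real.exp 0 ≤ φ y ∧ φ y < Real.exp (0 + 1)} := by
    ext y
    simp only [Set.mem_ofPred_eq, Set.mem_preimage, hφ.hom]
    rw [Real.exp_add, Real.exp_add, Real.exp_neg, Real.exp_zero, one_mul,
      inv_mul_lt_iff₀ (Real.exp_pos k),
      le_inv_mul_iff₀ (Real.exp_pos k), mul_one]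
  rw [h1, ← Measure.map_apply (flow E (-k)).measurable (hφ.measurableSet_shell 0), map_flow_measure,
    Measure.smul_apply, smul_eq_mul]
  congr 3
  ring

/-- On the shell at level `k` the power `φ ^ s` is `e^{ks}` up to the factor `e^{|s|}`, while the
flow carries the shell at level zero to it and multiplies volume by `e^{k trace E}`. The integral is
thus dominated by the series in `hk`; the next two lemmas take geometric series going to infinity
and to the origin. -/
lemma setLIntegral_shells_lt_top (hφ : IsGauge E φ) (hE : IsContracting E b) (hb : 0 < b)
    (s : ℝ) (k : ℕ → ℝ) (hk : Summable fun n => Real.exp (k n * (s + E.trace))) :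
    ∫⁻ y in ⋃ n, {y | Real.exp (k n) ≤ φ y ∧ φ y < Real.exp (k n + 1)},
      ENNReal.ofReal (φ y ^ s) ∂μ < ∞ := by
  obtain ⟨R, -, hR⟩ := hφ.exists_norm_le hE hb (Real.exp (0 + 1))
  have hfin : μ {y | Real.exp 0 ≤ φ y ∧ φ y < Real.exp (0 + 1)} < ∞ := by
    refine (measure_mono (t := Metric.closedBall 0 R) fun y hy => ?_).trans_lt
      (isCompact_closedBall 0 R).measure_lt_top
    simpa using hR y hy.2.le
  refine (lintegral_iUnion_le _ _).trans_lt ?_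
  have hbound : ∀ n, ∫⁻ y in {y | Real.exp (k n) ≤ φ y ∧ φ y < Real.exp (k n + 1)},
      ENNReal.ofReal (φ y ^ s) ∂μ ≤ ENNReal.ofReal (Real.exp (k n * (s + E.trace))) *
        (ENNReal.ofReal (Real.exp |s|) *
          μ {y | Real.exp 0 ≤ φ y ∧ φ y < Real.exp (0 + 1)}) := by
    intro n
    calc _ ≤ ∫⁻ y in {y | Real.exp (k n) ≤ φ y ∧ φ y < Real.exp (k n + 1)},
          ENNReal.ofReal (Real.exp (k n * s + |s|)) ∂μ := by
          refine setLIntegral_mono' (hφ.measurableSet_shell _) fun y hy => ?_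
          refine ENNReal.ofReal_le_ofReal ?_
          have hpos : 0 < φ y := (Real.exp_pos _).trans_le hy.1
          rw [Real.rpow_def_of_pos hpos]
          refine Real.exp_le_exp.2 ?_
          have h1 : k n ≤ Real.log (φ y) := (Real.le_log_iff_exp_le hpos).2 hy.1
          have h2 : Real.log (φ y) ≤ k n + 1 := ((Real.log_lt_iff_lt_exp hpos).2 hy.2).le
          have h3 : |(Real.log (φ y) - k n) * s| ≤ 1 * |s| := by
            rw [abs_mul]
            gcongr
            rw [abs_le]
            constructor <;> linarith
          have := le_abs_self ((Real.log (φ y) - k n) * s)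
          linarith
      _ = _ := by
          rw [setLIntegral_const, measure_shell μ hφ, ← mul_assoc, ← mul_assoc,
            ← ENNReal.ofReal_mul (Real.exp_pos _).le, ← ENNReal.ofReal_mul (Real.exp_pos _).le,
            ← Real.exp_add, ← Real.exp_add]
          congr 3
          ring
  refine (ENNReal.tsum_le_tsum hbound).trans_lt ?_
  rw [ENNReal.tsum_mul_right]
  exact ENNReal.mul_lt_top (lt_top_iff_ne_top.2 hk.tsum_ofReal_ne_top)
    (ENNReal.mul_lt_top ENNReal.ofReal_lt_top hfin)

lemma setLIntegral_ge_lt_top (hφ : IsGauge E φ) (hE : IsContracting E b) (hb : 0 < b)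
    {s : ℝ} (hs : s + E.trace < 0) (k : ℝ) :
    ∫⁻ y in {y | Real.exp k ≤ φ y}, ENNReal.ofReal (φ y ^ s) ∂μ < ∞ := by
  have hsum : Summable fun n : ℕ => Real.exp ((k + n) * (s + E.trace)) := by
    have h1 : Summable fun n : ℕ => Real.exp (s + E.trace) ^ n :=
      summable_geometric_of_lt_one (Real.exp_pos _).le (by rwa [Real.exp_lt_one_iff])
    convert! h1.mul_left (Real.exp (k * (s + E.trace))) using 2 with n
    rw [← Real.exp_nat_mul, ← Real.exp_add]
    ring_nf
  refine (lintegral_mono_set fun y hy => ?_).trans_lt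
    (setLIntegral_shells_lt_top μ hφ hE hb s (fun n => k + n) hsum)
  have hpos : 0 < φ y := (Real.exp_pos _).trans_le hy
  have h1 : k ≤ Real.log (φ y) := (Real.le_log_iff_exp_le hpos).2 hy
  have h2 := Nat.floor_le (sub_nonneg.2 h1)
  have h3 := Nat.lt_floor_add_one (Real.log (φ y) - k)
  refine Set.mem_iUnion.2 ⟨⌊Real.log (φ y) - k⌋₊, ?_, ?_⟩
  · rw [← Real.le_log_iff_exp_le hpos]; linarith
  · rw [← Real.log_lt_iff_lt_exp hpos]; linarith

lemma setLIntegral_lt_lt_top (hφ : IsGauge E φ) (hE : IsContracting E b) (hb : 0 < b)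
    {s : ℝ} (hs : 0 < s + E.trace) (r : ℝ) :
    ∫⁻ y in {y | φ y < r}, ENNReal.ofReal (φ y ^ s) ∂μ < ∞ := by
  set k := Real.log r with hk
  have hsum : Summable fun n : ℕ => Real.exp ((k - n - 1) * (s + E.trace)) := by
    have h1 : Summable fun n : ℕ => Real.exp (-(s + E.trace)) ^ n :=
      summable_geometric_of_lt_one (Real.exp_pos _).le (by rw [Real.exp_lt_one_iff]; linarith)
    convert! h1.mul_left (Real.exp ((k - 1) * (s + E.trace))) using 2 with n
    rw [← Real.exp_nat_mul, ← Real.exp_add]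
    ring_nf
  -- The origin lies in no shell; being a compact set, it contributes only a finite amount.
  have hsub : {y | φ y < r} ⊆
      {0} ∪ ⋃ n : ℕ, {y | Real.exp (k - n - 1) ≤ φ y ∧ φ y < Real.exp (k - n - 1 + 1)} := by
    intro y hy
    by_cases hy0 : y = 0
    · exact Or.inl hy0
    right
    have hpos : 0 < φ y := hφ.pos y hy0
    have h1 : Real.log (φ y) < k := Real.log_lt_log hpos hy
    have h2 := Nat.ceil_lt_add_one (a := k - Real.log (φ y)) (by linarith)
    have h3 := Nat.le_ceil (k - Real.log (φ y))
    have h4 : 1 ≤ ⌈k - Real.log (φ y)⌉₊ := Nat.one_le_ceil_iff.2 (by linarith)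
    refine Set.mem_iUnion.2 ⟨⌈k - Real.log (φ y)⌉₊ - 1, ?_, ?_⟩
    · rw [← Real.le_log_iff_exp_le hpos, Nat.cast_sub h4]; push_cast; linarith
    · rw [← Real.log_lt_iff_lt_exp hpos, Nat.cast_sub h4]; push_cast; linarith
  refine (lintegral_mono_set hsub).trans_lt ((lintegral_union_le _ _ _).trans_lt ?_)
  refine ENNReal.add_lt_top.2 ⟨?_, setLIntegral_shells_lt_top μ hφ hE hb s _ hsum⟩
  rw [lintegral_singleton]
  exact ENNReal.mul_lt_top ENNReal.ofReal_lt_top isCompact_singleton.measure_lt_top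

end IsGauge

end Gauge

/-! ### The radial part and admissible functions -/

section Radial

variable {d : ℕ} {E : Matrix (Fin d) (Fin d) ℝ} {b : ℝ} {φ : EuclideanSpace ℝ (Fin d) → ℝ}

/-- Contraction gives `‖t^E x‖ / t ≤ C t^{b-1} ‖x‖` on `(0, 1]`, which integrates to `(C / b) ‖x‖`.
-/
lemma IsContracting.exists_adaptedNorm_le (hE : IsContracting E b) (hb : 0 < b) :
    ∃ K : ℝ, 0 < K ∧ ∀ x, adaptedNorm E x ≤ K * ‖x‖ := by
  obtain ⟨C, hC, h⟩ := hE
  refine ⟨C / b, by positivity, fun x => ?_⟩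
  have hint : IntervalIntegrable (fun t : ℝ => C * ‖x‖ * t ^ (b - 1)) volume 0 1 :=
    (intervalIntegral.intervalIntegrable_rpow' (by linarith)).const_mul _
  have h1 : ‖∫ t in (0 : ℝ)..1, ‖opPow E t x‖ / t‖ ≤
      ∫ t in (0 : ℝ)..1, C * ‖x‖ * t ^ (b - 1) := by
    refine intervalIntegral.norm_integral_le_of_norm_le zero_le_one
      (ae_of_all _ fun t ht => ?_) hint
    have ht0 : 0 < t := ht.1
    rw [opPow_eq, Real.norm_of_nonneg (by positivity), div_le_iff₀ ht0]
    have h2 := h (-Real.log t) (by linarith [Real.log_nonpos ht0.le ht.2]) x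
    rw [neg_neg] at h2
    refine h2.trans (le_of_eq ?_)
    have h3 : Real.exp (-(b * -Real.log t)) = t ^ (b - 1) * t := by
      nth_rewrite 3 [← Real.rpow_one t]
      rw [← Real.rpow_add ht0, Real.rpow_def_of_pos ht0]
      ring_nf
    rw [h3]; ring
  have h4 : ∫ t in (0 : ℝ)..1, C * ‖x‖ * t ^ (b - 1) = C / b * ‖x‖ := by
    rw [intervalIntegral.integral_const_mul, integral_rpow (Or.inl (by linarith)), sub_add_cancel,
      Real.one_rpow, Real.zero_rpow hb.ne', sub_zero]
    ring
  rw [h4] at h1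
  exact (le_abs_self _).trans h1

lemma radial_nonneg (E : Matrix (Fin d) (Fin d) ℝ) (x : EuclideanSpace ℝ (Fin d)) :
    0 ≤ radial E x :=
  Real.sInf_nonneg fun _ hr => hr.1.le

/-- Apart from nonnegativity, only upper bounds for the radial part are needed, so a single member
of the set under the infimum suffices. -/
lemma radial_le_exp {x : EuclideanSpace ℝ (Fin d)} {t : ℝ}
    (h : adaptedNorm E (flow E (-t) x) ≤ 1) : radial E x ≤ Real.exp t := by
  refine csInf_le ⟨0, fun _ hr => hr.1.le⟩ ⟨Real.exp_pos t, ?_⟩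
  rwa [← Real.exp_neg, opPow_exp]

/-- Homogeneity is given only off the origin. Following a nonzero orbit backwards to the origin
gives `φ 0 = 0` by continuity; `d > 0` supplies such an orbit. -/
lemma IsContracting.isGauge (hE : IsContracting E b) (hb : 0 < b) (hc : Continuous φ)
    (hpos : ∀ x, x ≠ 0 → 0 < φ x) (hhom : IsHomogeneous E φ) (hd : 0 < d) : IsGauge E φ := by
  have hhom' : ∀ t x, x ≠ 0 → φ (flow E t x) = Real.exp t * φ x := by
    intro t x hx
    rw [← hhom _ (Real.exp_pos t) x hx, opPow_exp]
  have : Nontrivial (EuclideanSpace ℝ (Fin d)) := by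
    have : Nonempty (Fin d) := ⟨⟨0, hd⟩⟩
    infer_instance
  obtain ⟨x, hx⟩ := exists_ne (0 : EuclideanSpace ℝ (Fin d))
  have h0 : φ 0 = 0 := by
    have h1 := (hc.tendsto 0).comp (hE.tendsto hb x)
    have h2 : Tendsto (fun t : ℝ => Real.exp (-t) * φ x) atTop (𝓝 0) := by
      simpa using Real.tendsto_exp_neg_atTop_nhds_zero.mul_const (φ x)
    refine tendsto_nhds_unique h1 (h2.congr fun t => ?_)
    rw [Function.comp_apply, hhom' _ _ hx]
  refine ⟨hc, hpos, fun t x => ?_⟩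
  by_cases hx : x = 0
  · rw [hx, map_zero, h0, mul_zero]
  · exact hhom' t x hx

/-- The exponent of an admissible homogeneous function is at most the smallest real part. -/
lemma IsAdmissible.le_of_growth {β : ℝ} (hφ : IsGauge E φ) (hadm : IsAdmissible β E φ)
    (hE : IsContracting E b) (hb : 0 < b) {a₀ : ℝ} (ha₀ : 0 < a₀) {x₀ : EuclideanSpace ℝ (Fin d)}
    (hx₀ : x₀ ≠ 0)
    (hgrowth : ∀ ε : ℝ, 0 < ε → ∃ C : ℝ, ∀ t : ℝ, 0 ≤ t →
      ‖flow E t x₀‖ ≤ C * Real.exp ((a₀ + ε) * t)) : β ≤ a₀ := by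
  -- Take `ρ` strictly between `a₀` and `β`, and `z = exp(hE) x₀ - x₀`. Then `τ(z) = O(h^{1/ρ})`,
  -- whereas `φ (z + x₀) - φ x₀ = (e^h - 1) φ x₀ ≥ h φ x₀`. Admissibility yields `φ x₀ ≤ C' h^{β/ρ -
  -- 1}`, which tends to zero with `h`.
  by_contra! hlt
  obtain ⟨ρ, hρ1, hρ2⟩ := exists_between hlt
  have hρ0 : 0 < ρ := ha₀.trans hρ1
  obtain ⟨C₀, hC₀⟩ := hgrowth (ρ - a₀) (by linarith)
  obtain ⟨K, hK0, hK⟩ := hE.exists_adaptedNorm_le hb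
  have hnx : 0 < ‖x₀‖ := norm_pos_iff.2 hx₀
  obtain ⟨C, hC0, hC⟩ := hadm.bound ‖x₀‖ (‖x₀‖ + 1) hnx (by linarith)
  obtain ⟨L, hL⟩ := ((hasDerivAt_expFlow (Matrix.toEuclideanCLM (𝕜 := ℝ) E) 0).isBigO_sub).bound
  have hL' : ∀ᶠ h : ℝ in 𝓝[>] 0, ‖flow E h - 1‖ ≤ L * ‖h‖ := by
    filter_upwards [nhdsWithin_le_nhds hL] with h hh
    simpa using hh
  -- Pulling `z` back by the time `t` with `e^{ρt} = D h` leaves a vector of norm at most `L C₀ /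
  -- D`; this `D` makes its adapted norm at most one.
  set D := max (K * (L * C₀)) 1 with hD
  have hD0 : 0 < D := lt_max_of_lt_right one_pos
  have hsmall : ∀ᶠ h : ℝ in 𝓝[>] 0, h < D⁻¹ :=
    nhdsWithin_le_nhds (gt_mem_nhds (inv_pos.2 hD0))
  have key : ∀ᶠ h : ℝ in 𝓝[>] 0, φ x₀ ≤ C * D ^ (β / ρ) * h ^ (β / ρ - 1) := by
    filter_upwards [hL', hsmall, self_mem_nhdsWithin] with h hhL hhD hh0
    have hh0' : (0 : ℝ) < h := hh0
    have hDh : D * h < 1 := by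
      calc D * h < D * D⁻¹ := by gcongr
        _ = 1 := mul_inv_cancel₀ hD0.ne'
    set t := Real.log (D * h) / ρ with ht
    have ht0 : t ≤ 0 := div_nonpos_of_nonpos_of_nonneg
      (Real.log_nonpos (by positivity) hDh.le) hρ0.le
    have hexp : Real.exp (ρ * -t) = (D * h)⁻¹ := by
      rw [ht, mul_neg, mul_div_cancel₀ _ hρ0.ne', Real.exp_neg, Real.exp_log (by positivity)]
    set z := flow E h x₀ - x₀ with hz
    have h1 : flow E (-t) z = (flow E h - 1) (flow E (-t) x₀) := by
      rw [hz, map_sub, sub_apply, ← expFlow_add_apply, add_comm, expFlow_add_apply]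
      rfl
    have h2 : ‖flow E (-t) z‖ ≤ L * h * (C₀ * (D * h)⁻¹) := by
      rw [h1]
      have h3 := hC₀ (-t) (by linarith)
      rw [add_sub_cancel, hexp] at h3
      have h4 := ((flow E h - 1).le_opNorm (flow E (-t) x₀))
      rw [Real.norm_of_nonneg hh0'.le] at hhL
      exact h4.trans (mul_le_mul hhL h3 (norm_nonneg _) ((norm_nonneg _).trans hhL))
    have h5 : radial E z ≤ Real.exp t := by
      refine radial_le_exp ((hK _).trans ?_)
      calc K * ‖flow E (-t) z‖ ≤ K * (L * h * (C₀ * (D * h)⁻¹)) := by gcongr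
        _ = (K * (L * C₀)) / D := by field_simp
        _ ≤ 1 := by rw [div_le_one hD0]; exact le_max_left _ _
    have h6 : radial E z ≤ 1 := h5.trans (Real.exp_le_one_iff.2 ht0)
    have h7 := hC z x₀ le_rfl (by linarith) h6
    have h8 : z + x₀ = flow E h x₀ := by rw [hz]; abel
    have hβ0 : 0 < β := hρ0.trans hρ2
    rw [h8, hφ.hom] at h7
    have h9 : radial E z ^ β ≤ D ^ (β / ρ) * h ^ (β / ρ) := by
      rw [← Real.mul_rpow hD0.le hh0'.le]
      refine (Real.rpow_le_rpow (radial_nonneg E z) h5 hβ0.le).trans (le_of_eq ?_)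
      rw [← Real.exp_mul, ht, Real.rpow_def_of_pos (show 0 < D * h by positivity)]
      congr 1
      field_simp
    have h10 : h * φ x₀ ≤ C * (D ^ (β / ρ) * h ^ (β / ρ)) := by
      calc h * φ x₀ ≤ Real.exp h * φ x₀ - φ x₀ := by
            nlinarith [Real.add_one_le_exp h, hφ.pos x₀ hx₀]
        _ ≤ |Real.exp h * φ x₀ - φ x₀| := le_abs_self _
        _ ≤ C * radial E z ^ β := h7
        _ ≤ _ := by gcongr
    have h11 : h ^ (β / ρ) = h ^ (β / ρ - 1) * h := by
      nth_rewrite 3 [← Real.rpow_one h]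
      rw [← Real.rpow_add hh0', sub_add_cancel]
    rw [h11] at h10
    have h12 : h * φ x₀ ≤ h * (C * D ^ (β / ρ) * h ^ (β / ρ - 1)) := by linarith
    exact le_of_mul_le_mul_left h12 hh0'
  have hexp0 : 0 < β / ρ - 1 := by
    rw [sub_pos, one_lt_div hρ0]; exact hρ2
  have hlim : Tendsto (fun h : ℝ => C * D ^ (β / ρ) * h ^ (β / ρ - 1)) (𝓝[>] 0) (𝓝 0) := by
    have h1 : Tendsto (fun h : ℝ => h ^ (β / ρ - 1)) (𝓝 0) (𝓝 0) := by
      simpa [Real.zero_rpow hexp0.ne'] using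
        (Real.continuousAt_rpow_const 0 (β / ρ - 1) (Or.inr hexp0.le)).tendsto
    simpa using (h1.mono_left nhdsWithin_le_nhds).const_mul (C * D ^ (β / ρ))
  exact absurd (ge_of_tendsto hlim key) (not_le.2 (hφ.pos x₀ hx₀))

lemma exists_rpow_sub_one_le (α : ℝ) : ∃ L : ℝ, 0 < L ∧ ∀ u : ℝ, |u - 1| ≤ 1 / 2 →
    |u ^ α - 1| ≤ L * |u - 1| := by
  have hpos : ∀ u ∈ Set.Icc (1 / 2 : ℝ) (3 / 2), u ≠ 0 := fun u hu => by linarith [hu.1]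
  obtain ⟨B, hB⟩ := (isCompact_Icc (a := (1 / 2 : ℝ)) (b := 3 / 2)).exists_bound_of_continuousOn
    (f := fun u : ℝ => α * u ^ (α - 1))
    (continuousOn_const.mul (continuousOn_id.rpow_const fun u hu => Or.inl (hpos u hu)))
  refine ⟨max B 1, by positivity, fun u hu => ?_⟩
  rw [abs_le] at hu
  have h := (convex_Icc (1 / 2 : ℝ) (3 / 2)).norm_image_sub_le_of_norm_hasDerivWithin_le
    (f := fun u : ℝ => u ^ α) (f' := fun u : ℝ => α * u ^ (α - 1)) (C := max B 1)
    (fun u hu => (Real.hasDerivAt_rpow_const (Or.inl (hpos u hu))).hasDerivWithinAt)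
    (fun u hu => (hB u hu).trans (le_max_left _ _))
    (x := 1) (y := u) (by constructor <;> norm_num) (by constructor <;> linarith [hu.1, hu.2])
  simpa using h

/-- Increments of powers of an admissible function far from the origin. -/
lemma IsAdmissible.exists_rpow_sub_le {β : ℝ} (hφ : IsGauge E φ) (hadm : IsAdmissible β E φ)
    (hE : IsContracting E b) (hb : 0 < b) (hβ : 0 < β) (α : ℝ) :
    ∃ k K : ℝ, 0 < K ∧ ∀ x y, ‖x‖ ≤ 1 → Real.exp k ≤ φ y →
      |φ (x + y) ^ α - φ y ^ α| ≤ K * φ y ^ (α - β) := by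
  obtain ⟨K₀, hK₀, hK₀'⟩ := hE.exists_adaptedNorm_le hb
  obtain ⟨B, hB0, hB⟩ := hφ.exists_norm_le hE hb 1
  obtain ⟨A, hA0, hA⟩ := hφ.exists_le_norm one_pos
  obtain ⟨C, hC0, hC⟩ := hadm.bound A (max A B + 1) hA0 (by linarith [le_max_left A B])
  obtain ⟨L, hL0, hL⟩ := exists_rpow_sub_one_le α
  obtain ⟨T, hT⟩ : ∃ T : ℝ, ∀ x, ‖x‖ ≤ 1 → adaptedNorm E (flow E (-T) x) ≤ 1 := by
    obtain ⟨c, hc, h⟩ := hE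
    have h1 : Tendsto (fun t : ℝ => K₀ * (c * Real.exp (-(b * t)))) atTop (𝓝 0) := by
      have h2 : Tendsto (fun t : ℝ => Real.exp (-(b * t))) atTop (𝓝 0) :=
        Real.tendsto_exp_neg_atTop_nhds_zero.comp (tendsto_id.const_mul_atTop hb)
      simpa using (h2.const_mul c).const_mul K₀
    obtain ⟨T, hT0, hT⟩ := ((eventually_ge_atTop (0 : ℝ)).and
      (h1.eventually_lt_const one_pos)).exists
    refine ⟨T, fun x hx => (hK₀' _).trans ?_⟩
    calc K₀ * ‖flow E (-T) x‖ ≤ K₀ * (c * Real.exp (-(b * T)) * ‖x‖) := by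
          gcongr; exact h T hT0 x
      _ ≤ K₀ * (c * Real.exp (-(b * T)) * 1) := by gcongr
      _ ≤ 1 := by rw [mul_one]; exact hT.le
  -- Beyond level `k` the relative change of `φ` is at most one half, so the Lipschitz bound for the
  -- power near one applies.
  obtain ⟨k, hk1, hk2⟩ : ∃ k : ℝ, T ≤ k ∧ C * Real.exp (β * (T - k)) ≤ 1 / 2 := by
    have h1 : Tendsto (fun k : ℝ => C * Real.exp (β * (T - k))) atTop (𝓝 0) := by
      have h2 : Tendsto (fun k : ℝ => β * (T - k)) atTop atBot :=
        (tendsto_atBot_add_const_left atTop T tendsto_neg_atTop_atBot).const_mul_atBot hβ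
      simpa using (Real.tendsto_exp_atBot.comp h2).const_mul C
    obtain ⟨k, hk, hk'⟩ := ((eventually_ge_atTop T).and
      (h1.eventually_lt_const (by norm_num : (0 : ℝ) < 1 / 2))).exists
    exact ⟨k, hk, hk'.le⟩
  refine ⟨k, L * (C * Real.exp (β * T)), by positivity, fun x y hx hy => ?_⟩
  have hy0 : 0 < φ y := (Real.exp_pos k).trans_le hy
  -- Rescaling by `-s` moves `y` to the level set `φ = 1`, which is bounded and away from the
  -- origin, and reduces the radial part of the increment to at most `e^{T-s}`.
  set s := Real.log (φ y) with hs
  have hsy : Real.exp s = φ y := Real.exp_log hy0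
  have hks : k ≤ s := (Real.le_log_iff_exp_le hy0).2 hy
  set θ := flow E (-s) y with hθ
  set z := flow E (-s) x with hz
  have hφθ : φ θ = 1 := by rw [hθ, hφ.hom, Real.exp_neg, hsy, inv_mul_cancel₀ hy0.ne']
  have hrad : radial E z ≤ Real.exp (T - s) := by
    refine radial_le_exp ?_
    rw [hz, ← expFlow_add_apply, show -(T - s) + -s = -T by ring]
    exact hT x hx
  have hrad1 : radial E z ≤ 1 := hrad.trans (Real.exp_le_one_iff.2 (by linarith))
  have h1 := hC z θ (hA θ hφθ.ge)
    ((hB θ hφθ.le).trans (by linarith [le_max_right A B])) hrad1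
  rw [hφθ] at h1
  have h2 : |φ (z + θ) - 1| ≤ C * Real.exp (β * (T - s)) := by
    refine h1.trans ?_
    gcongr
    refine (Real.rpow_le_rpow (radial_nonneg E z) hrad hβ.le).trans (le_of_eq ?_)
    rw [← Real.exp_mul, mul_comm]
  have h3 : |φ (z + θ) - 1| ≤ 1 / 2 := by
    refine h2.trans (le_trans ?_ hk2)
    gcongr
  have h4 : φ (x + y) = φ y * φ (z + θ) := by
    rw [hz, hθ, ← map_add, hφ.hom, Real.exp_neg, hsy, mul_inv_cancel_left₀ hy0.ne']
  rw [h4, Real.mul_rpow hy0.le (hφ.nonneg _)]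
  have h5 : φ y ^ α * φ (z + θ) ^ α - φ y ^ α = φ y ^ α * (φ (z + θ) ^ α - 1) := by ring
  rw [h5, abs_mul, abs_of_pos (Real.rpow_pos_of_pos hy0 α)]
  have h6 : φ y ^ (α - β) = φ y ^ α * Real.exp (-(β * s)) := by
    rw [Real.rpow_sub hy0, div_eq_mul_inv, ← Real.rpow_neg hy0.le, Real.rpow_def_of_pos hy0 (-β)]
    congr 2
    ring
  calc φ y ^ α * |φ (z + θ) ^ α - 1| ≤ φ y ^ α * (L * (C * Real.exp (β * (T - s)))) := by
        gcongr
        exact (hL _ h3).trans (by gcongr)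
    _ = _ := by
        rw [h6, show β * (T - s) = β * T + -(β * s) by ring, Real.exp_add]
        ring

end Radial

/-! ### Variance functionals -/

section Variance

/-- Fatou's lemma gives a positive lower bound for `x ↦ ∫ ‖f x‖²` on compact sets. -/
lemma exists_pos_le_lintegral_enorm_sq {X S 𝕜 : Type*} [PseudoMetricSpace X] [MeasurableSpace S]
    [NormedAddCommGroup 𝕜] [MeasurableSpace 𝕜] [BorelSpace 𝕜] (μ : Measure S) (f : X → S → 𝕜)
    (hf : ∀ x, Measurable (f x)) (hcont : ∀ x, ∀ᵐ y ∂μ, ContinuousAt (fun x' => f x' y) x)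
    {K : Set X} (hK : IsCompact K) (hpos : ∀ x ∈ K, ∫⁻ y, ‖f x y‖ₑ ^ 2 ∂μ ≠ 0) :
    ∃ m : ℝ, 0 < m ∧ ∀ x ∈ K, ENNReal.ofReal m ≤ ∫⁻ y, ‖f x y‖ₑ ^ 2 ∂μ := by
  by_contra! hcon
  choose x hxK hx using fun n : ℕ => hcon (1 / ((n : ℝ) + 1)) (by positivity)
  obtain ⟨x₀, hx₀, k, hk, hlim⟩ := hK.tendsto_subseq hxK
  refine hpos x₀ hx₀ (le_antisymm ?_ bot_le)
  calc ∫⁻ y, ‖f x₀ y‖ₑ ^ 2 ∂μ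
      = ∫⁻ y, liminf (fun n => ‖f (x (k n)) y‖ₑ ^ 2) atTop ∂μ := by
        refine lintegral_congr_ae ?_
        filter_upwards [hcont x₀] with y hy
        refine (Tendsto.liminf_eq ?_).symm
        have h1 : Tendsto (fun n => f (x (k n)) y) atTop (𝓝 (f x₀ y)) := hy.tendsto.comp hlim
        exact ((ENNReal.continuous_pow 2).tendsto _).comp h1.enorm
    _ ≤ liminf (fun n => ∫⁻ y, ‖f (x (k n)) y‖ₑ ^ 2 ∂μ) atTop :=
        lintegral_liminf_le fun n => (hf _).enorm.pow_const 2
    _ ≤ liminf (fun n => ENNReal.ofReal (1 / ((k n : ℝ) + 1))) atTop :=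
        liminf_le_liminf (Eventually.of_forall fun n => (hx (k n)).le)
    _ = 0 := by
        refine Tendsto.liminf_eq ?_
        have h1 : Tendsto (fun n => 1 / ((k n : ℝ) + 1)) atTop (𝓝 0) :=
          tendsto_one_div_add_atTop_nhds_zero_nat.comp hk.tendsto_atTop
        simpa using ENNReal.tendsto_ofReal h1

variable {d : ℕ}

/-- The properties of the variance function of an operator scaling field with exponent `H`. -/
structure IsScalingVariance (E : Matrix (Fin d) (Fin d) ℝ) (H : ℝ)
    (V : EuclideanSpace ℝ (Fin d) → ℝ≥0∞) : Prop where
  hom : ∀ t x, V (flow E t x) = ENNReal.ofReal (Real.exp (2 * H * t)) * V x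
  bounded : ∃ B : ℝ≥0, ∀ x, ‖x‖ ≤ 1 → V x ≤ B
  lower : ∃ m : ℝ, 0 < m ∧ ∀ x, ‖x‖ = 1 → ENNReal.ofReal m ≤ V x

end Variance

/-! ### The variance of the moving average -/

section MovingAverage

variable {d : ℕ} {E : Matrix (Fin d) (Fin d) ℝ} {b : ℝ} {φ : EuclideanSpace ℝ (Fin d) → ℝ}
  (μ : Measure (EuclideanSpace ℝ (Fin d))) [μ.IsAddHaarMeasure]

lemma enorm_sq_eq_ofReal (r : ℝ) : ‖r‖ₑ ^ 2 = ENNReal.ofReal (r ^ 2) := by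
  rw [Real.enorm_eq_ofReal_abs, ← ENNReal.ofReal_pow (abs_nonneg r), sq_abs]

lemma measurable_maKernel (hφ : IsGauge E φ) (α : ℝ) (x : EuclideanSpace ℝ (Fin d)) :
    Measurable fun y => φ (x - y) ^ α - φ (-y) ^ α :=
  ((hφ.continuous.comp (continuous_const.sub continuous_id)).measurable.pow_const α).sub
    ((hφ.continuous.comp continuous_neg).measurable.pow_const α)

lemma lintegral_maKernel_sub (φ : EuclideanSpace ℝ (Fin d) → ℝ) (α : ℝ)
    (x x' : EuclideanSpace ℝ (Fin d)) :
    ∫⁻ y, ‖(φ (x - y) ^ α - φ (-y) ^ α) - (φ (x' - y) ^ α - φ (-y) ^ α)‖ₑ ^ 2 ∂μ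
      = ∫⁻ y, ‖φ (x - x' - y) ^ α - φ (-y) ^ α‖ₑ ^ 2 ∂μ := by
  rw [← lintegral_add_left_eq_self _ x']
  refine lintegral_congr fun y => ?_
  rw [sub_sub_sub_cancel_right, show x - (x' + y) = x - x' - y by abel,
    show x' - (x' + y) = -y by abel]

/-- Where `φ y` is large, the increment is at most `K φ^{α-β}`, whose square is integrable at
infinity because `2(α - β) + trace E = 2(H - β) < 0`. Elsewhere both arguments have gauge below `M`,
and the two terms are bounded separately by `φ^{2α}`, integrable at the origin because `2α + trace E
= 2H > 0`. -/
lemma lintegral_maKernel_le (hφ : IsGauge E φ) {β H : ℝ} (hadm : IsAdmissible β E φ)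
    (hE : IsContracting E b) (hb : 0 < b) (hH : 0 < H) (hHβ : H < β) :
    ∃ B : ℝ≥0, ∀ x, ‖x‖ ≤ 1 →
      ∫⁻ y, ‖φ (x - y) ^ (H - E.trace / 2) - φ (-y) ^ (H - E.trace / 2)‖ₑ ^ 2 ∂μ ≤ B := by
  set α := H - E.trace / 2 with hα
  obtain ⟨k, K, hK0, hK⟩ := hadm.exists_rpow_sub_le hφ hE hb (hH.trans hHβ) α
  obtain ⟨R, hR0, hR⟩ := hφ.exists_norm_le hE hb (Real.exp k)
  obtain ⟨M, hM0, hM⟩ := hφ.exists_le_of_norm_le (R + 1)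
  set g₁ : EuclideanSpace ℝ (Fin d) → ℝ≥0∞ :=
    {y | φ y < M}.indicator fun y => ENNReal.ofReal (φ y ^ (2 * α)) with hg₁
  set g₂ : EuclideanSpace ℝ (Fin d) → ℝ≥0∞ :=
    {y | Real.exp k ≤ φ y}.indicator fun y => ENNReal.ofReal (φ y ^ (2 * (α - β))) with hg₂
  have hmφ := hφ.continuous.measurable
  have hs₁ : MeasurableSet {y | φ y < M} := measurableSet_lt hmφ measurable_const
  have hs₂ : MeasurableSet {y | Real.exp k ≤ φ y} := measurableSet_le measurable_const hmφ
  have hm₁ : Measurable g₁ := (hmφ.pow_const _).ennreal_ofReal.indicator hs₁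
  have hm₂ : Measurable g₂ := (hmφ.pow_const _).ennreal_ofReal.indicator hs₂
  have hI₁ : ∫⁻ y, g₁ y ∂μ < ∞ := by
    rw [lintegral_indicator hs₁]
    exact IsGauge.setLIntegral_lt_lt_top μ hφ hE hb (by rw [hα]; linarith) M
  have hI₂ : ∫⁻ y, g₂ y ∂μ < ∞ := by
    rw [lintegral_indicator hs₂]
    exact IsGauge.setLIntegral_ge_lt_top μ hφ hE hb (by rw [hα]; linarith) k
  have hpow : ∀ (r : ℝ) (y : EuclideanSpace ℝ (Fin d)), (φ y ^ r) ^ 2 = φ y ^ (2 * r) := by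
    intro r y
    rw [mul_comm, Real.rpow_mul (hφ.nonneg y)]
    exact (Real.rpow_natCast _ 2).symm
  have hfin : 2 * (∫⁻ y, g₁ y ∂μ) + 2 * (∫⁻ y, g₁ y ∂μ)
      + ENNReal.ofReal (K ^ 2) * ∫⁻ y, g₂ y ∂μ < ∞ :=
    ENNReal.add_lt_top.2 ⟨ENNReal.add_lt_top.2 ⟨ENNReal.mul_lt_top ENNReal.ofNat_lt_top hI₁,
      ENNReal.mul_lt_top ENNReal.ofNat_lt_top hI₁⟩, ENNReal.mul_lt_top ENNReal.ofReal_lt_top hI₂⟩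
  refine ⟨(2 * (∫⁻ y, g₁ y ∂μ) + 2 * (∫⁻ y, g₁ y ∂μ)
    + ENNReal.ofReal (K ^ 2) * ∫⁻ y, g₂ y ∂μ).toNNReal, fun x hx => ?_⟩
  rw [ENNReal.coe_toNNReal hfin.ne]
  have h1 : ∫⁻ y, ‖φ (x - y) ^ α - φ (-y) ^ α‖ₑ ^ 2 ∂μ
      = ∫⁻ y, ‖φ (x + y) ^ α - φ y ^ α‖ₑ ^ 2 ∂μ := by
    rw [← lintegral_neg_eq_self]
    simp
  rw [h1]
  have h2 : ∀ y, ‖φ (x + y) ^ α - φ y ^ α‖ₑ ^ 2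
      ≤ 2 * g₁ (x + y) + 2 * g₁ y + ENNReal.ofReal (K ^ 2) * g₂ y := by
    intro y
    rw [enorm_sq_eq_ofReal]
    by_cases hy : Real.exp k ≤ φ y
    · refine le_trans ?_ le_add_self
      rw [hg₂, Set.indicator_of_mem (show y ∈ {y | Real.exp k ≤ φ y} from hy),
        ← ENNReal.ofReal_mul (by positivity)]
      refine ENNReal.ofReal_le_ofReal ?_
      rw [← hpow, ← mul_pow, ← sq_abs]
      gcongr
      exact hK x y hx hy
    · push Not at hy
      refine le_trans ?_ le_self_add
      have h2e : ∀ r : ℝ, (2 : ℝ≥0∞) * ENNReal.ofReal r = ENNReal.ofReal (2 * r) := fun r => by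
        rw [ENNReal.ofReal_mul zero_le_two, ENNReal.ofReal_ofNat]
      have hyR := hR y hy.le
      have hy1 : φ y < M := hM y (by linarith)
      have hy2 : φ (x + y) < M := hM _ ((norm_add_le _ _).trans (by linarith))
      rw [hg₁, Set.indicator_of_mem (show y ∈ {y | φ y < M} from hy1),
        Set.indicator_of_mem (show x + y ∈ {y | φ y < M} from hy2), h2e, h2e,
        ← ENNReal.ofReal_add (mul_nonneg zero_le_two (Real.rpow_nonneg (hφ.nonneg _) _))
          (mul_nonneg zero_le_two (Real.rpow_nonneg (hφ.nonneg _) _))]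
      refine ENNReal.ofReal_le_ofReal ?_
      rw [← hpow, ← hpow]
      nlinarith [sq_nonneg (φ (x + y) ^ α + φ y ^ α)]
  refine (lintegral_mono h2).trans (le_of_eq ?_)
  have hm₃ : Measurable fun y => g₁ (x + y) := hm₁.comp (measurable_const_add x)
  rw [lintegral_add_right _ (hm₂.const_mul _), lintegral_add_right _ (hm₁.const_mul _),
    lintegral_const_mul _ hm₃, lintegral_const_mul _ hm₁, lintegral_const_mul _ hm₂,
    lintegral_add_left_eq_self]

/-- Homogeneity follows by substituting `exp(tE) y` for `y`. If the integral vanished at some `x ≠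
0`, the nonzero exponent could be removed, so `φ (x - y) = φ (-y)` almost everywhere and then
everywhere by continuity; `y = 0` would give `φ x = 0`. -/
lemma isScalingVariance_maKernel (hd : 0 < d) (hφ : IsGauge E φ) {β H : ℝ}
    (hadm : IsAdmissible β E φ) (hE : IsContracting E b) (hb : 0 < b) (hH : 0 < H) (hHβ : H < β)
    (hHq : H ≠ E.trace / 2) :
    IsScalingVariance E H fun x =>
      ∫⁻ y, ‖φ (x - y) ^ (H - E.trace / 2) - φ (-y) ^ (H - E.trace / 2)‖ₑ ^ 2 ∂μ := by
  have hne : Nonempty (Fin d) := ⟨⟨0, hd⟩⟩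
  have : Nontrivial (EuclideanSpace ℝ (Fin d)) := inferInstance
  have hα0 : H - E.trace / 2 ≠ 0 := sub_ne_zero.2 hHq
  refine ⟨fun t x => ?_, lintegral_maKernel_le μ hφ hadm hE hb hH hHβ, ?_⟩
  · set α := H - E.trace / 2 with hα
    have h1 := lintegral_comp_flow μ E t
      ((measurable_maKernel hφ α (flow E t x)).enorm.pow_const 2)
    have h2 : ∀ y, ‖φ (flow E t x - flow E t y) ^ α - φ (-flow E t y) ^ α‖ₑ ^ 2
        = ENNReal.ofReal (Real.exp (t * (2 * α))) * ‖φ (x - y) ^ α - φ (-y) ^ α‖ₑ ^ 2 := by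
      intro y
      rw [← map_sub, ← map_neg, hφ.hom, hφ.hom, Real.mul_rpow (Real.exp_pos t).le (hφ.nonneg _),
        Real.mul_rpow (Real.exp_pos t).le (hφ.nonneg _), ← mul_sub, enorm_mul, mul_pow,
        enorm_sq_eq_ofReal, ← Real.exp_mul, ← Real.exp_nat_mul]
      congr 3
      push_cast
      ring
    simp_rw [h2] at h1
    rw [lintegral_const_mul _ ((measurable_maKernel hφ α x).enorm.pow_const 2)] at h1
    have h3 := congrArg (fun z => ENNReal.ofReal (Real.exp (t * E.trace)) * z) h1
    simp only [← mul_assoc, ← ENNReal.ofReal_mul (Real.exp_pos _).le, ← Real.exp_add] at h3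
    rw [add_neg_cancel, Real.exp_zero, ENNReal.ofReal_one, one_mul] at h3
    rw [← h3]
    rw [hα]
    ring_nf
  · refine (exists_pos_le_lintegral_enorm_sq μ
      (fun x y => φ (x - y) ^ (H - E.trace / 2) - φ (-y) ^ (H - E.trace / 2))
      (measurable_maKernel hφ _) (fun x => ?_)
      (isCompact_sphere (0 : EuclideanSpace ℝ (Fin d)) 1) (fun x hx h0 => ?_)).imp
        fun m h => ⟨h.1, fun x hx => h.2 x (by simpa using hx)⟩
    · have hx : ∀ᵐ y ∂μ, y ≠ x := by
        rw [ae_iff]; simp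
      filter_upwards [hx] with y hy
      refine ContinuousAt.sub ?_ continuousAt_const
      refine ContinuousAt.rpow_const ?_ (Or.inl (hφ.pos _ (sub_ne_zero.2 hy.symm)).ne')
      exact (hφ.continuous.comp (continuous_id.sub continuous_const)).continuousAt
    · rw [lintegral_eq_zero_iff ((measurable_maKernel hφ _ x).enorm.pow_const 2)] at h0
      have h1 : (fun y => φ (x - y)) =ᵐ[μ] fun y => φ (-y) := by
        filter_upwards [h0] with y hy
        have h2 : φ (x - y) ^ (H - E.trace / 2) = φ (-y) ^ (H - E.trace / 2) := by
          simpa [sub_eq_zero] using hy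
        have h3 := congrArg (fun z => z ^ (H - E.trace / 2)⁻¹) h2
        simpa only [Real.rpow_rpow_inv (hφ.nonneg _) hα0] using h3
      have h2 : (fun y => φ (x - y)) = fun y => φ (-y) :=
        Measure.eq_of_ae_eq h1 (hφ.continuous.comp (continuous_const.sub continuous_id))
          (hφ.continuous.comp continuous_neg)
      have h3 := congrFun h2 0
      simp only [sub_zero, neg_zero, hφ.zero] at h3
      have hx0 : x ≠ 0 := by rintro rfl; simp at hx
      exact (hφ.pos x hx0).ne' h3

end MovingAverage

/-! ### The variance of the harmonizable field -/

section Harmonizable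

variable {d : ℕ} {E : Matrix (Fin d) (Fin d) ℝ} {b : ℝ} {ψ : EuclideanSpace ℝ (Fin d) → ℝ}
  (μ : Measure (EuclideanSpace ℝ (Fin d)))

lemma IsContracting.transpose (hE : IsContracting E b) : IsContracting E.transpose b := by
  obtain ⟨C, hC, h⟩ := hE
  refine ⟨C, hC, fun t ht x => ?_⟩
  refine ((flow E.transpose (-t)).le_opNorm x).trans ?_
  rw [norm_flow_transpose]
  gcongr
  exact ContinuousLinearMap.opNorm_le_bound _ (by positivity) (h t ht)

lemma measurable_harmKernel (hψ : IsGauge E.transpose ψ) (s : ℝ) (x : EuclideanSpace ℝ (Fin d)) :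
    Measurable fun ξ : EuclideanSpace ℝ (Fin d) =>
      (Complex.exp (Complex.I * (inner ℝ x ξ : ℝ)) - 1) * ((ψ ξ ^ s : ℝ) : ℂ) := by
  have h1 : Continuous fun ξ : EuclideanSpace ℝ (Fin d) =>
      Complex.exp (Complex.I * (inner ℝ x ξ : ℝ)) - 1 := by fun_prop
  exact h1.measurable.mul (Complex.measurable_ofReal.comp (hψ.continuous.measurable.pow_const s))

lemma lintegral_harmKernel_sub (s : ℝ) (x x' : EuclideanSpace ℝ (Fin d)) :
    ∫⁻ ξ, ‖(Complex.exp (Complex.I * (inner ℝ x ξ : ℝ)) - 1) * ((ψ ξ ^ s : ℝ) : ℂ)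
        - (Complex.exp (Complex.I * (inner ℝ x' ξ : ℝ)) - 1) * ((ψ ξ ^ s : ℝ) : ℂ)‖ₑ ^ 2 ∂μ
      = ∫⁻ ξ, ‖(Complex.exp (Complex.I * (inner ℝ (x - x') ξ : ℝ)) - 1) *
          ((ψ ξ ^ s : ℝ) : ℂ)‖ₑ ^ 2 ∂μ := by
  refine lintegral_congr fun ξ => ?_
  rw [← sub_mul, sub_sub_sub_cancel_right, enorm_mul, enorm_mul]
  congr 2
  have h1 : Complex.exp (Complex.I * (inner ℝ x ξ : ℝ)) -
        Complex.exp (Complex.I * (inner ℝ x' ξ : ℝ))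
      = Complex.exp (Complex.I * (inner ℝ x' ξ : ℝ)) *
        (Complex.exp (Complex.I * (inner ℝ (x - x') ξ : ℝ)) - 1) := by
    rw [mul_sub, mul_one, ← Complex.exp_add, inner_sub_left]
    congr 2
    push_cast
    ring
  rw [h1, enorm_mul]
  have h2 : ‖Complex.exp (Complex.I * (inner ℝ x' ξ : ℝ))‖ₑ = 1 := by
    rw [← ofReal_norm, Complex.norm_exp_I_mul_ofReal, ENNReal.ofReal_one]
  rw [h2, one_mul]

variable [μ.IsAddHaarMeasure]

/-- Near the origin `|e^{i⟨x,ξ⟩} - 1| ≤ ‖ξ‖ ≤ C ψ^b`, where the second bound comes from flowing `ξ`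
out to `ψ = 1`; integrability there is `2(s + b) + trace E = 2(b - H) > 0`. Far away the factor is
at most two and `2s + trace E = -2H < 0`. -/
lemma lintegral_harmKernel_le (hψ : IsGauge E.transpose ψ) {H : ℝ}
    (hE : IsContracting E b) (hb : 0 < b) (hH : 0 < H) (hHb : H < b) :
    ∃ B : ℝ≥0, ∀ x, ‖x‖ ≤ 1 →
      ∫⁻ ξ, ‖(Complex.exp (Complex.I * (inner ℝ x ξ : ℝ)) - 1) *
        ((ψ ξ ^ (-H - E.trace / 2) : ℝ) : ℂ)‖ₑ ^ 2 ∂μ ≤ B := by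
  set s := -H - E.trace / 2 with hs
  have hEt := hE.transpose
  obtain ⟨R, hR0, hR⟩ := hψ.exists_norm_le hEt hb 1
  obtain ⟨C, hC0, hC⟩ : ∃ C : ℝ, 0 < C ∧ ∀ ξ, ξ ≠ 0 → ψ ξ ≤ 1 → ‖ξ‖ ≤ C * ψ ξ ^ b := by
    obtain ⟨C, hC, h⟩ := hEt
    refine ⟨C * R, by positivity, fun ξ hξ0 hξ => ?_⟩
    have hpos := hψ.pos ξ hξ0
    have h1 := h (-Real.log (ψ ξ)) (by linarith [Real.log_nonpos hpos.le hξ])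
      (flow E.transpose (-Real.log (ψ ξ)) ξ)
    rw [expFlow_neg_apply_expFlow] at h1
    have h2 : ‖flow E.transpose (-Real.log (ψ ξ)) ξ‖ ≤ R := by
      refine hR _ ?_
      rw [hψ.hom, Real.exp_neg, Real.exp_log hpos, inv_mul_cancel₀ hpos.ne']
    calc ‖ξ‖ ≤ C * Real.exp (-(b * -Real.log (ψ ξ))) * ‖flow E.transpose (-Real.log (ψ ξ)) ξ‖ := h1
      _ ≤ C * Real.exp (-(b * -Real.log (ψ ξ))) * R := by gcongr
      _ = C * R * ψ ξ ^ b := by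
        rw [Real.rpow_def_of_pos hpos, show -(b * -Real.log (ψ ξ)) = Real.log (ψ ξ) * b by ring]
        ring
  set g₁ : EuclideanSpace ℝ (Fin d) → ℝ≥0∞ :=
    {y | ψ y < 1}.indicator fun y => ENNReal.ofReal (ψ y ^ (2 * (s + b))) with hg₁
  set g₂ : EuclideanSpace ℝ (Fin d) → ℝ≥0∞ :=
    {y | Real.exp 0 ≤ ψ y}.indicator fun y => ENNReal.ofReal (ψ y ^ (2 * s)) with hg₂
  have hmψ := hψ.continuous.measurable
  have hs₁ : MeasurableSet {y | ψ y < 1} := measurableSet_lt hmψ measurable_const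
  have hs₂ : MeasurableSet {y | Real.exp 0 ≤ ψ y} := measurableSet_le measurable_const hmψ
  have hm₁ : Measurable g₁ := (hmψ.pow_const _).ennreal_ofReal.indicator hs₁
  have hm₂ : Measurable g₂ := (hmψ.pow_const _).ennreal_ofReal.indicator hs₂
  have htr : E.transpose.trace = E.trace := Matrix.trace_transpose E
  have hI₁ : ∫⁻ y, g₁ y ∂μ < ∞ := by
    rw [lintegral_indicator hs₁]
    exact IsGauge.setLIntegral_lt_lt_top μ hψ hEt hb (by rw [htr, hs]; linarith) 1
  have hI₂ : ∫⁻ y, g₂ y ∂μ < ∞ := by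
    rw [lintegral_indicator hs₂]
    exact IsGauge.setLIntegral_ge_lt_top μ hψ hEt hb (by rw [htr, hs]; linarith) 0
  have hpow : ∀ (r : ℝ) (y : EuclideanSpace ℝ (Fin d)), (ψ y ^ r) ^ 2 = ψ y ^ (2 * r) := by
    intro r y
    rw [mul_comm, Real.rpow_mul (hψ.nonneg y)]
    exact (Real.rpow_natCast _ 2).symm
  have hfin : ENNReal.ofReal (C ^ 2) * (∫⁻ y, g₁ y ∂μ) + 4 * (∫⁻ y, g₂ y ∂μ) < ∞ :=
    ENNReal.add_lt_top.2 ⟨ENNReal.mul_lt_top ENNReal.ofReal_lt_top hI₁,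
      ENNReal.mul_lt_top ENNReal.ofNat_lt_top hI₂⟩
  refine ⟨(ENNReal.ofReal (C ^ 2) * (∫⁻ y, g₁ y ∂μ) + 4 * (∫⁻ y, g₂ y ∂μ)).toNNReal,
    fun x hx => ?_⟩
  rw [ENNReal.coe_toNNReal hfin.ne]
  have h2 : ∀ ξ : EuclideanSpace ℝ (Fin d), ‖(Complex.exp (Complex.I * (inner ℝ x ξ : ℝ)) - 1) *
      ((ψ ξ ^ s : ℝ) : ℂ)‖ₑ ^ 2 ≤ ENNReal.ofReal (C ^ 2) * g₁ ξ + 4 * g₂ ξ := by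
    intro ξ
    rw [← ofReal_norm, ← ENNReal.ofReal_pow (norm_nonneg _), norm_mul, Complex.norm_real,
      Real.norm_of_nonneg (Real.rpow_nonneg (hψ.nonneg _) _), mul_pow]
    by_cases hξ : Real.exp 0 ≤ ψ ξ
    · refine le_trans ?_ le_add_self
      rw [hg₂, Set.indicator_of_mem (show ξ ∈ {y | Real.exp 0 ≤ ψ y} from hξ),
        show (4 : ℝ≥0∞) = ENNReal.ofReal 4 by rw [ENNReal.ofReal_ofNat],
        ← ENNReal.ofReal_mul (by positivity)]
      refine ENNReal.ofReal_le_ofReal ?_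
      rw [hpow]
      refine mul_le_mul_of_nonneg_right ?_ (Real.rpow_nonneg (hψ.nonneg _) _)
      have h3 : ‖Complex.exp (Complex.I * (inner ℝ x ξ : ℝ)) - 1‖ ≤ 2 := by
        refine (norm_sub_le _ _).trans ?_
        rw [Complex.norm_exp_I_mul_ofReal, norm_one]
        norm_num
      nlinarith [norm_nonneg (Complex.exp (Complex.I * (inner ℝ x ξ : ℝ)) - 1)]
    · rw [Real.exp_zero, not_le] at hξ
      refine le_trans ?_ le_self_add
      rw [hg₁, Set.indicator_of_mem (show ξ ∈ {y | ψ y < 1} from hξ),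
        ← ENNReal.ofReal_mul (by positivity)]
      refine ENNReal.ofReal_le_ofReal ?_
      by_cases hξ0 : ξ = 0
      · rw [hξ0, inner_zero_right]
        simp only [Complex.ofReal_zero, mul_zero, Complex.exp_zero, sub_self, norm_zero]
        rw [zero_pow two_ne_zero, zero_mul]
        have := Real.rpow_nonneg (hψ.nonneg 0) (2 * (s + b))
        positivity
      have hpos := hψ.pos ξ hξ0
      have h3 : ‖Complex.exp (Complex.I * (inner ℝ x ξ : ℝ)) - 1‖ ≤ C * ψ ξ ^ b := by
        refine (Real.norm_exp_I_mul_ofReal_sub_one_le).trans ?_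
        refine (norm_inner_le_norm x ξ).trans ?_
        calc ‖x‖ * ‖ξ‖ ≤ 1 * ‖ξ‖ := by gcongr
          _ ≤ _ := by rw [one_mul]; exact hC ξ hξ0 hξ.le
      rw [← hpow, Real.rpow_add hpos]
      calc _ ≤ (C * ψ ξ ^ b) ^ 2 * (ψ ξ ^ s) ^ 2 := by gcongr
        _ = _ := by ring
  refine (lintegral_mono h2).trans (le_of_eq ?_)
  rw [lintegral_add_right _ (hm₂.const_mul _), lintegral_const_mul _ hm₁, lintegral_const_mul _ hm₂]

lemma isScalingVariance_harmKernel (hd : 0 < d) (hψ : IsGauge E.transpose ψ) {H : ℝ}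
    (hE : IsContracting E b) (hb : 0 < b) (hH : 0 < H) (hHb : H < b) :
    IsScalingVariance E H fun x =>
      ∫⁻ ξ, ‖(Complex.exp (Complex.I * (inner ℝ x ξ : ℝ)) - 1) *
        ((ψ ξ ^ (-H - E.trace / 2) : ℝ) : ℂ)‖ₑ ^ 2 ∂μ := by
  have hne : Nonempty (Fin d) := ⟨⟨0, hd⟩⟩
  have : Nontrivial (EuclideanSpace ℝ (Fin d)) := inferInstance
  have htr : E.transpose.trace = E.trace := Matrix.trace_transpose E
  refine ⟨fun t x => ?_, lintegral_harmKernel_le μ hψ hE hb hH hHb, ?_⟩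
  · set s := -H - E.trace / 2 with hs
    -- The transposed flow run backwards in `ξ` cancels the flow of `x` inside the inner product.
    have h1 := lintegral_comp_flow μ E.transpose (-t)
      ((measurable_harmKernel hψ s (flow E t x)).enorm.pow_const 2)
    have h2 : ∀ ξ : EuclideanSpace ℝ (Fin d),
        ‖(Complex.exp (Complex.I * (inner ℝ (flow E t x) (flow E.transpose (-t) ξ) : ℝ)) - 1) *
          ((ψ (flow E.transpose (-t) ξ) ^ s : ℝ) : ℂ)‖ₑ ^ 2
        = ENNReal.ofReal (Real.exp (-t * (2 * s))) *
          ‖(Complex.exp (Complex.I * (inner ℝ x ξ : ℝ)) - 1) * ((ψ ξ ^ s : ℝ) : ℂ)‖ₑ ^ 2 := by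
      intro ξ
      rw [inner_flow, expFlow_apply_expFlow_neg, hψ.hom,
        Real.mul_rpow (Real.exp_pos _).le (hψ.nonneg _), Complex.ofReal_mul, mul_left_comm,
        enorm_mul, mul_pow, ← Real.exp_mul]
      congr 1
      rw [← ofReal_norm, Complex.norm_real, Real.norm_of_nonneg (Real.exp_pos _).le,
        ← ENNReal.ofReal_pow (Real.exp_pos _).le, ← Real.exp_nat_mul]
      congr 2
      push_cast
      ring
    simp_rw [h2] at h1
    rw [lintegral_const_mul _ ((measurable_harmKernel hψ s x).enorm.pow_const 2), htr] at h1
    have h3 := congrArg (fun z => ENNReal.ofReal (Real.exp (-t * E.trace)) * z) h1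
    simp only [← mul_assoc, ← ENNReal.ofReal_mul (Real.exp_pos _).le, ← Real.exp_add] at h3
    rw [add_neg_cancel, Real.exp_zero, ENNReal.ofReal_one, one_mul] at h3
    rw [← h3]
    rw [hs]
    ring_nf
  · refine (exists_pos_le_lintegral_enorm_sq μ
      (fun x ξ : EuclideanSpace ℝ (Fin d) => (Complex.exp (Complex.I * (inner ℝ x ξ : ℝ)) - 1) *
        ((ψ ξ ^ (-H - E.trace / 2) : ℝ) : ℂ))
      (measurable_harmKernel hψ _) (fun x => ae_of_all _ fun ξ => ?_)
      (isCompact_sphere (0 : EuclideanSpace ℝ (Fin d)) 1) (fun x hx h0 => ?_)).imp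
        fun m h => ⟨h.1, fun x hx => h.2 x (by simpa using hx)⟩
    · have h1 : Continuous fun x : EuclideanSpace ℝ (Fin d) =>
          (Complex.exp (Complex.I * (inner ℝ x ξ : ℝ)) - 1) *
            ((ψ ξ ^ (-H - E.trace / 2) : ℝ) : ℂ) := by fun_prop
      exact h1.continuousAt
    · rw [lintegral_eq_zero_iff ((measurable_harmKernel hψ _ x).enorm.pow_const 2)] at h0
      have hx0 : x ≠ 0 := by rintro rfl; simp at hx
      have hne : ∀ᵐ ξ ∂μ, ξ ≠ 0 := by
        rw [ae_iff]; simp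
      have h1 : (fun ξ : EuclideanSpace ℝ (Fin d) =>
          Complex.exp (Complex.I * (inner ℝ x ξ : ℝ))) =ᵐ[μ] fun _ => 1 := by
        filter_upwards [h0, hne] with ξ hξ hξ0
        have h2 := hψ.pos ξ hξ0
        have h3 : ((ψ ξ ^ (-H - E.trace / 2) : ℝ) : ℂ) ≠ 0 := by
          exact_mod_cast (Real.rpow_pos_of_pos h2 _).ne'
        have h4 : (Complex.exp (Complex.I * (inner ℝ x ξ : ℝ)) - 1) *
            ((ψ ξ ^ (-H - E.trace / 2) : ℝ) : ℂ) = 0 := by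
          simpa only [Pi.zero_apply, pow_eq_zero_iff two_ne_zero, enorm_eq_zero] using hξ
        exact sub_eq_zero.1 ((mul_eq_zero.1 h4).resolve_right h3)
      have h2 : (fun ξ : EuclideanSpace ℝ (Fin d) =>
          Complex.exp (Complex.I * (inner ℝ x ξ : ℝ))) = fun _ => 1 :=
        Measure.eq_of_ae_eq h1 (by fun_prop) continuous_const
      -- At this frequency the phase is `π`, so the exponential is `-1` and not `1`.
      have h3 := congrFun h2 ((Real.pi / ‖x‖ ^ 2) • x)
      have hxn : ‖x‖ ^ 2 ≠ 0 := by simpa using hx0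
      simp only [inner_smul_right, real_inner_self_eq_norm_sq] at h3
      rw [div_mul_cancel₀ _ hxn, mul_comm, Complex.exp_pi_mul_I] at h3
      norm_num at h3

end Harmonizable

/-! ### Stochastic integrals with respect to Gaussian noises -/

lemma eLpNorm_two_sq {α ε : Type*} [MeasurableSpace α] [ENorm ε] (μ : Measure α) (f : α → ε) :
    eLpNorm f 2 μ ^ 2 = ∫⁻ x, ‖f x‖ₑ ^ 2 ∂μ := by
  have h := eLpNorm_nnreal_pow_eq_lintegral (μ := μ) (f := f) (p := 2) two_ne_zero
  simpa using h

lemma lintegral_enorm_sq_gaussianReal (v : ℝ≥0) : ∫⁻ x, ‖x‖ₑ ^ 2 ∂(gaussianReal 0 v) = v := by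
  have h := ofReal_variance (X := fun x : ℝ => x) (μ := gaussianReal 0 v) (memLp_id_gaussianReal 2)
  rw [variance_fun_id_gaussianReal, evariance] at h
  simpa [integral_id_gaussianReal] using h.symm

/-- A noise all of whose linear real functionals are Gaussian with the isotropic variance. -/
structure IsIsotropicNoise {S Ω 𝕜 : Type*} [MeasurableSpace S] [MeasurableSpace Ω] [RCLike 𝕜]
    [MeasurableSpace 𝕜] (M : Set S → Ω → 𝕜) (μ : Measure S) (P : Measure Ω) : Prop
    extends IsIndependentlyScattered M μ P where
  law_re : ∀ A : Set S, MeasurableSet A → μ A ≠ ∞ → ∀ c : 𝕜,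
    P.map (fun ω => RCLike.re (c * M A ω)) = gaussianReal 0 (‖c‖₊ ^ 2 * (μ A).toNNReal)

section Noise

variable {S Ω : Type*} [MeasurableSpace S] [MeasurableSpace Ω]

lemma IsGaussianRandomMeasure.isIsotropicNoise {Z : Set S → Ω → ℝ} {μ : Measure S} {P : Measure Ω}
    (hZ : IsGaussianRandomMeasure Z μ P) : IsIsotropicNoise Z μ P := by
  refine ⟨hZ.toIsIndependentlyScattered, fun A hA hμ c => ?_⟩
  have h1 : P.map (fun ω => RCLike.re (c * Z A ω)) = (P.map (Z A)).map (fun x => c * x) := by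
    rw [AEMeasurable.map_map_of_aemeasurable (by fun_prop) (hZ.aemeasurable A hA hμ)]
    rfl
  rw [h1, hZ.law A hA hμ, gaussianReal_map_const_mul, mul_zero]
  congr 2
  ext
  simp

/-- `Re (c W) = c.re Re W - c.im Im W` is a sum of independent centered Gaussians, whose variances
add up to `‖c‖² μ A`. -/
lemma IsIsotropicGaussianRandomMeasure.isIsotropicNoise {W : Set S → Ω → ℂ} {μ : Measure S}
    {P : Measure Ω} (hW : IsIsotropicGaussianRandomMeasure W μ P) : IsIsotropicNoise W μ P := by
  refine ⟨hW.toIsIndependentlyScattered, fun A hA hμ c => ?_⟩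
  set v := (μ A).toNNReal with hv
  have h1 : P.map (fun ω => RCLike.re (c * W A ω)) =
      (P.map (W A)).map (fun z : ℂ => (c * z).re) := by
    rw [AEMeasurable.map_map_of_aemeasurable (by fun_prop) (hW.aemeasurable A hA hμ)]
    rfl
  have hmk : Measurable (fun z : ℝ × ℝ => (⟨z.1, z.2⟩ : ℂ)) :=
    Complex.measurableEquivRealProd.symm.measurable
  have h2 : (fun z : ℂ => (c * z).re) ∘ (fun z : ℝ × ℝ => (⟨z.1, z.2⟩ : ℂ))
      = (fun z : ℝ × ℝ => z.1 + z.2) ∘ Prod.map (fun x => c.re * x) (fun x => -c.im * x) := by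
    ext z
    simp [sub_eq_add_neg]
  rw [h1, hW.law A hA hμ, Measure.map_map (by fun_prop) hmk, h2,
    ← Measure.map_map (by fun_prop) (by fun_prop), ← Measure.map_prod_map _ _ (by fun_prop)
      (by fun_prop), gaussianReal_map_const_mul, gaussianReal_map_const_mul]
  have h3 := gaussianReal_conv_gaussianReal (m₁ := c.re * 0) (m₂ := -c.im * 0)
    (v₁ := NNReal.mk (c.re ^ 2) (sq_nonneg _) * v) (v₂ := NNReal.mk ((-c.im) ^ 2) (sq_nonneg _) * v)
  rw [Measure.conv] at h3
  rw [h3, mul_zero, mul_zero, add_zero, ← add_mul]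
  congr 2
  ext
  have h4 := Complex.normSq_eq_norm_sq c
  rw [Complex.normSq_apply] at h4
  simpa [sq] using h4

variable {𝕜 : Type*} [RCLike 𝕜] [MeasurableSpace 𝕜] {M : Set S → Ω → 𝕜}
  {μ : Measure S} {P : Measure Ω}

/-- For the constant sequence `∅` the partial sums are `n M(∅)`; they converge only if their common
increment vanishes. -/
lemma IsIndependentlyScattered.empty (hM : IsIndependentlyScattered M μ P) : M ∅ =ᵐ[P] 0 := by
  have h := hM.sigma_additive (fun _ => ∅) (fun _ => MeasurableSet.empty) (by simp)
    (fun i j _ => disjoint_bot_left)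
  filter_upwards [h] with ω hω
  simp only [Finset.sum_const, Finset.card_range, Set.iUnion_empty] at hω
  have h1 := (hω.comp (tendsto_add_atTop_nat 1)).sub hω
  rw [sub_self] at h1
  refine tendsto_nhds_unique (f := fun _ : ℕ => M ∅ ω) tendsto_const_nhds (h1.congr fun n => ?_)
  simp [add_mul]

lemma IsIndependentlyScattered.union (hM : IsIndependentlyScattered M μ P) {A B : Set S}
    (hA : MeasurableSet A) (hB : MeasurableSet B) (hμA : μ A ≠ ∞) (hμB : μ B ≠ ∞)
    (hAB : Disjoint A B) : M (A ∪ B) =ᵐ[P] M A + M B := by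
  let F : ℕ → Set S := fun n => if n = 0 then A else if n = 1 then B else ∅
  have hF : ⋃ n, F n = A ∪ B := by
    ext x
    simp only [Set.mem_iUnion, Set.mem_union, F]
    constructor
    · rintro ⟨n, hn⟩
      split_ifs at hn
      · exact Or.inl hn
      · exact Or.inr hn
      · exact hn.elim
    · rintro (h | h)
      · exact ⟨0, by simpa using h⟩
      · exact ⟨1, by simpa using h⟩
  have h := hM.sigma_additive F (fun n => by simp only [F]; split_ifs <;> simp [hA, hB])
    (by rw [hF]; exact measure_union_ne_top hμA hμB) (by
      intro i j hij
      simp only [F]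
      split_ifs with h1 h2 h3 h4 <;> first | omega | simp [hAB.symm])
  rw [hF] at h
  filter_upwards [h, hM.empty] with ω hω h0
  refine tendsto_nhds_unique hω (tendsto_const_nhds.congr' ?_)
  filter_upwards [eventually_ge_atTop 2] with n hn
  rw [← Finset.sum_subset (Finset.range_subset_range.2 hn)]
  · simp [Finset.sum_range_succ, F]
  · intro i _ hi
    have hi' : 2 ≤ i := not_lt.1 fun h => hi (Finset.mem_range.2 h)
    have h1 : F i = ∅ := by simp only [F]; rw [if_neg (by omega), if_neg (by omega)]
    rw [h1]
    exact h0

variable [BorelSpace 𝕜]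

namespace IsIsotropicNoise

lemma memLp (hM : IsIsotropicNoise M μ P) {A : Set S} (hA : MeasurableSet A) (hμ : μ A ≠ ∞) :
    MemLp (M A) 2 P := by
  have h : ∀ c : 𝕜, MemLp (fun ω => RCLike.re (c * M A ω)) 2 P := by
    intro c
    have h1 := memLp_id_gaussianReal (μ := 0) (v := ‖c‖₊ ^ 2 * (μ A).toNNReal) 2
    have hm := hM.aemeasurable A hA hμ
    rw [← hM.law_re A hA hμ c, memLp_map_measure_iff (by fun_prop) (by fun_prop)] at h1
    exact h1
  rw [← memLp_re_im_iff]
  refine ⟨by simpa using h 1, ?_⟩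
  simpa using h (-RCLike.I)

lemma aemeasurable_simpleIntegral (hM : IsIsotropicNoise M μ P) {s : SimpleFunc S 𝕜}
    (hs : s.FinMeasSupp μ) : AEMeasurable (simpleIntegral M s) P := by
  have h : simpleIntegral M s = fun ω => ∑ c ∈ s.range, c * M (s ⁻¹' {c}) ω := rfl
  rw [h]
  refine Finset.aemeasurable_fun_sum _ fun c _ => ?_
  by_cases hc : c = 0
  · simp [hc]
  · exact (hM.aemeasurable _ (s.measurableSet_fiber c)
      (hs.meas_preimage_singleton_ne_zero hc).ne).const_mul c

variable [IsProbabilityMeasure P]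

/-- Real functionals of integrals of simple functions are centered Gaussian. -/
lemma map_simpleIntegral (hM : IsIsotropicNoise M μ P) {s : SimpleFunc S 𝕜} (hs : s.FinMeasSupp μ)
    (k : 𝕜) : P.map (fun ω => RCLike.re (k * simpleIntegral M s ω)) =
      gaussianReal 0 (‖k‖₊ ^ 2 * (∫⁻ y, ‖s y‖ₑ ^ 2 ∂μ).toNNReal) := by
  classical
  -- The value zero is dropped because its fiber may have infinite measure.
  set R := s.range.filter (· ≠ 0) with hR
  have hfin : ∀ c ∈ R, μ (s ⁻¹' {c}) ≠ ∞ := fun c hc =>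
    (hs.meas_preimage_singleton_ne_zero (Finset.mem_filter.1 hc).2).ne
  have hmeas : ∀ c, MeasurableSet (s ⁻¹' {c}) := fun c => s.measurableSet_fiber c
  have hsum : ∀ ω, RCLike.re (k * simpleIntegral M s ω) =
      ∑ c ∈ R, RCLike.re (k * c * M (s ⁻¹' {c}) ω) := by
    intro ω
    rw [simpleIntegral, Finset.mul_sum, map_sum, hR, Finset.sum_filter]
    refine Finset.sum_congr rfl fun c _ => ?_
    by_cases hc : c = 0
    · simp [hc]
    · rw [if_pos hc, mul_assoc]
  -- Independence is available for families indexed by `Fin n`, so the nonzero values are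
  -- enumerated.
  let e := R.equivFin.symm
  let N : Fin R.card → Ω → ℝ := fun i ω => RCLike.re (k * (e i : 𝕜) * M (s ⁻¹' {(e i : 𝕜)}) ω)
  have hNlaw : ∀ i, P.map (N i) =
      gaussianReal 0 (‖k * (e i : 𝕜)‖₊ ^ 2 * (μ (s ⁻¹' {(e i : 𝕜)})).toNNReal) := fun i =>
    hM.law_re _ (hmeas _) (hfin _ (e i).2) _
  have hNmeas : ∀ i, AEMeasurable (N i) P := fun i => by
    have := hM.aemeasurable _ (hmeas _) (hfin _ (e i).2)
    fun_prop
  have hindep : iIndepFun N P :=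
    (hM.indep R.card (fun i => s ⁻¹' {(e i : 𝕜)}) (fun i => hmeas _) (fun i => hfin _ (e i).2)
      (fun i j hij => by
        refine Disjoint.preimage _ (Set.disjoint_singleton.2 fun h => hij ?_)
        exact e.injective (Subtype.ext h))).comp
      (fun i z => RCLike.re (k * (e i : 𝕜) * z)) (fun i => by fun_prop)
  have hsumN : (fun ω => RCLike.re (k * simpleIntegral M s ω)) = fun ω => ∑ i, N i ω := by
    ext ω
    rw [hsum, ← Finset.sum_coe_sort R (fun c => RCLike.re (k * c * M (s ⁻¹' {c}) ω))]
    exact (e.sum_comp (fun c : R => RCLike.re (k * (c : 𝕜) * M (s ⁻¹' {(c : 𝕜)}) ω))).symm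
  have hvar : ‖k‖₊ ^ 2 * (∫⁻ y, ‖s y‖ₑ ^ 2 ∂μ).toNNReal =
      ∑ i, ‖k * (e i : 𝕜)‖₊ ^ 2 * (μ (s ⁻¹' {(e i : 𝕜)})).toNNReal := by
    have h1 : ∫⁻ y, ‖s y‖ₑ ^ 2 ∂μ = ∑ c ∈ R, ‖c‖ₑ ^ 2 * μ (s ⁻¹' {c}) := by
      have h2 : ∫⁻ y, ‖s y‖ₑ ^ 2 ∂μ = ∫⁻ y, (s.map fun c => ‖c‖ₑ ^ 2) y ∂μ := rfl
      rw [h2, SimpleFunc.lintegral_eq_lintegral, SimpleFunc.map_lintegral, hR, Finset.sum_filter]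
      refine Finset.sum_congr rfl fun c _ => ?_
      by_cases hc : c = 0
      · simp [hc]
      · rw [if_pos hc]
    rw [h1, ENNReal.toNNReal_sum (fun c hc => ENNReal.mul_ne_top (by simp) (hfin c hc)),
      Finset.mul_sum, ← Finset.sum_coe_sort R]
    rw [← e.sum_comp]
    refine Finset.sum_congr rfl fun i _ => ?_
    rw [ENNReal.toNNReal_mul, ENNReal.toNNReal_pow, nnnorm_mul, mul_pow, mul_assoc]
    simp
  rw [hsumN, hvar]
  have hprob : IsProbabilityMeasure (P.map fun ω => ∑ i, N i ω) :=
    Measure.isProbabilityMeasure_map (by fun_prop)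
  refine Measure.ext_of_charFun ?_
  rw [hindep.charFun_map_fun_sum_eq_prod hNmeas]
  ext t
  rw [Finset.prod_apply, charFun_gaussianReal]
  simp_rw [hNlaw, charFun_gaussianReal]
  rw [← Complex.exp_sum]
  congr 1
  simp [Finset.sum_div, Finset.sum_mul]

/-- The squared modulus splits into the squares of the functionals for `k = 1` and `k = -I`, each of
second moment at most that of `s` (for real scalars the second vanishes). The factor 2 is not sharp;
only continuity of the integral is needed. -/
lemma eLpNorm_simpleIntegral_le (hM : IsIsotropicNoise M μ P) {s : SimpleFunc S 𝕜}
    (hs : s.FinMeasSupp μ) : eLpNorm (simpleIntegral M s) 2 P ≤ 2 * eLpNorm s 2 μ := by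
  have hm := hM.aemeasurable_simpleIntegral hs
  have hsfin : ∫⁻ y, ‖s y‖ₑ ^ 2 ∂μ ≠ ∞ := by
    rw [← eLpNorm_two_sq]
    exact ENNReal.pow_ne_top
      ((SimpleFunc.memLp_iff_finMeasSupp two_ne_zero ENNReal.ofNat_ne_top).2 hs).eLpNorm_ne_top
  have key : ∀ k : 𝕜, ∫⁻ ω, ‖RCLike.re (k * simpleIntegral M s ω)‖ₑ ^ 2 ∂P
      = ‖k‖ₑ ^ 2 * ∫⁻ y, ‖s y‖ₑ ^ 2 ∂μ := by
    intro k
    have h1 := lintegral_map' (μ := P) (f := fun x : ℝ => ‖x‖ₑ ^ 2)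
      (g := fun ω => RCLike.re (k * simpleIntegral M s ω)) (by fun_prop) (by fun_prop)
    rw [← h1, hM.map_simpleIntegral hs k, lintegral_enorm_sq_gaussianReal, ENNReal.coe_mul,
      ENNReal.coe_toNNReal hsfin, ENNReal.coe_pow]
    rfl
  have h1 : ∫⁻ ω, ‖simpleIntegral M s ω‖ₑ ^ 2 ∂P =
      ∫⁻ ω, ‖RCLike.re ((1 : 𝕜) * simpleIntegral M s ω)‖ₑ ^ 2
        + ‖RCLike.re (-RCLike.I * simpleIntegral M s ω)‖ₑ ^ 2 ∂P := by
    refine lintegral_congr fun ω => ?_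
    rw [enorm_sq_eq_ofReal, enorm_sq_eq_ofReal, ← ENNReal.ofReal_add (sq_nonneg _) (sq_nonneg _),
      ← ofReal_norm, ← ENNReal.ofReal_pow (norm_nonneg _), RCLike.norm_sq_eq_def]
    congr 1
    simp [sq]
  have h2 : ‖(-RCLike.I : 𝕜)‖ₑ ≤ 1 := by
    rw [enorm_neg, ← ofReal_norm, ENNReal.ofReal_le_one]
    by_cases h : (RCLike.I : 𝕜) = 0
    · simp [h]
    · exact (RCLike.norm_I_of_ne_zero h).le
  refine (ENNReal.pow_le_pow_left_iff two_ne_zero).1 ?_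
  rw [mul_pow, eLpNorm_two_sq, eLpNorm_two_sq, h1, lintegral_add_left' (by fun_prop), key, key]
  calc ‖(1 : 𝕜)‖ₑ ^ 2 * ∫⁻ y, ‖s y‖ₑ ^ 2 ∂μ + ‖(-RCLike.I : 𝕜)‖ₑ ^ 2 * ∫⁻ y, ‖s y‖ₑ ^ 2 ∂μ
      ≤ 1 ^ 2 * ∫⁻ y, ‖s y‖ₑ ^ 2 ∂μ + 1 ^ 2 * ∫⁻ y, ‖s y‖ₑ ^ 2 ∂μ := by
        gcongr
        simp
    _ = 2 * ∫⁻ y, ‖s y‖ₑ ^ 2 ∂μ := by rw [one_pow, one_mul, two_mul]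
    _ ≤ 2 ^ 2 * ∫⁻ y, ‖s y‖ₑ ^ 2 ∂μ := by
        gcongr
        norm_num

end IsIsotropicNoise

end Noise

/-! ### Existence of stochastic integrals and the law of their increments -/

section StochasticIntegral

lemma finMeasSupp_sub {S 𝕜 : Type*} [MeasurableSpace S] [RCLike 𝕜] {μ : Measure S}
    {s t : SimpleFunc S 𝕜} (hs : s.FinMeasSupp μ) (ht : t.FinMeasSupp μ) :
    (s - t).FinMeasSupp μ := by
  rw [← SimpleFunc.integrable_iff_finMeasSupp] at *
  exact hs.sub ht

variable {S Ω : Type*} [MeasurableSpace S] [MeasurableSpace Ω]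
  {𝕜 : Type*} [RCLike 𝕜] [MeasurableSpace 𝕜] {M : Set S → Ω → 𝕜}
  {μ : Measure S} {P : Measure Ω}

open Classical in
/-- The noise of a set as a vector of `L²(P)`. -/
def l2Noise (M : Set S → Ω → 𝕜) (P : Measure Ω) (A : Set S) : Lp 𝕜 2 P :=
  if h : MemLp (M A) 2 P then h.toLp (M A) else 0

/-- The noise of a set as a vector measure with values in operators. -/
def l2NoiseMap (M : Set S → Ω → 𝕜) (P : Measure Ω) (A : Set S) : 𝕜 →L[ℝ] Lp 𝕜 2 P :=
  (ContinuousLinearMap.toSpanSingleton 𝕜 (l2Noise M P A)).restrictScalars ℝ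

variable [BorelSpace 𝕜]

namespace IsIsotropicNoise

lemma coeFn_l2Noise (hM : IsIsotropicNoise M μ P) {A : Set S} (hA : MeasurableSet A)
    (hμ : μ A ≠ ∞) : l2Noise M P A =ᵐ[P] M A := by
  rw [l2Noise, dif_pos (hM.memLp hA hμ)]
  exact MemLp.coeFn_toLp _

/-- This makes `SimpleFunc.setToSimpleFunc` available with values in `L²(P)`, and its subtraction
rule then passes to simple stochastic integrals almost surely. -/
lemma finMeasAdditive (hM : IsIsotropicNoise M μ P) : FinMeasAdditive μ (l2NoiseMap M P) := by
  intro A B hA hB hμA hμB hAB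
  have h : l2Noise M P (A ∪ B) = l2Noise M P A + l2Noise M P B := by
    refine Lp.ext ?_
    filter_upwards [hM.coeFn_l2Noise hA hμA, hM.coeFn_l2Noise hB hμB,
      hM.coeFn_l2Noise (hA.union hB) (measure_union_ne_top hμA hμB),
      hM.union hA hB hμA hμB hAB, Lp.coeFn_add (l2Noise M P A) (l2Noise M P B)]
      with ω h1 h2 h3 h4 h5
    rw [h5, h3, h4, Pi.add_apply, Pi.add_apply, h1, h2]
  ext1 c
  simp [l2NoiseMap, h]

lemma coeFn_setToSimpleFunc (hM : IsIsotropicNoise M μ P) {s : SimpleFunc S 𝕜}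
    (hs : s.FinMeasSupp μ) :
    (s.setToSimpleFunc (l2NoiseMap M P) : Lp 𝕜 2 P) =ᵐ[P] simpleIntegral M s := by
  have h1 : ∀ c ∈ s.range, (l2NoiseMap M P (s ⁻¹' {c}) c : Lp 𝕜 2 P) =ᵐ[P]
      fun ω => c * M (s ⁻¹' {c}) ω := by
    intro c _
    by_cases hc : c = 0
    · rw [hc, map_zero]
      filter_upwards [Lp.coeFn_zero 𝕜 2 P] with ω hω
      rw [hω]; simp
    · have h2 : l2NoiseMap M P (s ⁻¹' {c}) c = c • l2Noise M P (s ⁻¹' {c}) := by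
        simp [l2NoiseMap]
      rw [h2]
      filter_upwards [Lp.coeFn_smul c (l2Noise M P (s ⁻¹' {c})),
        hM.coeFn_l2Noise (s.measurableSet_fiber c) (hs.meas_preimage_singleton_ne_zero hc).ne]
        with ω h3 h4
      rw [h3, Pi.smul_apply, h4, smul_eq_mul]
  have h2 : ∀ᵐ ω ∂P, ∀ c ∈ s.range, (l2NoiseMap M P (s ⁻¹' {c}) c : Lp 𝕜 2 P) ω =
      c * M (s ⁻¹' {c}) ω :=
    (eventually_all_finset _).2 h1
  filter_upwards [Lp.coeFn_finsetSum s.range (fun c => l2NoiseMap M P (s ⁻¹' {c}) c), h2]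
    with ω h3 h4
  rw [SimpleFunc.setToSimpleFunc, h3, Finset.sum_apply, simpleIntegral]
  exact Finset.sum_congr rfl h4

lemma memLp_simpleIntegral (hM : IsIsotropicNoise M μ P) {s : SimpleFunc S 𝕜}
    (hs : s.FinMeasSupp μ) : MemLp (simpleIntegral M s) 2 P :=
  (memLp_congr_ae (hM.coeFn_setToSimpleFunc hs)).1 (Lp.memLp _)

lemma simpleIntegral_sub (hM : IsIsotropicNoise M μ P) {s t : SimpleFunc S 𝕜}
    (hs : s.FinMeasSupp μ) (ht : t.FinMeasSupp μ) :
    simpleIntegral M (s - t) =ᵐ[P] simpleIntegral M s - simpleIntegral M t := by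
  have h := SimpleFunc.setToSimpleFunc_sub (l2NoiseMap M P) hM.finMeasAdditive
    (SimpleFunc.integrable_iff_finMeasSupp.2 hs) (SimpleFunc.integrable_iff_finMeasSupp.2 ht)
  filter_upwards [hM.coeFn_setToSimpleFunc hs, hM.coeFn_setToSimpleFunc ht,
    hM.coeFn_setToSimpleFunc (finMeasSupp_sub hs ht),
    Lp.coeFn_sub (s.setToSimpleFunc (l2NoiseMap M P)) (t.setToSimpleFunc (l2NoiseMap M P))]
    with ω h1 h2 h3 h4
  rw [← h3, h, h4, Pi.sub_apply, Pi.sub_apply, h1, h2]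

variable [IsProbabilityMeasure P]

/-- Simple functions approximating `f` in `L²(μ)` have integrals that are Cauchy in `L²(P)`, by
linearity and the norm bound for simple integrals. -/
lemma exists_isStochIntegral (hM : IsIsotropicNoise M μ P) {f : S → 𝕜} (hf : MemLp f 2 μ) :
    ∃ I : Ω → 𝕜, IsStochIntegral M μ P f I := by
  choose s hs hs2 using fun n : ℕ => hf.exists_simpleFunc_eLpNorm_sub_lt ENNReal.ofNat_ne_top
    (ε := ENNReal.ofReal (1 / ((n : ℝ) + 1))) (by
      rw [Ne, ENNReal.ofReal_eq_zero, not_le]; positivity)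
  have hfin : ∀ n, (s n).FinMeasSupp μ := fun n =>
    (SimpleFunc.memLp_iff_finMeasSupp two_ne_zero ENNReal.ofNat_ne_top).1 (hs2 n)
  have hlim : Tendsto (fun n => eLpNorm (⇑(s n) - f) 2 μ) atTop (𝓝 0) := by
    have h1 : Tendsto (fun n : ℕ => ENNReal.ofReal (1 / ((n : ℝ) + 1))) atTop (𝓝 0) := by
      simpa using ENNReal.tendsto_ofReal tendsto_one_div_add_atTop_nhds_zero_nat
    refine tendsto_of_tendsto_of_tendsto_of_le_of_le tendsto_const_nhds h1 (fun _ => bot_le)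
      fun n => ?_
    rw [eLpNorm_sub_comm]
    exact (hs n).le
  have hF := (Lp.tendsto_Lp_iff_tendsto_eLpNorm'' (fun n => (s n : S → 𝕜)) hs2 f hf).2 hlim
  let L : ℕ → Lp 𝕜 2 P := fun n => (hM.memLp_simpleIntegral (hfin n)).toLp _
  have hdist : ∀ n m, dist (L n) (L m) ≤ 2 * dist ((hs2 n).toLp _) ((hs2 m).toLp _) := by
    intro n m
    rw [Lp.dist_def, Lp.dist_def]
    have h1 : eLpNorm (⇑(L n) - ⇑(L m)) 2 P = eLpNorm (simpleIntegral M (s n - s m)) 2 P := by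
      refine eLpNorm_congr_ae ?_
      filter_upwards [hM.simpleIntegral_sub (hfin n) (hfin m),
        (hM.memLp_simpleIntegral (hfin n)).coeFn_toLp,
        (hM.memLp_simpleIntegral (hfin m)).coeFn_toLp] with ω h1 h2 h3
      rw [h1, Pi.sub_apply, Pi.sub_apply, h2, h3]
    have h2 : eLpNorm (⇑((hs2 n).toLp _) - ⇑((hs2 m).toLp _)) 2 μ = eLpNorm (⇑(s n - s m)) 2 μ := by
      refine eLpNorm_congr_ae ?_
      filter_upwards [(hs2 n).coeFn_toLp, (hs2 m).coeFn_toLp] with ω h2 h3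
      rw [Pi.sub_apply, h2, h3, SimpleFunc.coe_sub, Pi.sub_apply]
    rw [h1, h2]
    have h3 := hM.eLpNorm_simpleIntegral_le (finMeasSupp_sub (hfin n) (hfin m))
    have h4 : eLpNorm (⇑(s n - s m)) 2 μ ≠ ∞ := ((hs2 n).sub (hs2 m)).eLpNorm_ne_top
    have h5 := ENNReal.toReal_mono (ENNReal.mul_ne_top ENNReal.ofNat_ne_top h4) h3
    simpa using h5
  have hcauchy : CauchySeq L := by
    have h1 := hF.cauchySeq
    rw [Metric.cauchySeq_iff] at h1 ⊢
    intro ε hε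
    obtain ⟨N, hN⟩ := h1 (ε / 2) (by positivity)
    refine ⟨N, fun m hm n hn => ?_⟩
    have := hN m hm n hn
    linarith [hdist m n]
  obtain ⟨I, hI⟩ := cauchySeq_tendsto_of_complete hcauchy
  refine ⟨I, hf, Lp.memLp I, s, hfin, hlim, ?_⟩
  have h1 := (Lp.tendsto_Lp_iff_tendsto_eLpNorm'' (fun n => simpleIntegral M (s n))
    (fun n => hM.memLp_simpleIntegral (hfin n)) I (Lp.memLp I)).1 (by
      rw [Lp.toLp_coeFn]; exact hI)
  exact h1

lemma isStochIntegral_stochIntegral (hM : IsIsotropicNoise M μ P) {f : S → 𝕜} (hf : MemLp f 2 μ) :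
    IsStochIntegral M μ P f (stochIntegral M μ P f) := by
  have h := hM.exists_isStochIntegral hf
  rw [stochIntegral, dif_pos h]
  exact h.choose_spec

/-- Increments of stochastic integrals are centered Gaussian. -/
lemma map_sub_of_isStochIntegral (hM : IsIsotropicNoise M μ P) {f g : S → 𝕜} {I J : Ω → 𝕜}
    (hI : IsStochIntegral M μ P f I) (hJ : IsStochIntegral M μ P g J) :
    P.map (fun ω => RCLike.re (I ω) - RCLike.re (J ω)) =
      gaussianReal 0 (∫⁻ y, ‖f y - g y‖ₑ ^ 2 ∂μ).toNNReal := by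
  obtain ⟨hf, hIm, s, hs, hsf, hsI⟩ := hI
  obtain ⟨hg, hJm, t, ht, htg, htJ⟩ := hJ
  have hs2 : ∀ n, MemLp (s n) 2 μ := fun n =>
    (SimpleFunc.memLp_iff_finMeasSupp two_ne_zero ENNReal.ofNat_ne_top).2 (hs n)
  have ht2 : ∀ n, MemLp (t n) 2 μ := fun n =>
    (SimpleFunc.memLp_iff_finMeasSupp two_ne_zero ENNReal.ofNat_ne_top).2 (ht n)
  let v : ℕ → ℝ≥0 := fun n => (∫⁻ y, ‖(s n - t n) y‖ₑ ^ 2 ∂μ).toNNReal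
  have hv : Tendsto v atTop (𝓝 (∫⁻ y, ‖f y - g y‖ₑ ^ 2 ∂μ).toNNReal) := by
    have h1 := (Lp.tendsto_Lp_iff_tendsto_eLpNorm'' (fun n => (s n : S → 𝕜)) hs2 f hf).2 hsf
    have h2 := (Lp.tendsto_Lp_iff_tendsto_eLpNorm'' (fun n => (t n : S → 𝕜)) ht2 g hg).2 htg
    have h3 := ((h1.sub h2).nnnorm).pow 2
    have h4 : ∀ {u w : S → 𝕜} (hu : MemLp u 2 μ) (hw : MemLp w 2 μ),
        ‖hu.toLp u - hw.toLp w‖₊ ^ 2 = (∫⁻ y, ‖u y - w y‖ₑ ^ 2 ∂μ).toNNReal := by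
      intro u w hu hw
      rw [← MemLp.toLp_sub, Lp.nnnorm_toLp, ← ENNReal.toNNReal_pow, eLpNorm_two_sq]
      rfl
    rw [h4 hf hg] at h3
    exact h3.congr fun n => h4 (hs2 n) (ht2 n)
  let D : ℕ → Ω → 𝕜 := fun n => simpleIntegral M (s n) - simpleIntegral M (t n)
  have hD : Tendsto (fun n => eLpNorm (D n - (I - J)) 2 P) atTop (𝓝 0) := by
    have h1 : Tendsto (fun n => eLpNorm (fun ω => simpleIntegral M (s n) ω - I ω) 2 P +
        eLpNorm (fun ω => simpleIntegral M (t n) ω - J ω) 2 P) atTop (𝓝 0) := by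
      simpa using hsI.add htJ
    refine tendsto_of_tendsto_of_tendsto_of_le_of_le tendsto_const_nhds h1 (fun _ => bot_le)
      fun n => ?_
    have h2 : D n - (I - J) = (simpleIntegral M (s n) - I) - (simpleIntegral M (t n) - J) := by
      simp only [D]; abel
    rw [h2]
    exact eLpNorm_sub_le ((hM.memLp_simpleIntegral (hs n)).1.sub hIm.1)
      ((hM.memLp_simpleIntegral (ht n)).1.sub hJm.1) one_le_two
  have hDm : ∀ n, AEStronglyMeasurable (D n) P := fun n =>
    (hM.memLp_simpleIntegral (hs n)).1.sub (hM.memLp_simpleIntegral (ht n)).1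
  -- Convergence in `L²` gives almost sure convergence along a subsequence, hence convergence of
  -- characteristic functions by dominated convergence. The Gaussian characteristic functions
  -- converge as well, because their variances do.
  obtain ⟨k, hk, hlim⟩ := (tendstoInMeasure_of_tendsto_eLpNorm two_ne_zero hDm
    (hIm.1.sub hJm.1) hD).exists_seq_tendsto_ae
  have hlaw : ∀ n, P.map (fun ω => RCLike.re (D n ω)) = gaussianReal 0 (v n) := by
    intro n
    have h1 := hM.map_simpleIntegral (finMeasSupp_sub (hs n) (ht n)) 1
    rw [nnnorm_one, one_pow, one_mul] at h1
    rw [← h1]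
    refine Measure.map_congr ?_
    filter_upwards [hM.simpleIntegral_sub (hs n) (ht n)] with ω hω
    rw [one_mul, hω]
  have hImeas := hIm.1.aemeasurable
  have hJmeas := hJm.1.aemeasurable
  have hDmeas := fun n => (hDm n).aemeasurable
  have hIJ : AEMeasurable (fun ω => RCLike.re (I ω) - RCLike.re (J ω)) P := by fun_prop
  have hprob := Measure.isProbabilityMeasure_map hIJ
  refine Measure.ext_of_charFun (funext fun r => ?_)
  have h1 : Tendsto (fun n => charFun (P.map (fun ω => RCLike.re (D (k n) ω))) r) atTop
      (𝓝 (charFun (P.map (fun ω => RCLike.re (I ω) - RCLike.re (J ω))) r)) := by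
    simp_rw [charFun_apply_real]
    rw [integral_map hIJ (by fun_prop)]
    have h2 : ∀ n, ∫ x, Complex.exp (r * x * Complex.I) ∂(P.map fun ω => RCLike.re (D (k n) ω))
        = ∫ ω, Complex.exp (r * (RCLike.re (D (k n) ω) : ℝ) * Complex.I) ∂P := fun n =>
      integral_map (by have := hDmeas (k n); fun_prop) (by fun_prop)
    simp_rw [h2]
    refine tendsto_integral_of_dominated_convergence (fun _ => 1) (fun n => ?_)
      (integrable_const 1) (fun n => ae_of_all _ fun ω => ?_) ?_
    · have := hDmeas (k n)
      exact AEMeasurable.aestronglyMeasurable (by fun_prop)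
    · rw [← Complex.ofReal_mul, Complex.norm_exp_ofReal_mul_I]
    · filter_upwards [hlim] with ω hω
      have h3 : Continuous fun z : 𝕜 =>
          Complex.exp (r * (RCLike.re z : ℝ) * Complex.I) := by fun_prop
      have h4 := (h3.tendsto _).comp hω
      simpa [Function.comp_def] using h4
  have h2 : Tendsto (fun n => charFun (P.map (fun ω => RCLike.re (D (k n) ω))) r) atTop
      (𝓝 (charFun (gaussianReal 0 (∫⁻ y, ‖f y - g y‖ₑ ^ 2 ∂μ).toNNReal) r)) := by
    simp_rw [hlaw, charFun_gaussianReal]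
    have h3 : Continuous fun w : ℝ≥0 =>
        Complex.exp (r * (0 : ℝ) * Complex.I - ((w : ℝ) : ℂ) * r ^ 2 / 2) := by fun_prop
    exact (h3.tendsto _).comp (hv.comp hk.tendsto_atTop)
  exact tendsto_nhds_unique h1 h2

end IsIsotropicNoise

end StochasticIntegral

/-! ### The Garsia-Rodemich-Rumsey estimate -/

section HolderEstimate

lemma enorm_integral_sub_integral_le {T : Type*} [MeasurableSpace T] {π π' : Measure T}
    [IsProbabilityMeasure π] [IsProbabilityMeasure π'] {f : T → ℝ} (hf : Integrable f π)
    (hf' : Integrable f π') :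
    ‖∫ u, f u ∂π - ∫ v, f v ∂π'‖ₑ ≤ ∫⁻ u, ∫⁻ v, ‖f u - f v‖ₑ ∂π' ∂π := by
  have h1 : ∫ u, f u ∂π - ∫ v, f v ∂π' = ∫ u, (f u - ∫ v, f v ∂π') ∂π := by
    rw [integral_sub hf (integrable_const _)]; simp
  rw [h1]
  refine (enorm_integral_le_lintegral_enorm _).trans (lintegral_mono fun u => ?_)
  have h2 : f u - ∫ v, f v ∂π' = ∫ v, (f u - f v) ∂π' := by
    rw [integral_sub (integrable_const _) hf']; simp
  rw [h2]
  exact enorm_integral_le_lintegral_enorm _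

lemma lintegral_cond {T : Type*} [MeasurableSpace T] (ν : Measure T) (B : Set T)
    (F : T → ℝ≥0∞) : ∫⁻ u, F u ∂ν[|B] = (ν B)⁻¹ * ∫⁻ u in B, F u ∂ν := by
  rw [ProbabilityTheory.cond, lintegral_smul_measure, smul_eq_mul]

/-- Either `D ≤ ρ^s`, or `D / ρ^s ≥ 1` is bounded by its own `N`-th power; the factor `(3ρ/r)^q ≥ 1`
is then inserted to produce the kernel `D^N / r^q`. -/
lemma le_rpow_add_mul_div {D ρ s r q k : ℝ} {N : ℕ} (hD : 0 ≤ D) (hρ : 0 < ρ) (hN : N ≠ 0)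
    (hr0 : 0 ≤ r) (hr : r ≤ 3 * ρ) (hDr : r = 0 → D = 0) (hq : q = k + s * N) (hq0 : 0 ≤ q) :
    D ≤ ρ ^ s + ρ ^ s * 3 ^ q * ρ ^ k * (D ^ N / r ^ q) := by
  have hs : 0 < ρ ^ s := Real.rpow_pos_of_pos hρ s
  rcases hr0.eq_or_lt with h0 | h0
  · rw [hDr h0.symm]; positivity
  have h1 : D ≤ ρ ^ s + ρ ^ s * (D / ρ ^ s) ^ N := by
    rcases le_total D (ρ ^ s) with h | h
    · have : 0 ≤ ρ ^ s * (D / ρ ^ s) ^ N := by positivity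
      linarith
    · have h2 : D / ρ ^ s ≤ (D / ρ ^ s) ^ N := le_self_pow₀ ((one_le_div hs).2 h) hN
      have h3 : D = ρ ^ s * (D / ρ ^ s) := by field_simp
      nlinarith
  have h2 : (ρ ^ s) ^ N * ρ ^ k = ρ ^ q := by
    rw [hq, Real.rpow_add hρ, Real.rpow_mul hρ.le, Real.rpow_natCast, mul_comm]
  have h3 : (1 : ℝ) ≤ 3 ^ q * ρ ^ q / r ^ q := by
    rw [one_le_div (by positivity), ← Real.mul_rpow (by norm_num) hρ.le]
    exact Real.rpow_le_rpow hr0 hr hq0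
  refine h1.trans (add_le_add le_rfl ?_)
  calc ρ ^ s * (D / ρ ^ s) ^ N = ρ ^ s * (D / ρ ^ s) ^ N * 1 := by ring
    _ ≤ ρ ^ s * (D / ρ ^ s) ^ N * (3 ^ q * ρ ^ q / r ^ q) := by gcongr
    _ = ρ ^ s * 3 ^ q * ρ ^ k * (D ^ N / r ^ q) := by
      rw [← h2, div_pow]; field_simp

variable {T : Type*} [NormedAddCommGroup T] [NormedSpace ℝ T] [FiniteDimensional ℝ T]
  [MeasurableSpace T] [BorelSpace T]

/-- The Garsia-Rodemich-Rumsey functional of `f` on the ball of radius `R`. -/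
def oscIntegral (ν : Measure T) (N : ℕ) (q R : ℝ) (f : T → ℝ) : ℝ≥0∞ :=
  ∫⁻ u in Metric.ball 0 R, ∫⁻ v in Metric.ball 0 R,
    ENNReal.ofReal (|f u - f v| ^ N / ‖u - v‖ ^ q) ∂ν ∂ν

lemma _root_.Continuous.integrable_cond_ball {ν : Measure T} [ν.IsAddHaarMeasure] {f : T → ℝ}
    (hf : Continuous f) (x : T) {ρ : ℝ} (hρ : 0 < ρ) :
    Integrable f ν[|Metric.ball x ρ] := by
  have h : IntegrableOn f (Metric.ball x ρ) ν :=
    (hf.continuousOn.integrableOn_compact (isCompact_closedBall x ρ)).mono_set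
      Metric.ball_subset_closedBall
  exact h.integrable.smul_measure (ENNReal.inv_ne_top.2 (Metric.measure_ball_pos ν x hρ).ne')

/-- The pointwise inequality `le_rpow_add_mul_div` with `k = 2m` is averaged over the two balls. The
normalization costs a factor of order `ρ^{-2m}`, since comparable radii mean comparable volumes, and
this cancels `ρ^k`. -/
lemma exists_abs_average_sub_le (ν : Measure T) [ν.IsAddHaarMeasure] {N : ℕ} (hN : N ≠ 0)
    {s : ℝ} (hs : 0 < s) :
    ∃ C : ℝ, 0 < C ∧ ∀ (f : T → ℝ) (R : ℝ), Continuous f →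
      oscIntegral ν N (2 * Module.finrank ℝ T + s * N) R f ≠ ∞ → ∀ (x y : T) (ρ ρ' : ℝ),
      0 < ρ' → ρ' ≤ ρ → ρ ≤ 2 * ρ' → ‖x - y‖ ≤ ρ → Metric.ball x ρ ⊆ Metric.ball 0 R →
      Metric.ball y ρ' ⊆ Metric.ball 0 R →
      |∫ u, f u ∂ν[|Metric.ball x ρ] - ∫ u, f u ∂ν[|Metric.ball y ρ']| ≤
        ρ ^ s * (1 + C * (oscIntegral ν N (2 * Module.finrank ℝ T + s * N) R f).toReal) := by
  set m := Module.finrank ℝ T with hm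
  set q : ℝ := 2 * m + s * N with hq
  have hq0 : 0 ≤ q := by positivity
  set κ : ℝ := (ν (Metric.ball (0 : T) 1)).toReal with hκ
  have hκtop : ν (Metric.ball (0 : T) 1) ≠ ∞ := measure_ball_lt_top.ne
  have hκ0 : 0 < κ := ENNReal.toReal_pos (Metric.measure_ball_pos ν _ one_pos).ne' hκtop
  have hball : ∀ (x : T) (ρ : ℝ), 0 < ρ → ν (Metric.ball x ρ) = ENNReal.ofReal (ρ ^ m * κ) := by
    intro x ρ hρ
    rw [Measure.addHaar_ball_of_pos ν x hρ, ENNReal.ofReal_mul (by positivity),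
      ENNReal.ofReal_toReal hκtop]
  -- `3 ^ q` comes from `‖u - v‖ ≤ 3ρ`, `2 ^ m` from the ratio of the radii, and `κ ^ 2` from the
  -- volumes of the two balls.
  refine ⟨3 ^ q * 2 ^ m / κ ^ 2, by positivity, ?_⟩
  intro f R hf hQ x y ρ ρ' hρ' hρρ' hρ2 hxy hx hy
  have hρ : 0 < ρ := hρ'.trans_le hρρ'
  set B := Metric.ball x ρ
  set B' := Metric.ball y ρ'
  have hB0 : ν B ≠ 0 := (Metric.measure_ball_pos ν x hρ).ne'
  have hB0' : ν B' ≠ 0 := (Metric.measure_ball_pos ν y hρ').ne'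
  have hBt : ν B ≠ ∞ := measure_ball_lt_top.ne
  have hBt' : ν B' ≠ ∞ := measure_ball_lt_top.ne
  have : IsProbabilityMeasure ν[|B] := cond_isProbabilityMeasure_of_finite hB0 hBt
  have : IsProbabilityMeasure ν[|B'] := cond_isProbabilityMeasure_of_finite hB0' hBt'
  set K₁ : ℝ≥0∞ := ENNReal.ofReal (ρ ^ s)
  set K₂ : ℝ≥0∞ := ENNReal.ofReal (ρ ^ s * 3 ^ q * ρ ^ (2 * m : ℝ))
  let g : T → T → ℝ≥0∞ := fun u v => ENNReal.ofReal (|f u - f v| ^ N / ‖u - v‖ ^ q)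
  have hg : Measurable (Function.uncurry g) := by
    have := hf.measurable
    simp only [g, Function.uncurry_def]
    fun_prop
  have hpt : ∀ u ∈ B, ∀ v ∈ B', ‖f u - f v‖ₑ ≤ K₁ + K₂ * g u v := by
    intro u hu v hv
    have hu' : ‖u - x‖ < ρ := mem_ball_iff_norm.1 hu
    have hv' : ‖y - v‖ < ρ' := mem_ball_iff_norm'.1 hv
    have h3 : ‖u - v‖ ≤ 3 * ρ := by
      have : u - v = (u - x) + (x - y) + (y - v) := by abel
      rw [this]
      linarith [norm_add₃_le (a := u - x) (b := x - y) (c := y - v)]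
    have h4 := le_rpow_add_mul_div (abs_nonneg (f u - f v)) hρ hN (norm_nonneg (u - v)) h3
      (fun h => by rw [sub_eq_zero.1 (norm_eq_zero.1 h)]; simp) hq hq0
    rw [← ofReal_norm, Real.norm_eq_abs, ← ENNReal.ofReal_mul (by positivity),
      ← ENNReal.ofReal_add (by positivity) (by positivity)]
    exact ENNReal.ofReal_le_ofReal h4
  have hinner : ∀ u ∈ B, ∫⁻ v, ‖f u - f v‖ₑ ∂ν[|B'] ≤
      K₁ + K₂ * (ν B')⁻¹ * ∫⁻ v in Metric.ball 0 R, g u v ∂ν := by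
    intro u hu
    calc ∫⁻ v, ‖f u - f v‖ₑ ∂ν[|B'] ≤ ∫⁻ v, K₁ + K₂ * g u v ∂ν[|B'] := by
          refine lintegral_mono_ae ?_
          filter_upwards [ae_cond_mem measurableSet_ball] with v hv
          exact hpt u hu v hv
      _ = K₁ + K₂ * ((ν B')⁻¹ * ∫⁻ v in B', g u v ∂ν) := by
          rw [lintegral_add_left measurable_const, lintegral_const, measure_univ, mul_one,
            lintegral_const_mul _ (by fun_prop), lintegral_cond]
      _ ≤ _ := by
          rw [mul_assoc]
          gcongr
  have hmain : ‖∫ u, f u ∂ν[|B] - ∫ u, f u ∂ν[|B']‖ₑ ≤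
      K₁ + K₂ * (ν B')⁻¹ * (ν B)⁻¹ * oscIntegral ν N q R f := by
    refine (enorm_integral_sub_integral_le (hf.integrable_cond_ball x hρ)
      (hf.integrable_cond_ball y hρ')).trans ?_
    calc ∫⁻ u, ∫⁻ v, ‖f u - f v‖ₑ ∂ν[|B'] ∂ν[|B]
        ≤ ∫⁻ u, K₁ + K₂ * (ν B')⁻¹ * ∫⁻ v in Metric.ball 0 R, g u v ∂ν ∂ν[|B] := by
          refine lintegral_mono_ae ?_
          filter_upwards [ae_cond_mem measurableSet_ball] with u hu
          exact hinner u hu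
      _ = K₁ + K₂ * (ν B')⁻¹ * ((ν B)⁻¹ * ∫⁻ u in B, ∫⁻ v in Metric.ball 0 R, g u v ∂ν ∂ν) := by
          have h5 : Measurable fun u => ∫⁻ v in Metric.ball 0 R, g u v ∂ν :=
            hg.lintegral_prod_right
          rw [lintegral_add_left measurable_const, lintegral_const, measure_univ, mul_one,
            lintegral_const_mul _ h5, lintegral_cond]
      _ ≤ _ := by
          rw [mul_assoc (K₂ * (ν B')⁻¹)]
          gcongr
          exact lintegral_mono_set hx
  have hfin : K₂ * (ν B')⁻¹ * (ν B)⁻¹ * oscIntegral ν N q R f ≠ ∞ := by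
    refine ENNReal.mul_ne_top (ENNReal.mul_ne_top (ENNReal.mul_ne_top ENNReal.ofReal_ne_top ?_) ?_)
      hQ
    · exact ENNReal.inv_ne_top.2 hB0'
    · exact ENNReal.inv_ne_top.2 hB0
  have h6 := ENNReal.toReal_mono (ENNReal.add_ne_top.2 ⟨ENNReal.ofReal_ne_top, hfin⟩) hmain
  rw [toReal_enorm, Real.norm_eq_abs, ENNReal.toReal_add ENNReal.ofReal_ne_top hfin,
    ENNReal.toReal_mul, ENNReal.toReal_mul, ENNReal.toReal_mul, ENNReal.toReal_inv,
    ENNReal.toReal_inv, hball x ρ hρ, hball y ρ' hρ', ENNReal.toReal_ofReal (by positivity),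
    ENNReal.toReal_ofReal (by positivity), ENNReal.toReal_ofReal (by positivity),
    ENNReal.toReal_ofReal (by positivity)] at h6
  refine h6.trans ?_
  rw [mul_add, mul_one, ← mul_assoc]
  refine add_le_add le_rfl (mul_le_mul_of_nonneg_right ?_ ENNReal.toReal_nonneg)
  have h7 : ρ ^ (2 * m : ℝ) = ρ ^ m * ρ ^ m := by
    rw [two_mul, Real.rpow_add hρ, Real.rpow_natCast]
  have h8 : ρ ^ m ≤ 2 ^ m * ρ' ^ m := by
    rw [← mul_pow]; exact pow_le_pow_left₀ hρ.le hρ2 m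
  rw [h7]
  calc ρ ^ s * 3 ^ q * (ρ ^ m * ρ ^ m) * (ρ' ^ m * κ)⁻¹ * (ρ ^ m * κ)⁻¹
      = ρ ^ s * 3 ^ q / κ ^ 2 * (ρ ^ m / ρ' ^ m) := by field_simp
    _ ≤ ρ ^ s * 3 ^ q / κ ^ 2 * 2 ^ m := by
        gcongr
        rwa [div_le_iff₀ (by positivity)]
    _ = ρ ^ s * (3 ^ q * 2 ^ m / κ ^ 2) := by ring

/-- With `ρ = ‖x - y‖`, the averages of `f` over balls of radius `ρ 2^{-n}` converge to the values
at their centers, with differences summing geometrically with ratio `2^{-s}`. One comparison at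
radius `ρ` links `x` to `y`. Since `ρ < 2R`, all the balls lie in the ball of radius `3R`. -/
lemma exists_holder_of_oscIntegral (ν : Measure T) [ν.IsAddHaarMeasure] {N : ℕ} (hN : N ≠ 0)
    {s : ℝ} (hs : 0 < s) :
    ∃ C : ℝ, 0 < C ∧ ∀ (f : T → ℝ) (R : ℝ), Continuous f →
      oscIntegral ν N (2 * Module.finrank ℝ T + s * N) (3 * R) f ≠ ∞ →
      ∀ x ∈ Metric.ball (0 : T) R, ∀ y ∈ Metric.ball (0 : T) R, |f x - f y| ≤
        C * (1 + (oscIntegral ν N (2 * Module.finrank ℝ T + s * N) (3 * R) f).toReal) *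
          ‖x - y‖ ^ s := by
  obtain ⟨C, hC, h⟩ := exists_abs_average_sub_le ν hN hs
  set θ : ℝ := (1 / 2 : ℝ) ^ s with hθ
  have hθ0 : 0 < θ := by positivity
  have hθ1 : θ < 1 := Real.rpow_lt_one (by norm_num) (by norm_num) hs
  refine ⟨(2 / (1 - θ) + 1) * (1 + C), by have := sub_pos.2 hθ1; positivity, ?_⟩
  intro f R hf hQ x hx y hy
  set Q := (oscIntegral ν N (2 * Module.finrank ℝ T + s * N) (3 * R) f).toReal
  have hQ0 : 0 ≤ Q := ENNReal.toReal_nonneg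
  rcases eq_or_ne x y with rfl | hxy
  · simp [Real.zero_rpow hs.ne']
  set ρ := ‖x - y‖ with hρdef
  have hρ : 0 < ρ := norm_pos_iff.2 (sub_ne_zero.2 hxy)
  have hx' : ‖x‖ < R := mem_ball_zero_iff.1 hx
  have hy' : ‖y‖ < R := mem_ball_zero_iff.1 hy
  have hρR : ρ < 2 * R := by linarith [norm_sub_le x y]
  have hsub : ∀ z : T, ‖z‖ < R → ∀ r ≤ ρ, Metric.ball z r ⊆ Metric.ball 0 (3 * R) := by
    intro z hz r hr w hw
    rw [mem_ball_iff_norm] at hw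
    rw [mem_ball_zero_iff]
    have : w = (w - z) + z := by abel
    rw [this]
    linarith [norm_add_le (w - z) z]
  have hpt : ∀ z : T, ‖z‖ < R →
      |∫ u, f u ∂ν[|Metric.ball z ρ] - f z| ≤ ρ ^ s * (1 + C * Q) / (1 - θ) := by
    intro z hz
    let r : ℕ → ℝ := fun n => ρ * (1 / 2) ^ n
    have hr0 : ∀ n, 0 < r n := fun n => by positivity
    have hrρ : ∀ n, r n ≤ ρ := fun n =>
      mul_le_of_le_one_right hρ.le (pow_le_one₀ (by norm_num) (by norm_num))
    let a : ℕ → ℝ := fun n => ∫ u, f u ∂ν[|Metric.ball z (r n)]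
    have hstep : ∀ n, dist (a n) (a (n + 1)) ≤ ρ ^ s * (1 + C * Q) * θ ^ n := by
      intro n
      have hr1 : r (n + 1) = r n / 2 := by simp only [r, pow_succ]; ring
      have h1 := h f (3 * R) hf hQ z z (r n) (r (n + 1)) (hr0 _) (by linarith [hr0 n])
        (by linarith) (by simpa using (hr0 n).le) (hsub z hz _ (hrρ n)) (hsub z hz _ (hrρ _))
      rw [Real.dist_eq]
      refine h1.trans (le_of_eq ?_)
      have h2 : r n ^ s = ρ ^ s * θ ^ n := by
        simp only [r]
        rw [Real.mul_rpow hρ.le (by positivity), hθ, ← Real.rpow_natCast, ← Real.rpow_natCast,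
          ← Real.rpow_mul (by norm_num), ← Real.rpow_mul (by norm_num), mul_comm s]
      rw [h2]; ring
    have hlim : Tendsto a atTop (𝓝 (f z)) := by
      have hr : Tendsto r atTop (𝓝 0) := by
        simpa [r] using (tendsto_pow_atTop_nhds_zero_of_lt_one (r := (1 / 2 : ℝ)) (by norm_num)
          (by norm_num)).const_mul ρ
      rw [Metric.tendsto_nhds]
      intro ε hε
      obtain ⟨δ, hδ, hδf⟩ := Metric.continuous_iff.1 hf z (ε / 2) (by positivity)
      filter_upwards [hr.eventually (gt_mem_nhds hδ)] with n hn
      have hB0 := (Metric.measure_ball_pos ν z (hr0 n)).ne'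
      have : IsProbabilityMeasure ν[|Metric.ball z (r n)] :=
        cond_isProbabilityMeasure_of_finite hB0 measure_ball_lt_top.ne
      have h1 : a n - f z = ∫ u, (f u - f z) ∂ν[|Metric.ball z (r n)] := by
        rw [integral_sub (hf.integrable_cond_ball z (hr0 n)) (integrable_const _)]; simp [a]
      rw [Real.dist_eq, h1, ← Real.norm_eq_abs]
      refine (norm_integral_le_of_norm_le_const (C := ε / 2) ?_).trans_lt ?_
      · filter_upwards [ae_cond_mem measurableSet_ball] with u hu
        have := hδf u ((Metric.mem_ball.1 hu).trans hn)
        rw [Real.norm_eq_abs, ← Real.dist_eq]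
        exact this.le
      · rw [measureReal_def, measure_univ]; simpa using hε
    have h3 := dist_le_of_le_geometric_of_tendsto₀ θ _ hθ1 hstep hlim
    simpa [a, r, Real.dist_eq] using h3
  have h1 := hpt x hx'
  have h2 := hpt y hy'
  have h3 := h f (3 * R) hf hQ x y ρ ρ hρ le_rfl (by linarith) le_rfl (hsub x hx' _ le_rfl)
    (hsub y hy' _ le_rfl)
  have h4 : |f x - f y| ≤ 2 * (ρ ^ s * (1 + C * Q) / (1 - θ)) + ρ ^ s * (1 + C * Q) := by
    rw [abs_le] at *
    constructor <;> linarith [h1.1, h1.2, h2.1, h2.2, h3.1, h3.2]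
  refine h4.trans ?_
  have h5 : 1 + C * Q ≤ (1 + C) * (1 + Q) := by nlinarith
  have h6 : 0 ≤ 2 / (1 - θ) + 1 := by have := sub_pos.2 hθ1; positivity
  calc 2 * (ρ ^ s * (1 + C * Q) / (1 - θ)) + ρ ^ s * (1 + C * Q)
      = (2 / (1 - θ) + 1) * ρ ^ s * (1 + C * Q) := by ring
    _ ≤ (2 / (1 - θ) + 1) * ρ ^ s * ((1 + C) * (1 + Q)) := by gcongr
    _ = (2 / (1 - θ) + 1) * (1 + C) * (1 + Q) * ρ ^ s := by ring

end HolderEstimate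

/-! ### Path regularity of fields with Gaussian increments -/

section GaussianRegularity

variable {Ω : Type*} [MeasurableSpace Ω] {P : Measure Ω}

/-- Setting the field to zero on a measurable null set leaves every path continuous and the values
on a countable dense set measurable; all other values are limits of these. Joint measurability,
needed for Tonelli and for a measurable Hölder constant, then follows. -/
lemma exists_measurable_modification {T : Type*} [TopologicalSpace T]
    [TopologicalSpace.SeparableSpace T] [FirstCountableTopology T] [Nonempty T] {Y : T → Ω → ℝ}
    (hm : ∀ x, AEMeasurable (Y x) P) (hc : ∀ᵐ ω ∂P, Continuous fun x => Y x ω) :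
    ∃ Y' : T → Ω → ℝ, (∀ x, Measurable (Y' x)) ∧ (∀ ω, Continuous fun x => Y' x ω) ∧
      ∀ᵐ ω ∂P, ∀ x, Y' x ω = Y x ω := by
  have h1 : ∀ᵐ ω ∂P, (Continuous fun x => Y x ω) ∧
      ∀ n, Y (TopologicalSpace.denseSeq T n) ω = (hm (TopologicalSpace.denseSeq T n)).mk _ ω :=
    hc.and (ae_all_iff.2 fun n => (hm _).ae_eq_mk)
  obtain ⟨N, hN, hNm, hN0⟩ := exists_measurable_superset_of_null (ae_iff.1 h1)
  have hgood : ∀ ω ∉ N, (Continuous fun x => Y x ω) ∧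
      ∀ n, Y (TopologicalSpace.denseSeq T n) ω = (hm (TopologicalSpace.denseSeq T n)).mk _ ω :=
    fun ω hω => by
      by_contra h
      exact hω (hN h)
  have hcont : ∀ ω, Continuous fun x => Nᶜ.indicator (Y x) ω := by
    intro ω
    by_cases hω : ω ∈ N
    · simpa [hω] using continuous_const
    · simpa [hω] using (hgood ω hω).1
  refine ⟨fun x => Nᶜ.indicator (Y x), fun x => ?_, hcont, ?_⟩
  · have hd : ∀ n, Measurable (Nᶜ.indicator (Y (TopologicalSpace.denseSeq T n))) := by
      intro n
      have h2 : Nᶜ.indicator (Y (TopologicalSpace.denseSeq T n)) =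
          Nᶜ.indicator ((hm (TopologicalSpace.denseSeq T n)).mk _) :=
        Set.indicator_congr fun ω hω => (hgood ω hω).2 n
      rw [h2]
      exact (hm _).measurable_mk.indicator hNm.compl
    obtain ⟨z, hz, hzx⟩ := mem_closure_iff_seq_limit.1
      ((TopologicalSpace.denseRange_denseSeq T).closure_range ▸ Set.mem_univ x)
    choose k hk using hz
    refine measurable_of_tendsto_metrizable (fun j => hd (k j)) (tendsto_pi_nhds.2 fun ω => ?_)
    simp_rw [hk]
    exact ((hcont ω).tendsto x).comp hzx
  · have h3 : ∀ᵐ ω ∂P, ω ∉ N := measure_eq_zero_iff_ae_notMem.1 hN0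
    filter_upwards [h3] with ω hω x
    simp [hω]

lemma lintegral_abs_pow_gaussianReal (N : ℕ) (v : ℝ≥0) :
    ∫⁻ x, ENNReal.ofReal (|x| ^ N) ∂(gaussianReal 0 v) =
      ENNReal.ofReal (√v ^ N) * ∫⁻ x, ENNReal.ofReal (|x| ^ N) ∂(gaussianReal 0 1) := by
  have h : gaussianReal 0 v = (gaussianReal 0 1).map (√v * ·) := by
    rw [gaussianReal_map_const_mul, mul_zero, mul_one]
    congr 1
    ext
    simp
  rw [h, lintegral_map (by fun_prop) (by fun_prop), ← lintegral_const_mul _ (by fun_prop)]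
  refine lintegral_congr fun x => ?_
  rw [abs_mul, mul_pow, ENNReal.ofReal_mul (by positivity), abs_of_nonneg (Real.sqrt_nonneg _)]

lemma lintegral_abs_pow_gaussianReal_ne_top (N : ℕ) :
    ∫⁻ x, ENNReal.ofReal (|x| ^ N) ∂(gaussianReal 0 1) ≠ ∞ := by
  have h := (memLp_id_gaussianReal (μ := 0) (v := 1) N).integrable_norm_pow'
  simpa using h.lintegral_lt_top.ne

variable {T : Type*} [NormedAddCommGroup T] [NormedSpace ℝ T] [FiniteDimensional ℝ T]

lemma oscIntegral_eq_lintegral_prod [MeasurableSpace T] [BorelSpace T] (ν : Measure T)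
    [ν.IsAddHaarMeasure] (N : ℕ) (q R : ℝ) {f : T → ℝ} (hf : Continuous f) :
    oscIntegral ν N q R f = ∫⁻ z, ENNReal.ofReal (|f z.1 - f z.2| ^ N / ‖z.1 - z.2‖ ^ q)
      ∂((ν.restrict (Metric.ball 0 R)).prod (ν.restrict (Metric.ball 0 R))) := by
  have := hf.measurable
  rw [lintegral_prod _ (by fun_prop)]
  rfl

/-- The `N`-th absolute moment of an increment is a constant times the `N / 2` power of its
variance, hence `O(‖x - y‖^{σN})` on a ball. For large `N` the functional `oscIntegral` has finite
expectation, so it is almost surely finite and controls the Hölder constant. -/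
lemma exists_holder_of_variance_le [IsProbabilityMeasure P] {Y : T → Ω → ℝ}
    {v : T → T → ℝ≥0} (hm : ∀ x, AEMeasurable (Y x) P)
    (hc : ∀ᵐ ω ∂P, Continuous fun x => Y x ω)
    (hlaw : ∀ x y, P.map (fun ω => Y x ω - Y y ω) = gaussianReal 0 (v x y))
    {s σ : ℝ} (hs : 0 < s) (hsσ : s < σ)
    (hv : ∀ R : ℝ, ∃ C : ℝ, ∀ x y, ‖x‖ < R → ‖y‖ < R → v x y ≤ C * ‖x - y‖ ^ (2 * σ))
    {K : Set T} (hK : IsCompact K) :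
    ∃ A : Ω → ℝ, Measurable A ∧ (∀ ω, 0 < A ω) ∧
      ∀ᵐ ω ∂P, ∀ x ∈ K, ∀ y ∈ K, |Y x ω - Y y ω| ≤ A ω * ‖x - y‖ ^ s := by
  borelize T
  obtain ⟨Y', hY'm, hY'c, hYY'⟩ := exists_measurable_modification hm hc
  have hlaw' : ∀ x y, P.map (fun ω => Y' x ω - Y' y ω) = gaussianReal 0 (v x y) := by
    intro x y
    rw [← hlaw x y]
    refine Measure.map_congr ?_
    filter_upwards [hYY'] with ω hω
    rw [hω, hω]
  have hjoint : Measurable (Function.uncurry Y') :=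
    measurable_uncurry_of_continuous_of_measurable hY'c hY'm
  set m := Module.finrank ℝ T
  -- This makes the exponent `σN - q = (σ - s)N - 2m` nonnegative, so the expected kernel is bounded
  -- up to the diagonal.
  obtain ⟨N, hN⟩ := exists_nat_ge (2 * m / (σ - s) + 1)
  have hσs : 0 < σ - s := sub_pos.2 hsσ
  have hN1 : (1 : ℝ) ≤ N := by
    have : 0 ≤ 2 * m / (σ - s) := by positivity
    linarith
  have hN0 : N ≠ 0 := by rintro rfl; norm_num at hN1
  have hNm : 2 * m ≤ (σ - s) * N := by
    have : 2 * m / (σ - s) ≤ N := by linarith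
    rw [div_le_iff₀ hσs] at this
    linarith
  set q : ℝ := 2 * m + s * N with hq
  have hq0 : 0 < q := by positivity
  let ν : Measure T := Measure.addHaar
  obtain ⟨C₀, hC₀, hgrr⟩ := exists_holder_of_oscIntegral ν hN0 hs
  obtain ⟨R, hR0, hKR⟩ := hK.isBounded.subset_ball_lt 0 (0 : T)
  let Q : Ω → ℝ≥0∞ := fun ω => oscIntegral ν N q (3 * R) fun x => Y' x ω
  have hg : Measurable fun z : Ω × T × T =>
      ENNReal.ofReal (|Y' z.2.1 z.1 - Y' z.2.2 z.1| ^ N / ‖z.2.1 - z.2.2‖ ^ q) := by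
    have h1 : Measurable fun z : Ω × T × T => Y' z.2.1 z.1 :=
      hjoint.comp (measurable_snd.fst.prodMk measurable_fst)
    have h2 : Measurable fun z : Ω × T × T => Y' z.2.2 z.1 :=
      hjoint.comp (measurable_snd.snd.prodMk measurable_fst)
    fun_prop
  have hQprod : ∀ ω, Q ω = ∫⁻ z, ENNReal.ofReal (|Y' z.1 ω - Y' z.2 ω| ^ N / ‖z.1 - z.2‖ ^ q)
      ∂((ν.restrict (Metric.ball 0 (3 * R))).prod (ν.restrict (Metric.ball 0 (3 * R)))) :=
    fun ω => oscIntegral_eq_lintegral_prod ν N q (3 * R) (hY'c ω)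
  have hQm : Measurable Q := by
    rw [funext hQprod]
    exact hg.lintegral_prod_right'
  have hQfin : ∫⁻ ω, Q ω ∂P ≠ ∞ := by
    simp_rw [hQprod]
    rw [lintegral_lintegral_swap hg.aemeasurable]
    obtain ⟨C, hC⟩ := hv (3 * R)
    set M := ∫⁻ x, ENNReal.ofReal (|x| ^ N) ∂(gaussianReal 0 1)
    have hM : M ≠ ∞ := lintegral_abs_pow_gaussianReal_ne_top N
    set b : ℝ := √C ^ N * (6 * R) ^ ((σ - s) * N - 2 * m)
    have hbd : ∀ x y : T, ‖x‖ < 3 * R → ‖y‖ < 3 * R →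
        ∫⁻ ω, ENNReal.ofReal (|Y' x ω - Y' y ω| ^ N / ‖x - y‖ ^ q) ∂P ≤ ENNReal.ofReal b * M := by
      intro x y hx hy
      rcases eq_or_ne x y with rfl | hxy
      · simp [hN0]
      have hr : 0 < ‖x - y‖ := norm_pos_iff.2 (sub_ne_zero.2 hxy)
      have hr2 : ‖x - y‖ ≤ 6 * R := by linarith [norm_sub_le x y]
      have h1 : ∫⁻ ω, ENNReal.ofReal (|Y' x ω - Y' y ω| ^ N) ∂P =
          ENNReal.ofReal (√(v x y) ^ N) * M := by
        rw [← lintegral_abs_pow_gaussianReal, ← hlaw' x y,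
          lintegral_map (f := fun z : ℝ => ENNReal.ofReal (|z| ^ N))
            (g := fun ω => Y' x ω - Y' y ω) (by fun_prop) ((hY'm x).sub (hY'm y))]
      have h2 : √(v x y) ≤ √C * ‖x - y‖ ^ σ := by
        have h3 : ‖x - y‖ ^ (2 * σ) = (‖x - y‖ ^ σ) ^ 2 := by
          rw [← Real.rpow_natCast, ← Real.rpow_mul hr.le]; congr 1; push_cast; ring
        have h4 := Real.sqrt_le_sqrt (hC x y hx hy)
        rwa [h3, Real.sqrt_mul' _ (by positivity), Real.sqrt_sq (by positivity)] at h4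
      have h5 : √(v x y) ^ N / ‖x - y‖ ^ q ≤ b := by
        calc √(v x y) ^ N / ‖x - y‖ ^ q ≤ (√C * ‖x - y‖ ^ σ) ^ N / ‖x - y‖ ^ q := by gcongr
          _ = √C ^ N * ‖x - y‖ ^ ((σ - s) * N - 2 * m) := by
            rw [mul_pow, ← Real.rpow_natCast (‖x - y‖ ^ σ), ← Real.rpow_mul hr.le, mul_div_assoc,
              ← Real.rpow_sub hr]
            congr 2
            rw [hq]; ring
          _ ≤ b := by
            exact mul_le_mul_of_nonneg_left
              (Real.rpow_le_rpow hr.le hr2 (sub_nonneg.2 hNm)) (by positivity)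
      simp_rw [div_eq_mul_inv, mul_comm _ (‖x - y‖ ^ q)⁻¹]
      simp_rw [ENNReal.ofReal_mul (p := (‖x - y‖ ^ q)⁻¹) (by positivity)]
      have hmeas : Measurable fun ω => ENNReal.ofReal (|Y' x ω - Y' y ω| ^ N) := by
        have := hY'm x
        have := hY'm y
        fun_prop
      rw [lintegral_const_mul _ hmeas, h1, ← mul_assoc, ← ENNReal.ofReal_mul (by positivity),
        mul_comm _ (√(v x y) ^ N), ← div_eq_mul_inv]
      gcongr
    rw [Measure.prod_restrict]
    refine ((setLIntegral_mono' (g := fun _ => ENNReal.ofReal b * M)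
      (measurableSet_ball.prod measurableSet_ball) fun z hz => ?_).trans_lt ?_).ne
    · exact hbd z.1 z.2 (mem_ball_zero_iff.1 hz.1) (mem_ball_zero_iff.1 hz.2)
    · rw [setLIntegral_const, Measure.prod_prod]
      exact ENNReal.mul_lt_top (ENNReal.mul_lt_top ENNReal.ofReal_lt_top hM.lt_top)
        (ENNReal.mul_lt_top measure_ball_lt_top measure_ball_lt_top)
  refine ⟨fun ω => C₀ * (1 + (Q ω).toReal), by fun_prop, fun ω => by positivity, ?_⟩
  filter_upwards [ae_lt_top hQm hQfin, hYY'] with ω hω hω' x hx y hy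
  rw [← hω' x, ← hω' y]
  exact hgrr _ R (hY'c ω) hω.ne x (hKR hx) y (hKR hy)

/-- The Gaussian density is at most `1 / √v`. -/
lemma gaussianReal_Icc_le {v : ℝ≥0} (hv : v ≠ 0) (ε : ℝ) :
    gaussianReal 0 v (Set.Icc (-ε) ε) ≤ ENNReal.ofReal (2 * ε / √v) := by
  rw [gaussianReal_apply 0 hv]
  have hv' : 0 < (v : ℝ) := by positivity
  have h1 : ∀ x, gaussianPDF 0 v x ≤ ENNReal.ofReal (1 / √v) := by
    intro x
    rw [gaussianPDF_def]
    refine ENNReal.ofReal_le_ofReal ?_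
    rw [gaussianPDFReal_def, ← one_div]
    have h2 : Real.exp (-(x - 0) ^ 2 / (2 * v)) ≤ 1 := by
      rw [Real.exp_le_one_iff]
      exact div_nonpos_of_nonpos_of_nonneg (neg_nonpos.2 (sq_nonneg _)) (by positivity)
    have h3 : √(v : ℝ) ≤ √(2 * Real.pi * v) := by
      apply Real.sqrt_le_sqrt
      nlinarith [Real.pi_gt_three]
    calc 1 / √(2 * Real.pi * v) * Real.exp (-(x - 0) ^ 2 / (2 * v)) ≤ 1 / √v * 1 := by gcongr
      _ = 1 / √v := mul_one _
  refine (lintegral_mono h1).trans ?_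
  rw [lintegral_const, Measure.restrict_apply_univ, Real.volume_Icc,
    ← ENNReal.ofReal_mul (by positivity)]
  exact ENNReal.ofReal_le_ofReal (le_of_eq (by ring))

/-- At a fixed base point, an `s`-Hölder bound for all small `h` forces each single increment to be
`O(h^s)` although its standard deviation is at least a multiple of `h^σ`. This has probability
`O(h^{s-σ})` for every small `h`, hence zero. Base points in a dense sequence, integer constants and
scales `1/(n+1)` reduce the claim to countably many such events. -/
lemma ae_not_holder_of_le_variance {T : Type*} [NormedAddCommGroup T] [NormedSpace ℝ T]
    [TopologicalSpace.SeparableSpace T] {Y : T → Ω → ℝ}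
    {v : T → T → ℝ≥0} (hm : ∀ x, AEMeasurable (Y x) P)
    (hlaw : ∀ x y, P.map (fun ω => Y x ω - Y y ω) = gaussianReal 0 (v x y))
    {s σ c : ℝ} (hσs : σ < s) (hc : 0 < c) (w : T)
    (hv : ∀ x, ∀ᶠ h in 𝓝[>] (0 : ℝ), c * h ^ (2 * σ) ≤ v (x + h • w) x) :
    ∀ᵐ ω ∂P, ∀ K : Set T, IsCompact K → (interior K).Nonempty →
      ¬ ∃ A : ℝ, ∀ x ∈ K, ∀ y ∈ K, |Y x ω - Y y ω| ≤ A * ‖x - y‖ ^ s := by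
  have key : ∀ (x : T) (A n : ℕ), ∀ᵐ ω ∂P, ¬ ∀ h : ℝ, 0 < h → h < 1 / ((n : ℝ) + 1) →
      |Y (x + h • w) ω - Y x ω| ≤ A * ‖w‖ ^ s * h ^ s := by
    intro x A n
    rw [ae_iff]
    simp only [not_not]
    set b : ℝ := 2 * (A * ‖w‖ ^ s) / √c
    have hlim : Tendsto (fun h : ℝ => ENNReal.ofReal (b * h ^ (s - σ))) (𝓝[>] 0) (𝓝 0) := by
      have h1 : Tendsto (fun h : ℝ => b * h ^ (s - σ)) (𝓝[>] 0) (𝓝 0) := by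
        have h2 := ((Real.continuousAt_rpow_const (0 : ℝ) (s - σ)
          (Or.inr (sub_pos.2 hσs).le)).tendsto.mono_left
            (nhdsWithin_le_nhds (s := Set.Ioi 0))).const_mul b
        simpa [Real.zero_rpow (sub_pos.2 hσs).ne'] using h2
      simpa using ENNReal.tendsto_ofReal h1
    refine le_antisymm (ge_of_tendsto hlim ?_) bot_le
    have hn : ∀ᶠ h : ℝ in 𝓝[>] 0, h < 1 / ((n : ℝ) + 1) :=
      (gt_mem_nhds (by positivity)).filter_mono nhdsWithin_le_nhds
    filter_upwards [hv x, hn, self_mem_nhdsWithin] with h h1 h2 h3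
    have h3 : 0 < h := h3
    have hvpos : 0 < (v (x + h • w) x : ℝ) := lt_of_lt_of_le (by positivity) h1
    have hv0 : v (x + h • w) x ≠ 0 := by
      intro h4; rw [h4] at hvpos; simp at hvpos
    have h4 : √c * h ^ σ ≤ √(v (x + h • w) x) := by
      have h5 : h ^ (2 * σ) = (h ^ σ) ^ 2 := by
        rw [← Real.rpow_natCast, ← Real.rpow_mul h3.le]; congr 1; push_cast; ring
      have h6 := Real.sqrt_le_sqrt h1
      rwa [h5, Real.sqrt_mul' _ (by positivity), Real.sqrt_sq (by positivity)] at h6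
    set ε : ℝ := A * ‖w‖ ^ s * h ^ s
    calc P {ω | ∀ h : ℝ, 0 < h → h < 1 / ((n : ℝ) + 1) →
          |Y (x + h • w) ω - Y x ω| ≤ A * ‖w‖ ^ s * h ^ s}
        ≤ P ((fun ω => Y (x + h • w) ω - Y x ω) ⁻¹' Set.Icc (-ε) ε) :=
          measure_mono fun ω hω => abs_le.1 (hω h h3 h2)
      _ = gaussianReal 0 (v (x + h • w) x) (Set.Icc (-ε) ε) := by
          rw [← hlaw, Measure.map_apply_of_aemeasurable (f := fun ω => Y (x + h • w) ω - Y x ω)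
            ((hm _).sub (hm _)) measurableSet_Icc]
      _ ≤ ENNReal.ofReal (2 * ε / √(v (x + h • w) x)) := gaussianReal_Icc_le hv0 ε
      _ ≤ ENNReal.ofReal (b * h ^ (s - σ)) := by
          refine ENNReal.ofReal_le_ofReal ?_
          calc 2 * ε / √(v (x + h • w) x) ≤ 2 * ε / (√c * h ^ σ) := by gcongr
            _ = b * h ^ (s - σ) := by
              rw [Real.rpow_sub h3]
              simp only [ε, b]
              field_simp
  have hall : ∀ᵐ ω ∂P, ∀ i A n : ℕ, ¬ ∀ h : ℝ, 0 < h → h < 1 / ((n : ℝ) + 1) →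
      |Y (TopologicalSpace.denseSeq T i + h • w) ω - Y (TopologicalSpace.denseSeq T i) ω| ≤
        A * ‖w‖ ^ s * h ^ s :=
    ae_all_iff.2 fun i => ae_all_iff.2 fun A => ae_all_iff.2 fun n => key _ A n
  filter_upwards [hall] with ω hω K _ hKi
  rintro ⟨A, hA⟩
  obtain ⟨_, hx, i, rfl⟩ :=
    (TopologicalSpace.denseRange_denseSeq T).inter_open_nonempty _ isOpen_interior hKi
  set x := TopologicalSpace.denseSeq T i
  obtain ⟨A', hA'⟩ := exists_nat_ge A
  have h1 : ∀ᶠ h : ℝ in 𝓝 0, x + h • w ∈ interior K := by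
    have h2 : Continuous fun h : ℝ => x + h • w := by fun_prop
    exact h2.continuousAt.eventually_mem (by simpa using isOpen_interior.mem_nhds hx)
  obtain ⟨δ, hδ, hδK⟩ := Metric.eventually_nhds_iff.1 h1
  obtain ⟨n, hn⟩ := exists_nat_one_div_lt hδ
  refine hω i A' n fun h h0 hh => ?_
  have h3 : x + h • w ∈ interior K := hδK (by
    rw [Real.dist_eq, sub_zero, abs_of_pos h0]; exact hh.trans hn)
  refine (hA _ (interior_subset h3) _ (interior_subset hx)).trans ?_
  rw [add_sub_cancel_left, norm_smul, Real.norm_eq_abs, abs_of_pos h0,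
    Real.mul_rpow h0.le (norm_nonneg _), mul_assoc, mul_comm (‖w‖ ^ s)]
  gcongr

end GaussianRegularity

/-! ### From scaling of the variance to critical exponents -/

section CriticalExponents

variable {Ω : Type*} [MeasurableSpace Ω] {P : Measure Ω} {d : ℕ} {E : Matrix (Fin d) (Fin d) ℝ}
  {b H : ℝ} {V : EuclideanSpace ℝ (Fin d) → ℝ≥0∞}

lemma hasHolderCriticalExponent_of_variance [IsProbabilityMeasure P] {T : Type*}
    [NormedAddCommGroup T] [NormedSpace ℝ T] [FiniteDimensional ℝ T] {Y : T → Ω → ℝ}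
    {v : T → T → ℝ≥0} (hm : ∀ x, AEMeasurable (Y x) P)
    (hc : ∀ᵐ ω ∂P, Continuous fun x => Y x ω)
    (hlaw : ∀ x y, P.map (fun ω => Y x ω - Y y ω) = gaussianReal 0 (v x y))
    {γ : ℝ} (hγ0 : 0 < γ) (hγ1 : γ < 1)
    (hupper : ∀ σ, 0 < σ → σ < γ → ∀ R : ℝ, ∃ C : ℝ, ∀ x y, ‖x‖ < R → ‖y‖ < R →
      v x y ≤ C * ‖x - y‖ ^ (2 * σ))
    (hlower : ∀ σ, γ < σ → ∃ (w : T) (c : ℝ), 0 < c ∧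
      ∀ x, ∀ᶠ h in 𝓝[>] (0 : ℝ), c * h ^ (2 * σ) ≤ v (x + h • w) x) :
    HasHolderCriticalExponent Y P γ where
  pos := hγ0
  lt_one := hγ1
  holder s hs hsγ K hK := by
    obtain ⟨σ, hσ1, hσ2⟩ := exists_between hsγ
    exact exists_holder_of_variance_le hm hc hlaw hs hσ1 (hupper σ (hs.trans hσ1) hσ2) hK
  not_holder s hγs _ := by
    obtain ⟨σ, hσ1, hσ2⟩ := exists_between hγs
    obtain ⟨w, c, hc0, hv⟩ := hlower σ hσ1
    exact ae_not_holder_of_le_variance hm hlaw hσ2 hc0 w hv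

namespace IsScalingVariance

lemma exists_le_of_norm_le (hV : IsScalingVariance E H V) (hE : IsContracting E b) (hb : 0 < b)
    (R : ℝ) : ∃ B : ℝ≥0, ∀ x, ‖x‖ ≤ R → V x ≤ B := by
  obtain ⟨B, hB⟩ := hV.bounded
  obtain ⟨C, hC, h⟩ := hE
  have h1 : Tendsto (fun t : ℝ => C * Real.exp (-(b * t)) * R) atTop (𝓝 0) := by
    have h2 : Tendsto (fun t : ℝ => Real.exp (-(b * t))) atTop (𝓝 0) :=
      Real.tendsto_exp_neg_atTop_nhds_zero.comp (tendsto_id.const_mul_atTop hb)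
    simpa using (h2.const_mul C).mul_const R
  obtain ⟨t, ht0, ht⟩ := ((eventually_ge_atTop (0 : ℝ)).and
    (h1.eventually_lt_const zero_lt_one)).exists
  refine ⟨(Real.exp (2 * H * t)).toNNReal * B, fun x hx => ?_⟩
  have h3 := hV.hom t (flow E (-t) x)
  rw [expFlow_apply_expFlow_neg] at h3
  have h4 : ‖flow E (-t) x‖ ≤ 1 :=
    (h t ht0 x).trans (le_trans (by gcongr) ht.le)
  rw [h3, ENNReal.coe_mul]
  exact mul_le_mul' le_rfl (hB _ h4)

lemma ne_top (hV : IsScalingVariance E H V) (hE : IsContracting E b) (hb : 0 < b)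
    (x : EuclideanSpace ℝ (Fin d)) : V x ≠ ∞ := by
  obtain ⟨B, hB⟩ := hV.exists_le_of_norm_le hE hb ‖x‖
  exact ((hB x le_rfl).trans_lt ENNReal.coe_lt_top).ne

lemma toReal_flow (hV : IsScalingVariance E H V) (t : ℝ) (x : EuclideanSpace ℝ (Fin d)) :
    (V (flow E t x)).toReal = Real.exp (2 * H * t) * (V x).toReal := by
  rw [hV.hom, ENNReal.toReal_mul, ENNReal.toReal_ofReal (Real.exp_pos _).le]

lemma zero (hV : IsScalingVariance E H V) (hH : 0 < H) : (V 0).toReal = 0 := by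
  have h := hV.toReal_flow 1 0
  rw [map_zero] at h
  have h1 : 1 < Real.exp (2 * H * 1) := by
    rw [Real.one_lt_exp_iff]; linarith
  by_contra h0
  rw [eq_comm, mul_eq_right₀ h0] at h
  linarith

/-- Exponential growth of the orbits bounds the variance from above. -/
lemma toReal_le_rpow (hV : IsScalingVariance E H V) (hE : IsContracting E b) (hb : 0 < b)
    (hH : 0 < H) {α G : ℝ} (hα : 0 < α) (R : ℝ) :
    ∃ C : ℝ, ∀ x, (∀ t, 0 ≤ t → ‖flow E t x‖ ≤ G * Real.exp (α * t) * ‖x‖) → ‖x‖ ≤ R →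
      (V x).toReal ≤ C * ‖x‖ ^ (2 * (H / α)) := by
  obtain ⟨B, hB⟩ := hV.exists_le_of_norm_le hE hb (max G R)
  have hB' : ∀ x, ‖x‖ ≤ max G R → (V x).toReal ≤ B := fun x hx =>
    ENNReal.toReal_mono ENNReal.coe_ne_top (hB x hx)
  refine ⟨B, fun x hx hxR => ?_⟩
  rcases eq_or_ne x 0 with rfl | hx0
  · rw [hV.zero hH]; positivity
  have hn : 0 < ‖x‖ := norm_pos_iff.2 hx0
  rcases le_total ‖x‖ 1 with h1 | h1
  -- At this time `e^{αt} ‖x‖ = 1`, so the orbit has norm at most `G`, while scaling has multiplied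
  -- the variance by `‖x‖^{-2H/α}`.
  · set t := -Real.log ‖x‖ / α
    have ht : 0 ≤ t := div_nonneg (neg_nonneg.2 (Real.log_nonpos hn.le h1)) hα.le
    have hαt : α * t = -Real.log ‖x‖ := by simp only [t]; field_simp
    have h2 : ‖flow E t x‖ ≤ G := by
      refine (hx t ht).trans (le_of_eq ?_)
      rw [hαt, Real.exp_neg, Real.exp_log hn, mul_assoc, inv_mul_cancel₀ hn.ne', mul_one]
    have h3 := hB' _ (h2.trans (le_max_left _ _))
    rw [hV.toReal_flow] at h3
    have h4 : ‖x‖ ^ (2 * (H / α)) = Real.exp (-(2 * H * t)) := by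
      rw [Real.rpow_def_of_pos hn]
      congr 1
      simp only [t]
      ring
    rw [h4, Real.exp_neg, ← div_eq_mul_inv, le_div_iff₀' (Real.exp_pos _)]
    exact h3
  · refine (hB' x (hxR.trans (le_max_right _ _))).trans ?_
    exact le_mul_of_one_le_right B.2 (Real.one_le_rpow h1 (by positivity))

/-- Exponential growth of an orbit bounds the variance in its direction from below. -/
lemma exists_rpow_le_toReal (hV : IsScalingVariance E H V) (hE : IsContracting E b) (hb : 0 < b)
    (hH : 0 < H) {α c : ℝ} (hα : 0 < α) (hc : 0 < c) {u : EuclideanSpace ℝ (Fin d)}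
    (hu : ∀ t, 0 ≤ t → c * Real.exp (α * t) ≤ ‖flow E t u‖) :
    ∃ k : ℝ, 0 < k ∧ ∀ᶠ h in 𝓝[>] (0 : ℝ), k * h ^ (2 * (H / α)) ≤ (V (h • u)).toReal := by
  obtain ⟨m, hm, hVm⟩ := hV.lower
  -- A point outside the unit ball is reached from the unit sphere by flowing forward in time, which
  -- only increases the variance.
  have hlow : ∀ x, 1 ≤ ‖x‖ → m ≤ (V x).toReal := by
    intro x hx
    obtain ⟨t, ht, ht1⟩ := hE.exists_norm_eq hb one_pos hx
    have h1 := (ENNReal.ofReal_le_iff_le_toReal (hV.ne_top hE hb _)).1 (hVm _ ht1)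
    have h2 := hV.toReal_flow t (flow E (-t) x)
    rw [expFlow_apply_expFlow_neg] at h2
    rw [h2]
    have h3 : 1 ≤ Real.exp (2 * H * t) := Real.one_le_exp (by positivity)
    nlinarith
  refine ⟨m * c ^ (2 * (H / α)), by positivity, ?_⟩
  have hsmall : ∀ᶠ h : ℝ in 𝓝[>] 0, h < 1 / c :=
    (gt_mem_nhds (by positivity)).filter_mono nhdsWithin_le_nhds
  filter_upwards [hsmall, self_mem_nhdsWithin] with h hh h0
  have h0 : 0 < h := h0
  have hch : 0 < c * h := by positivity
  have hch1 : c * h ≤ 1 := by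
    rw [lt_div_iff₀ hc] at hh; linarith
  -- Now `c h e^{αt} = 1`, so the orbit of `h • u` has left the open unit ball.
  set t := -Real.log (c * h) / α
  have ht : 0 ≤ t := div_nonneg (neg_nonneg.2 (Real.log_nonpos hch.le hch1)) hα.le
  have hαt : α * t = -Real.log (c * h) := by simp only [t]; field_simp
  have h1 : 1 ≤ ‖flow E t (h • u)‖ := by
    rw [map_smul, norm_smul, Real.norm_eq_abs, abs_of_pos h0]
    have h2 := hu t ht
    rw [hαt, Real.exp_neg, Real.exp_log hch] at h2
    calc (1 : ℝ) = h * (c * (c * h)⁻¹) := by field_simp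
      _ ≤ h * ‖flow E t u‖ := by gcongr
  have h3 := hlow _ h1
  rw [hV.toReal_flow] at h3
  have h4 : c ^ (2 * (H / α)) * h ^ (2 * (H / α)) = Real.exp (-(2 * H * t)) := by
    rw [← Real.mul_rpow hc.le h0.le, Real.rpow_def_of_pos hch]
    congr 1
    simp only [t]
    ring
  rw [mul_assoc, h4, Real.exp_neg, ← div_eq_mul_inv, div_le_iff₀' (Real.exp_pos _)]
  exact h3

variable {p : ℕ} {a : Fin (p + 1) → ℝ} {Y : EuclideanSpace ℝ (Fin d) → Ω → ℝ}

/-- The rate `α = H / σ` satisfies `H / α = σ` and lies below `a i`, so it is an admissible growth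
rate for `u`, with loss `ε = a i - H / σ`. -/
lemma exists_le_of_mem_iSup_lt (hV : IsScalingVariance E H V) (hE : IsContracting E b)
    (hb : 0 < b) (hH : 0 < H) (ha_mono : StrictMono a) (ha_range : Set.range a = realSpectrum E)
    {i : Fin (p + 1)} (hai : 0 < a i) {u : EuclideanSpace ℝ (Fin d)}
    (hu : u ∉ ⨆ j < i, spectralSubspace E (a j)) {σ : ℝ} (hσ : H / a i < σ) :
    ∃ k : ℝ, 0 < k ∧ ∀ᶠ h in 𝓝[>] (0 : ℝ), k * h ^ (2 * σ) ≤ (V (h • u)).toReal := by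
  have hσ0 : 0 < σ := lt_trans (by positivity) hσ
  have hα : H / σ < a i := by
    rw [div_lt_iff₀ hai] at hσ
    rw [div_lt_iff₀ hσ0]; linarith
  obtain ⟨c, hc, h⟩ := exists_le_norm_flow ha_mono ha_range i hu (sub_pos.2 hα)
  rw [sub_sub_cancel] at h
  obtain ⟨k, hk, h1⟩ := hV.exists_rpow_le_toReal hE hb hH (div_pos hH hσ0) hc h
  rw [div_div_cancel₀ hH.ne'] at h1
  exact ⟨k, hk, h1⟩

/-- For the whole field, the upper bound uses growth of the full flow at rate `H / σ > a_p`, and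
irregularity is detected along one vector outside `W_{p-1}`. On the line spanned by `u` both bounds
use the orbit of `u` alone: membership in `W_i` bounds its growth from above, and lying outside
`W_{i-1}` bounds it from below. -/
theorem regularity [IsProbabilityMeasure P] (hV : IsScalingVariance E H V)
    (hE : IsContracting E b) (hb : 0 < b) (ha_mono : StrictMono a)
    (ha_range : Set.range a = realSpectrum E) (hH : 0 < H) (hHa : H < a 0)
    (hm : ∀ x, AEMeasurable (Y x) P) (hc : ∀ᵐ ω ∂P, Continuous fun x => Y x ω)
    (hlaw : ∀ x y, P.map (fun ω => Y x ω - Y y ω) = gaussianReal 0 (V (x - y)).toNNReal) :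
    HasHolderCriticalExponent Y P (H / a (Fin.last p)) ∧
      ∀ (i : Fin (p + 1)) (u : EuclideanSpace ℝ (Fin d)), ‖u‖ = 1 →
        u ∈ (⨆ j ≤ i, spectralSubspace E (a j)) → u ∉ (⨆ j < i, spectralSubspace E (a j)) →
        HasDirectionalRegularity Y P u (H / a i) := by
  have hHi : ∀ i, H < a i := fun i => hHa.trans_le (ha_mono.monotone (Fin.zero_le i))
  have hai : ∀ i, 0 < a i := fun i => hH.trans (hHi i)
  have hγ0 : ∀ i, 0 < H / a i := fun i => div_pos hH (hai i)
  have hγ1 : ∀ i, H / a i < 1 := fun i => (div_lt_one (hai i)).2 (hHi i)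
  have hα : ∀ i σ, 0 < σ → σ < H / a i → a i < H / σ := by
    intro i σ hσ0 hσ
    rw [lt_div_iff₀ (hai i)] at hσ
    rw [lt_div_iff₀ hσ0]; linarith
  constructor
  · refine hasHolderCriticalExponent_of_variance hm hc hlaw (hγ0 _) (hγ1 _) ?_ ?_
    · intro σ hσ0 hσ R
      obtain ⟨G, _, hG⟩ := exists_norm_flow_le ha_mono ha_range (sub_pos.2 (hα _ σ hσ0 hσ))
      rw [add_sub_cancel] at hG
      obtain ⟨C, hC⟩ := hV.toReal_le_rpow hE hb hH (G := G) (div_pos hH hσ0) (2 * R)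
      rw [div_div_cancel₀ hH.ne'] at hC
      exact ⟨C, fun x y hx hy => hC _ (fun t ht => hG t ht _)
        (by linarith [norm_sub_le x y])⟩
    · intro σ hσ
      obtain ⟨u, hu⟩ := exists_not_mem_iSup_lt ha_mono ha_range (Fin.last p)
      obtain ⟨k, hk, h⟩ := hV.exists_le_of_mem_iSup_lt hE hb hH ha_mono ha_range (hai _) hu hσ
      refine ⟨u, k, hk, fun x => ?_⟩
      simp_rw [add_sub_cancel_left]
      exact h
  · intro i u hu1 hu hu'
    have hcont : Continuous fun t : ℝ => t • u := by fun_prop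
    refine hasHolderCriticalExponent_of_variance (v := fun s t => (V (s • u - t • u)).toNNReal)
      (fun t => hm (t • u)) (hc.mono fun ω hω => hω.comp hcont) (fun s t => hlaw _ _)
      (hγ0 i) (hγ1 i) ?_ ?_
    · intro σ hσ0 hσ R
      obtain ⟨G, hG⟩ := exists_norm_flow_le_of_mem ha_mono i hu (sub_pos.2 (hα _ σ hσ0 hσ))
      rw [add_sub_cancel] at hG
      obtain ⟨C, hC⟩ := hV.toReal_le_rpow hE hb hH (G := G) (div_pos hH hσ0) (2 * R)
      rw [div_div_cancel₀ hH.ne'] at hC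
      refine ⟨C, fun x y hx hy => ?_⟩
      have hn : ‖x • u - y • u‖ = ‖x - y‖ := by rw [← sub_smul, norm_smul, hu1, mul_one]
      have h1 := hC (x • u - y • u) (fun t ht => ?_)
        (by rw [hn]; linarith [norm_sub_le x y])
      · rw [hn] at h1
        exact h1
      · rw [hn, ← sub_smul, map_smul, norm_smul, mul_comm]
        gcongr
        exact hG t ht
    · intro σ hσ
      obtain ⟨k, hk, h⟩ := hV.exists_le_of_mem_iSup_lt hE hb hH ha_mono ha_range (hai _) hu' hσ
      refine ⟨1, k, hk, fun x => ?_⟩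
      have h1 : ∀ t : ℝ, (x + t • (1 : ℝ)) • u - x • u = t • u := fun t => by
        rw [smul_eq_mul, mul_one, ← sub_smul, add_sub_cancel_left]
      simp_rw [h1]
      exact h

end IsScalingVariance

/-- Law of the increments of a field given by stochastic integrals. -/
lemma IsIsotropicNoise.law_increments [IsProbabilityMeasure P] {S T 𝕜 : Type*} [MeasurableSpace S]
    [RCLike 𝕜] [MeasurableSpace 𝕜] [BorelSpace 𝕜] {M : Set S → Ω → 𝕜} {μ : Measure S}
    (hM : IsIsotropicNoise M μ P) {f : T → S → 𝕜}
    (hf : ∀ x, AEStronglyMeasurable (f x) μ) (hfin : ∀ x, ∫⁻ y, ‖f x y‖ₑ ^ 2 ∂μ ≠ ∞)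
    {Y : T → Ω → ℝ} (hY : ∀ x, Y x =ᵐ[P] fun ω => RCLike.re (stochIntegral M μ P (f x) ω)) :
    (∀ x, AEMeasurable (Y x) P) ∧ ∀ x y, P.map (fun ω => Y x ω - Y y ω) =
      gaussianReal 0 (∫⁻ z, ‖f x z - f y z‖ₑ ^ 2 ∂μ).toNNReal := by
  have hmem : ∀ x, MemLp (f x) 2 μ := by
    refine fun x => ⟨hf x, ?_⟩
    have h := hfin x
    rw [← eLpNorm_two_sq] at h
    exact lt_top_iff_ne_top.2 fun h' => h (by rw [h']; simp)
  have hI := fun x => hM.isStochIntegral_stochIntegral (hmem x)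
  refine ⟨fun x => ?_, fun x y => ?_⟩
  · have h := (hI x).2.1.1.aemeasurable
    exact AEMeasurable.congr (by fun_prop) (hY x).symm
  · rw [← hM.map_sub_of_isStochIntegral (hI x) (hI y)]
    refine Measure.map_congr ?_
    filter_upwards [hY x, hY y] with ω h1 h2
    rw [h1, h2]

end CriticalExponents

/-! ### Application to the two fields -/

lemma pos_of_range_eq_realSpectrum {d p : ℕ} {E : Matrix (Fin d) (Fin d) ℝ} {a : Fin (p + 1) → ℝ}
    (ha_range : Set.range a = realSpectrum E) : 0 < d := by
  obtain ⟨x, -, hx⟩ := exists_mem_spectralSubspace ha_range 0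
  rcases Nat.eq_zero_or_pos d with rfl | h
  · exact absurd (Subsingleton.elim _ _) hx
  · exact h

lemma isContracting_of_lt {d p : ℕ} {E : Matrix (Fin d) (Fin d) ℝ} {a : Fin (p + 1) → ℝ}
    (ha_mono : StrictMono a) (ha_range : Set.range a = realSpectrum E) {b : ℝ} (hb : b < a 0) :
    IsContracting E b := by
  obtain ⟨C, hC, h⟩ := exists_norm_flow_neg_le ha_mono ha_range (sub_pos.2 hb)
  refine ⟨C, hC, fun t ht x => (h t ht x).trans (le_of_eq ?_)⟩
  congr 3
  ring

end OSSRF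

end
/-- Hölder critical exponent and directional regularity of Gaussian operator scaling fields. The
distinct real parts of the eigenvalues of `E` are `a 0 < a 1 < ... < a p`; the noises have control
measure `c` times Lebesgue measure, with an arbitrary normalization `c > 0`. -/
theorem theorem5p1 {d p : ℕ} (E : Matrix (Fin d) (Fin d) ℝ) (a : Fin (p + 1) → ℝ)
    (ha_mono : StrictMono a) (ha_range : Set.range a = OSSRF.realSpectrum E)
    (ha_pos : ∀ i, 0 < a i)
    {Ω : Type*} [MeasurableSpace Ω] (P : Measure Ω) [IsProbabilityMeasure P]
    (c : ℝ≥0) (hc : c ≠ 0) :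
    (∀ (β H : ℝ) (φ : EuclideanSpace ℝ (Fin d) → ℝ)
        (Z : Set (EuclideanSpace ℝ (Fin d)) → Ω → ℝ),
      OSSRF.IsHomogeneous E φ → OSSRF.IsAdmissible β E φ →
      0 < H → H < β → H ≠ E.trace / 2 →
      OSSRF.IsGaussianRandomMeasure Z (c • volume) P →
      ∀ Y : EuclideanSpace ℝ (Fin d) → Ω → ℝ,
        OSSRF.IsContinuousVersion Y (OSSRF.movingAverageField E H φ Z (c • volume) P) P →
        OSSRF.HasHolderCriticalExponent Y P (H / a (Fin.last p)) ∧
        ∀ (i : Fin (p + 1)) (u : EuclideanSpace ℝ (Fin d)), ‖u‖ = 1 →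
          u ∈ (⨆ j ≤ i, OSSRF.spectralSubspace E (a j)) →
          u ∉ (⨆ j < i, OSSRF.spectralSubspace E (a j)) →
          OSSRF.HasDirectionalRegularity Y P u (H / a i)) ∧
    (∀ (H : ℝ) (ψ : EuclideanSpace ℝ (Fin d) → ℝ)
        (W : Set (EuclideanSpace ℝ (Fin d)) → Ω → ℂ),
      Continuous ψ → OSSRF.IsHomogeneous E.transpose ψ → (∀ x, 0 ≤ ψ x) →
      (∀ x, x ≠ 0 → 0 < ψ x) →
      0 < H → H < a 0 →
      OSSRF.IsIsotropicGaussianRandomMeasure W (c • volume) P →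
      ∀ Y : EuclideanSpace ℝ (Fin d) → Ω → ℝ,
        OSSRF.IsContinuousVersion Y (OSSRF.harmonizableField E H ψ W (c • volume) P) P →
        OSSRF.HasHolderCriticalExponent Y P (H / a (Fin.last p)) ∧
        ∀ (i : Fin (p + 1)) (u : EuclideanSpace ℝ (Fin d)), ‖u‖ = 1 →
          u ∈ (⨆ j ≤ i, OSSRF.spectralSubspace E (a j)) →
          u ∉ (⨆ j < i, OSSRF.spectralSubspace E (a j)) →
          OSSRF.HasDirectionalRegularity Y P u (H / a i)) := by
  obtain ⟨b, hb, hba⟩ := exists_between (ha_pos 0)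
  have hd := OSSRF.pos_of_range_eq_realSpectrum ha_range
  have hμ : ((c • volume : Measure (EuclideanSpace ℝ (Fin d)))).IsAddHaarMeasure :=
    Measure.IsAddHaarMeasure.smul volume (by simpa using hc) (by simp)
  constructor
  · intro β H φ Z hhom hadm hH hHβ hHq hZ Y hY
    have hE := OSSRF.isContracting_of_lt ha_mono ha_range hba
    have hφ := hE.isGauge hb hadm.continuous hadm.pos hhom hd
    obtain ⟨x₀, hx₀, hx₀0⟩ := OSSRF.exists_mem_spectralSubspace ha_range 0
    have hx₀' : x₀ ∈ ⨆ j ≤ (0 : Fin (p + 1)), OSSRF.spectralSubspace E (a j) :=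
      Submodule.mem_iSup_of_mem 0 (Submodule.mem_iSup_of_mem le_rfl hx₀)
    -- This supplies `H < a 0`, so that all the exponents `H / a i` are below one.
    have hβ : β ≤ a 0 := hadm.le_of_growth hφ hE hb (ha_pos 0) hx₀0 fun ε hε =>
      OSSRF.exists_norm_flow_le_of_mem ha_mono 0 hx₀' hε
    have hV := OSSRF.isScalingVariance_maKernel (c • volume) hd hφ hadm hE hb hH hHβ hHq
    obtain ⟨hm, hlaw⟩ := hZ.isIsotropicNoise.law_increments
      (fun x => (OSSRF.measurable_maKernel hφ (H - E.trace / 2) x).aestronglyMeasurable)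
      (fun x => hV.ne_top hE hb x) (Y := Y) hY.1
    -- Translation invariance of the control measure makes the variance of an increment a function
    -- of `x - y`.
    simp_rw [OSSRF.lintegral_maKernel_sub] at hlaw
    exact hV.regularity hE hb ha_mono ha_range hH (hHβ.trans_le hβ) hm hY.2 hlaw
  · intro H ψ W hc' hhom _ hpos hH hHa hW Y hY
    -- Here the contraction rate must exceed `H`, since integrability of the kernel at the origin
    -- depends on it; the moving average needs only some positive rate.
    obtain ⟨b', hb', hba'⟩ := exists_between hHa
    have hE := OSSRF.isContracting_of_lt ha_mono ha_range hba'
    have hb0 : 0 < b' := hH.trans hb'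
    have hψ := hE.transpose.isGauge hb0 hc' hpos hhom hd
    have hV := OSSRF.isScalingVariance_harmKernel (c • volume) hd hψ hE hb0 hH hb'
    obtain ⟨hm, hlaw⟩ := hW.isIsotropicNoise.law_increments
      (fun x => (OSSRF.measurable_harmKernel hψ (-H - E.trace / 2) x).aestronglyMeasurable)
      (fun x => hV.ne_top hE hb0 x) (Y := Y) hY.1
    -- The difference of two kernels is the kernel at `x - y` times a factor of modulus one.
    simp_rw [OSSRF.lintegral_harmKernel_sub] at hlaw
    exact hV.regularity hE hb0 ha_mono ha_range hH hHa hm hY.2 hlaw
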